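/- **Definitions.** A *boron tree* is a finite connected acyclic graph $G$ all of whose vertices have degree $1$ or $3$. Choose an edge $\{a,b\}$ of $G$, and let $T$ be the binary tree rooted at a new vertex $r$, obtained from $G$ by replacing the edge $\{a,b\}$ with the two edges $\{a,r\},\{r,b\}$. Choose a linear ordering of the children of each vertex of $T$, and let $\prec$ be the induced lexicographical ordering of the set $C$ of leaves of $G$. For $x,y,z\in C$ put $$S(x,y,z)\iff x\prec y\prec z \text{ and } \mathrm{ht}_T(x\wedge y)>\mathrm{ht}_T(y\wedge z),$$ where $\wedge$ is the meet in the rooted tree $T$ and $\mathrm{ht}_T$ is the distance from $r$. An *ordered boron tree structure* is a structure isomorphic to some $(C,S,\prec)$ obtained in this way; the empty structure and the one-point structure with empty relations are also counted as (degenerate) ordered boron tree structures. Morphisms are embeddings of structures. A *finite ordered $2$-ultrametric space* is a finite (possibly empty) ultrametric space $(X,d)$ with a linear ordering $\prec$ that is convex ($x\prec y\prec z$ implies $d(x,y)\le d(x,z)$), and such that for every $r>0$ every set of points with all mutual distances equal to $r$ has at most $2$ elements. Balls are the sets $\{y: d(x,y)<r\}$, $r>0$. Morphisms are the order-preserving *bp-embeddings*,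 i.e. injections that are ball-preserving bijections onto their image: with the image carrying the restricted metric, a subset of the domain is a ball if and only if its image is a ball. The *universal ordered boron tree* is the Fraïssé limit $M$ of the class of ordered boron tree structures, i.e. the countable ultrahomogeneous structure whose finite substructures are, up to isomorphism, exactly the ordered boron tree structures. Its automorphism group $\mathrm{Aut}(M)$ carries the topology of pointwise convergence ($M$ discrete). For a group $H$, an *$n$-diagonal conjugacy class* is a set $\{(k^{-1}g_1k,\dots,k^{-1}g_nk):k\in H\}\subseteq H^n$; a conjugacy class is a $1$-diagonal one. **Proposition.** The category of ordered boron tree structures with embeddings is equivalent to the category of finite ordered $2$-ultrametric spaces with order-preserving bp-embeddings, through an equivalence that, up to natural order-preserving bijections, does not change the underlying ordered sets and the underlying maps. This holds both when the distances are arbitrary reals and when they are required to be rational. Moreover, the universal ordered boron tree $M$ exists, and $\mathrm{Aut}(M)$ has a comeager conjugacy class, but it has no comeager $2$-diagonal conjugacy class. -/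

import Mathlib

open CategoryTheory

/-! ### Ball-preserving maps of ultrametric spaces -/

section BallPreserving

variable {X Y Z : Type} [MetricSpace X] [MetricSpace Y] [MetricSpace Z]

/-- A ball: a set `{y | dist y x < r}` with `r > 0`. -/
def IsMetricBall (B : Set X) : Prop :=
  ∃ (x : X) (r : ℝ), 0 < r ∧ B = Metric.ball x r

/-- A bp-bijection: a bijection such that balls correspond to balls, in both directions. -/
def IsBPBijection (f : X → Y) : Prop :=
  Function.Bijective f ∧ ∀ B : Set X, IsMetricBall (f '' B) ↔ IsMetricBall B

/-- A bp-embedding: an injection that is a bp-bijection onto its image, the image being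
regarded as a metric space with the restricted metric. -/
def IsBPEmbedding (f : X → Y) : Prop :=
  Function.Injective f ∧ IsBPBijection (Set.rangeFactorization f)

/-- A convex linear ordering of a metric space. -/
def IsConvexOrder (X : Type) [MetricSpace X] [LinearOrder X] : Prop :=
  ∀ x y z : X, x < y → y < z → dist x y ≤ dist x z

/-- Every `r`-polygon (a set of points with all mutual distances equal to `r`, where `r > 0`)
has at most `N` elements. -/
def PolygonsBoundedBy (N : ℕ∞) (X : Type) [MetricSpace X] : Prop :=
  ∀ (r : ℝ) (P : Set X), 0 < r → (∀ x ∈ P, ∀ y ∈ P, x ≠ y → dist x y = r) → P.encard ≤ N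

lemma image_ball_of_dist_lt_iff [Finite X] {f : X → Y} (hf : Function.Bijective f)
    (h : ∀ x y z, dist x y < dist y z ↔ dist (f x) (f y) < dist (f y) (f z))
    {B : Set X} (hB : IsMetricBall B) : IsMetricBall (f '' B) := by
  obtain ⟨x, r, hr, rfl⟩ := hB
  by_cases hne : ((Metric.ball x r)ᶜ : Set X).Nonempty
  · obtain ⟨z, hz, hmin⟩ := Set.exists_min_image _ (fun y => dist x y) (Set.toFinite _) hne
    have hzr : r ≤ dist x z := by
      simpa [Metric.mem_ball, dist_comm] using hz
    refine ⟨f x, dist (f x) (f z), ?_, ?_⟩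
    · rw [dist_pos]
      intro he
      have := hf.1 he
      subst this
      simp at hzr
      linarith
    · ext w
      obtain ⟨y, rfl⟩ := hf.2 w
      rw [hf.1.mem_set_image, Metric.mem_ball, Metric.mem_ball, ← h]
      constructor
      · intro hy
        linarith
      · intro hy
        by_contra hc
        have := hmin y (by simpa [Metric.mem_ball] using hc)
        rw [dist_comm] at hy
        linarith
  · have hu : Metric.ball x r = Set.univ := by
      rw [Set.not_nonempty_iff_eq_empty] at hne
      simpa using hne
    have : Finite Y := Finite.of_surjective f hf.2
    obtain ⟨y, hy⟩ := @Finite.exists_max Y ℝ _ ⟨f x⟩ _ (fun y : Y => dist y (f x))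
    refine ⟨f x, dist y (f x) + 1, by positivity, ?_⟩
    rw [hu, Set.image_univ, hf.2.range_eq]
    ext w
    simp only [Set.mem_univ, Metric.mem_ball, true_iff]
    have := hy w
    linarith

lemma dist_lt_of_isBPBijection [IsUltrametricDist Y] {f : X → Y}
    (hf : Function.Bijective f) (h : ∀ B : Set X, IsMetricBall B → IsMetricBall (f '' B))
    {x y z : X} (hlt : dist x y < dist y z) : dist (f x) (f y) < dist (f y) (f z) := by
  have hpos : 0 < dist y z := lt_of_le_of_lt dist_nonneg hlt
  obtain ⟨c, r, hr, hcr⟩ := h _ ⟨y, dist y z, hpos, rfl⟩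
  have hy : f y ∈ Metric.ball c r := by
    rw [← hcr]
    exact ⟨y, Metric.mem_ball_self hpos, rfl⟩
  rw [IsUltrametricDist.ball_eq_of_mem hy] at hcr
  have hx : f x ∈ f '' Metric.ball y (dist y z) := ⟨x, hlt, rfl⟩
  have hz : f z ∉ f '' Metric.ball y (dist y z) := by
    rw [hf.1.mem_set_image, Metric.mem_ball, dist_comm]
    simp
  rw [hcr, Metric.mem_ball] at hx hz
  rw [dist_comm (f y) (f z)]
  linarith

/-- On finite ultrametric spaces, bp-embeddings are the injections preserving and reflecting the
comparison of distances from a common point. -/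
lemma isBPEmbedding_iff [Finite X] [IsUltrametricDist X] [IsUltrametricDist Y] {f : X → Y} :
    IsBPEmbedding f ↔ Function.Injective f ∧
      ∀ x y z, dist x y < dist y z ↔ dist (f x) (f y) < dist (f y) (f z) := by
  have hbij : Function.Injective f → Function.Bijective (Set.rangeFactorization f) := fun hi =>
    ⟨Set.rangeFactorization_injective.2 hi, Set.rangeFactorization_surjective⟩
  have hu : IsUltrametricDist (Set.range f) :=
    ⟨fun x y z => IsUltrametricDist.dist_triangle_max x.1 y.1 z.1⟩
  constructor
  · rintro ⟨hi, hb, hB⟩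
    refine ⟨hi, fun x y z => ⟨fun h => ?_, fun h => ?_⟩⟩
    · exact dist_lt_of_isBPBijection hb (fun B => (hB B).2) h
    · let e := Equiv.ofBijective _ hb
      have hs : ∀ B : Set (Set.range f), IsMetricBall B → IsMetricBall (e.symm '' B) := by
        intro B hBB
        rw [← hB]
        change IsMetricBall (e '' (e.symm '' B))
        simpa using hBB
      have := dist_lt_of_isBPBijection (x := e x) (y := e y) (z := e z) e.symm.bijective hs h
      simpa using this
  · rintro ⟨hi, h⟩
    refine ⟨hi, hbij hi, fun B => ⟨fun hB => ?_, fun hB => ?_⟩⟩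
    · let e := Equiv.ofBijective _ (hbij hi)
      have := image_ball_of_dist_lt_iff (f := e.symm) e.symm.bijective (by
        intro x y z
        obtain ⟨x, rfl⟩ := e.surjective x
        obtain ⟨y, rfl⟩ := e.surjective y
        obtain ⟨z, rfl⟩ := e.surjective z
        simp only [Equiv.symm_apply_apply]
        exact (h x y z).symm) hB
      change IsMetricBall (e.symm '' (e '' B)) at this
      simpa using this
    · exact image_ball_of_dist_lt_iff (hbij hi) h hB

lemma IsBPEmbedding.comp [Finite X] [Finite Y] [IsUltrametricDist X] [IsUltrametricDist Y]
    [IsUltrametricDist Z] {g : Y → Z} {f : X → Y} (hg : IsBPEmbedding g) (hf : IsBPEmbedding f) :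
    IsBPEmbedding (g ∘ f) := by
  rw [isBPEmbedding_iff] at *
  exact ⟨hg.1.comp hf.1, fun x y z => (hf.2 x y z).trans (hg.2 _ _ _)⟩

lemma IsBPEmbedding.id [Finite X] [IsUltrametricDist X] : IsBPEmbedding (id : X → X) := by
  rw [isBPEmbedding_iff]
  exact ⟨Function.injective_id, fun _ _ _ => Iff.rfl⟩

end BallPreserving

/-- A finite ordered `N`-ultrametric space with distances in `D`: a finite ultrametric space with
a convex linear ordering, in which every polygon has at most `N` elements. -/
structure FinOrdUltrametric (N : ℕ∞) (D : Set ℝ) where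
  carrier : Type
  [metric : MetricSpace carrier]
  [order : LinearOrder carrier]
  [finite : Finite carrier]
  [ultrametric : IsUltrametricDist carrier]
  convex : IsConvexOrder carrier
  polygons : PolygonsBoundedBy N carrier
  dist_mem : ∀ x y : carrier, dist x y ∈ D

namespace FinOrdUltrametric

attribute [instance] metric order finite ultrametric

/-- The category of finite ordered `N`-ultrametric spaces; the morphisms are the order-preserving
bp-embeddings. -/
instance (N : ℕ∞) (D : Set ℝ) : Category (FinOrdUltrametric N D) where
  Hom X Y := {f : X.carrier → Y.carrier // StrictMono f ∧ IsBPEmbedding f}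
  id X := ⟨id, strictMono_id, IsBPEmbedding.id⟩
  comp f g := ⟨g.1 ∘ f.1, g.2.1.comp f.2.1, g.2.2.comp f.2.2⟩

/-- The underlying map of a morphism. -/
def mapOf {N : ℕ∞} {D : Set ℝ} {X Y : FinOrdUltrametric N D} (f : X ⟶ Y) :
    X.carrier → Y.carrier :=
  f.1

end FinOrdUltrametric

/-! ### Rooted trees -/

section Trees

variable {W : Type}

/-- The tree order of the tree `T` with root `r`: the vertex `x` lies on the path from `r`
to `y`. -/
def IsAncestor (T : SimpleGraph W) (r x y : W) : Prop :=
  ∃ p : T.Walk r y, p.IsPath ∧ x ∈ p.support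

/-- In the tree `T` with root `r`, the vertex `m` is the meet `x ∧ y`. -/
def IsTreeMeet (T : SimpleGraph W) (r x y m : W) : Prop :=
  IsAncestor T r m x ∧ IsAncestor T r m y ∧
    ∀ z, IsAncestor T r z x → IsAncestor T r z y → IsAncestor T r z m

/-- In the tree `T` with root `r`, the vertex `c` is a child of the vertex `m`. -/
def IsChild (T : SimpleGraph W) (r m c : W) : Prop :=
  T.Adj m c ∧ IsAncestor T r m c

/-- The lexicographical order determined by a linear ordering of the vertices (only its
restrictions to the sets of children of a common vertex matter): vertices `x`, `y` that lie above
distinct children `c`, `c'` of a common vertex `m` are compared as `c` and `c'`. It is used only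
for leaves `x`, `y`; then `m = x ∧ y`. -/
def treeLexLT (T : SimpleGraph W) (r : W) (o : LinearOrder W) (x y : W) : Prop :=
  ∃ m c c' : W, IsChild T r m c ∧ IsChild T r m c' ∧ IsAncestor T r c x ∧ IsAncestor T r c' y ∧
    o.lt c c'

/-- The graph obtained from `G` by subdividing the edge `{a, b}` with a new vertex `none`. -/
def subdivideEdge (G : SimpleGraph W) (a b : W) : SimpleGraph (Option W) where
  Adj
    | some u, some v => G.Adj u v ∧ s(u, v) ≠ s(a, b)
    | none, some v => v = a ∨ v = b
    | some u, none => u = a ∨ u = b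
    | none, none => False
  symm := ⟨by
    rintro (_ | u) (_ | v) h
    · exact h
    · exact h
    · exact h
    · exact ⟨h.1.symm, by rw [Sym2.eq_swap]; exact h.2⟩⟩
  loopless := ⟨by
    rintro (_ | u) h
    · exact h
    · exact G.loopless.irrefl u h.1⟩

/-- A boron tree: a connected acyclic graph all of whose vertices have degree 1 or 3. -/
def IsBoronTree (G : SimpleGraph W) : Prop :=
  G.Connected ∧ G.IsAcyclic ∧ ∀ v, (G.neighborSet v).ncard = 1 ∨ (G.neighborSet v).ncard = 3

/-- The leaves of a graph. -/
def leafSet (G : SimpleGraph W) : Set W :=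
  {v | (G.neighborSet v).ncard = 1}

end Trees

/-! ### Ordered boron tree structures -/

/-- The relation symbols: a binary symbol for `≺` and a ternary symbol for `S`. -/
inductive BoronRel : ℕ → Type
  | prec : BoronRel 2
  | sep : BoronRel 3

/-- The language of ordered boron tree structures. -/
def boronLang : FirstOrder.Language where
  Functions := fun _ => Empty
  Relations := BoronRel

instance (n : ℕ) : IsEmpty (boronLang.Functions n) :=
  inferInstanceAs (IsEmpty Empty)

/-- The relation `≺` of a structure. -/
def boronPrec {C : Type} [boronLang.Structure C] (x y : C) : Prop :=
  FirstOrder.Language.Structure.RelMap (L := boronLang) BoronRel.prec ![x, y]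

/-- The relation `S` of a structure. -/
def boronSep {C : Type} [boronLang.Structure C] (x y z : C) : Prop :=
  FirstOrder.Language.Structure.RelMap (L := boronLang) BoronRel.sep ![x, y, z]

/-- The structure `C` is built from the boron tree `G`: for some edge `{a, b}` of `G` and some
lexicographical ordering of the binary tree `T` obtained by subdividing `{a, b}` with a new
vertex, the root, `C` is (identified with) the set of leaves with the induced ordering `≺`, and
`S(x, y, z)` holds iff `x ≺ y ≺ z` and the height of `x ∧ y` exceeds the height of `y ∧ z`. -/
def IsBuiltFrom {V : Type} (G : SimpleGraph V) (C : Type) [boronLang.Structure C] : Prop :=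
  ∃ (a b : V) (o : LinearOrder (Option V)) (e : C ≃ leafSet G),
    G.Adj a b ∧
    (∀ x y : C, boronPrec x y ↔
      treeLexLT (subdivideEdge G a b) none o (some (e x).1) (some (e y).1)) ∧
    (∀ x y z : C, boronSep x y z ↔ boronPrec x y ∧ boronPrec y z ∧
      ∃ m m' : Option V,
        IsTreeMeet (subdivideEdge G a b) none (some (e x).1) (some (e y).1) m ∧
        IsTreeMeet (subdivideEdge G a b) none (some (e y).1) (some (e z).1) m' ∧
        (subdivideEdge G a b).dist none m' < (subdivideEdge G a b).dist none m)

/-- Ordered boron tree structures: the structures built from finite boron trees, and the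
degenerate ones, i.e. the structures with at most one element and with empty relations. -/
def IsOrderedBoron (C : Type) [boronLang.Structure C] : Prop :=
  (∃ (V : Type) (_ : Finite V) (G : SimpleGraph V), IsBoronTree G ∧ IsBuiltFrom G C) ∨
  (Subsingleton C ∧ (∀ x y : C, ¬ boronPrec x y) ∧ ∀ x y z : C, ¬ boronSep x y z)

/-- A bundled ordered boron tree structure. -/
structure OrderedBoron where
  carrier : Type
  [str : boronLang.Structure carrier]
  isOrderedBoron : IsOrderedBoron carrier

namespace OrderedBoron

attribute [instance] str

/-- The category of ordered boron tree structures with embeddings of structures. -/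
instance : Category OrderedBoron where
  Hom X Y := boronLang.Embedding X.carrier Y.carrier
  id X := FirstOrder.Language.Embedding.refl boronLang X.carrier
  comp f g := FirstOrder.Language.Embedding.comp g f

/-- The underlying map of a morphism. -/
def mapOf {X Y : OrderedBoron} (f : X ⟶ Y) : X.carrier → Y.carrier :=
  DFunLike.coe (F := boronLang.Embedding X.carrier Y.carrier) f

end OrderedBoron

/-- The class of ordered boron tree structures. -/
def orderedBoronClass : Set (Bundled boronLang.Structure) :=
  {C | IsOrderedBoron C}

/-- `M` is a universal ordered boron tree: a countable structure that is a Fraïssé limit of the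
class of ordered boron tree structures. -/
def IsUniversalOrderedBoronTree (M : Type) [boronLang.Structure M] : Prop :=
  ∃ _ : Countable M, FirstOrder.Language.IsFraisseLimit orderedBoronClass M

/-! ### Automorphism groups and diagonal conjugacy classes -/

/-- The automorphism group of a structure, as a group of permutations. -/
def autGroup (L : FirstOrder.Language) (M : Type) [L.Structure M] : Subgroup (Equiv.Perm M) where
  carrier := {g | ∃ φ : L.Equiv M M, φ.toEquiv = g}
  one_mem' := ⟨FirstOrder.Language.Equiv.refl L M, rfl⟩
  mul_mem' := by
    rintro _ _ ⟨φ, rfl⟩ ⟨ψ, rfl⟩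
    exact ⟨φ.comp ψ, rfl⟩
  inv_mem' := by
    rintro _ ⟨φ, rfl⟩
    exact ⟨φ.symm, rfl⟩

/-- The topology of pointwise convergence: the topology induced by the product topology of
`M → M`, where `M` is discrete. -/
instance (L : FirstOrder.Language) (M : Type) [L.Structure M] :
    TopologicalSpace (autGroup L M) :=
  TopologicalSpace.induced (fun g (x : M) => g.1 x) (@Pi.topologicalSpace M (fun _ => M) fun _ => ⊥)

/-- The diagonal conjugacy class `{(k⁻¹ g₁ k, …, k⁻¹ gₙ k) : k ∈ H}` of a tuple in a group. -/
def diagonalConjClass {H : Type} [Group H] {n : ℕ} (g : Fin n → H) : Set (Fin n → H) :=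
  {h | ∃ k : H, ∀ i, h i = k⁻¹ * g i * k}

/-- The group `H` has a comeager `n`-diagonal conjugacy class. -/
def HasComeagerDiagonalClass (H : Type) [Group H] [TopologicalSpace H] (n : ℕ) : Prop :=
  ∃ g : Fin n → H, diagonalConjClass g ∈ residual (Fin n → H)

/-- The group `H` has a comeager conjugacy class. -/
def HasComeagerConjClass (H : Type) [Group H] [TopologicalSpace H] : Prop :=
  ∃ g : H, {h : H | ∃ k : H, h = k⁻¹ * g * k} ∈ residual H

/-!
An ordered boron tree structure is the same thing as a finite ordered ultrametric space in which
the metric matters only through the comparisons of the distances from a common point: the distance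
of two leaves is a constant minus the height of their meet, and `S x y z` says that `x < y < z` and
`dist x y < dist y z`. A convex order together with the bound two on polygons amounts to the axioms
`OrdUlt`: of three points `x < y < z`, exactly one of the two neighbouring distances is the larger,
and it equals `dist x z`. Such a metric exists on the leaves of a binary tree
(`IsOrderedBoron.exists_metric`), and the balls of a finite space form a binary tree
(`isOrderedBoron_of_ordUlt`). Trees are handled through parent functions (`IsParentFun`). Under this
correspondence both kinds of morphisms are the maps that preserve the order and the comparisons of
distances (`boron_maps_iff`), so the functor that is the identity on points and maps is an
equivalence (`exists_equivalence`).

A countable ordered ultrametric space is called rich (`RichOrdUlt`) if points can be inserted at any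
distance from a given point, on either side. In the presence of `OrdUlt` this already gives the
one-point extension of finite partial isomorphisms (`IsPartialIso.exists_insert`): the new point has
to be placed only relative to the nearest point of the domain. So rich spaces are Fraïssé limits,
one of them is the explicit space `TreePoint`, and by uniqueness of Fraïssé limits every universal
ordered boron tree carries a rich metric.

The comeager conjugacy class consists of the automorphisms that satisfy countably many open dense
conditions (`IsGenericAut`): a point that moves moves in distance from some fixed point; fixed
points can be inserted over a fixed point in all gaps between orbits; between two fixed points there
are points that move up and points that move down. Two such automorphisms are conjugate by
back-and-forth (`IsGenericAut.exists_conj`).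

If some diagonal conjugacy class of pairs were comeager, then by the Baire category theorem its
members with prescribed values of the conjugating element at two points `a`, `b` would be dense in
some open set of pairs with common fixed point `a` whose first member moves `b` away from `a`. The
comparisons of the distances from `a` of the images of `b` under words would then be constant on
that set, whereas `exists_words_differ` shows that finitely many values of a pair never decide all
of them.
-/

/-! ### Ordered ultrametric spaces with binary branching -/

/-- An ultrametric space of arbitrary cardinality with a convex linear order in which every
polygon has at most two points. The two axioms say that of three points `x < y < z` exactly one
of the two neighbouring distances is the larger one, and that it equals `dist x z`. -/
class OrdUlt (X : Type) [MetricSpace X] [LinearOrder X] : Prop extends IsUltrametricDist X where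
  dist_eq_max : ∀ {x y z : X}, x < y → y < z → dist x z = max (dist x y) (dist y z)
  dist_ne : ∀ {x y z : X}, x < y → y < z → dist x y ≠ dist y z

namespace OrdUlt

variable {X : Type} [MetricSpace X] [LinearOrder X] [OrdUlt X]

lemma dist_eq_of_lt {u v w : X} (h : dist u v < dist u w) : dist v w = dist u w := by
  have h1 := IsUltrametricDist.dist_triangle_max u v w
  have h2 := IsUltrametricDist.dist_triangle_max v u w
  rw [dist_comm v u] at h2
  apply le_antisymm
  · exact h2.trans (max_le h.le le_rfl)
  · rcases le_max_iff.1 h1 with h3 | h3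
    · exact absurd h3 (not_le.2 h)
    · exact h3

lemma dist_eq_max_of_ne {f a b : X} (h : dist f a ≠ dist f b) :
    dist a b = max (dist f a) (dist f b) := by
  rcases lt_or_gt_of_ne h with h | h
  · rw [dist_eq_of_lt h, max_eq_right h.le]
  · rw [dist_comm, dist_eq_of_lt h, max_eq_left h.le]

/-- If `v` is closer to `u` than `w` is, then `u` and `v` lie on the same side of `w`. -/
lemma lt_iff_of_dist_lt {u v w : X} (h : dist u v < dist u w) : u < w ↔ v < w := by
  have huw : u ≠ w := by
    rintro rfl
    rw [dist_self] at h
    exact absurd h (not_lt.2 dist_nonneg)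
  have hvw : v ≠ w := by
    rintro rfl
    exact lt_irrefl _ h
  constructor
  · intro h1
    by_contra h2
    have h3 : w < v := lt_of_le_of_ne (not_lt.1 h2) hvw.symm
    have := dist_eq_max h1 h3
    rw [this] at h
    exact absurd h (not_lt.2 (le_max_left _ _))
  · intro h1
    by_contra h2
    have h3 : w < u := lt_of_le_of_ne (not_lt.1 h2) huw.symm
    have := dist_eq_max h1 h3
    rw [dist_comm u v, this, dist_comm w u] at h
    exact absurd h (not_lt.2 (le_max_right _ _))

lemma gt_iff_of_dist_lt {u v w : X} (h : dist u v < dist u w) : w < u ↔ w < v := by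
  have huw : u ≠ w := by
    rintro rfl
    rw [dist_self] at h
    exact absurd h (not_lt.2 dist_nonneg)
  have hvw : v ≠ w := by
    rintro rfl
    exact lt_irrefl _ h
  have := lt_iff_of_dist_lt h
  constructor
  · intro h1
    exact lt_of_le_of_ne (not_lt.1 fun h2 => (this.2 h2).not_gt h1) hvw.symm
  · intro h1
    exact lt_of_le_of_ne (not_lt.1 fun h2 => (this.1 h2).not_gt h1) huw.symm

/-- Two points at the same positive distance from `f` lie in the same half of the corresponding
ball, since every ball splits into two halves only. -/
lemma dist_lt_of_eq {f a b : X} (h : dist f a = dist f b) (ha : a ≠ f) :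
    dist a b < dist f a := by
  have hpos : 0 < dist f a := dist_pos.2 ha.symm
  have hb : b ≠ f := by
    rintro rfl
    rw [dist_self] at h
    exact hpos.ne' h
  wlog hab : a < b generalizing a b
  · rcases eq_or_lt_of_le (not_lt.1 hab) with h1 | h1
    · subst h1
      rwa [dist_self]
    · rw [dist_comm, h]
      exact this h.symm hb (h ▸ hpos) ha h1
  rcases lt_or_gt_of_ne ha with h1 | h1 <;> rcases lt_or_gt_of_ne hb with h2 | h2
  · have h3 := dist_eq_max hab h2
    have h4 := dist_ne hab h2
    rw [dist_comm a f, dist_comm b f, ← h] at h3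
    rw [dist_comm b f, ← h] at h4
    exact lt_of_le_of_ne (h3 ▸ le_max_left _ _) h4
  · exact absurd (by rw [dist_comm, h]) (dist_ne h1 h2)
  · exact absurd (hab.trans h2) (not_lt.2 h1.le)
  · have h3 := dist_eq_max h1 hab
    have h4 := dist_ne h1 hab
    rw [← h] at h3
    exact lt_of_le_of_ne (h3 ▸ le_max_right _ _) h4.symm

/-- Comparison of the distances from `a`, in terms of the distances from another point `f`. -/
lemma dist_lt_dist_iff {f a b c : X} : dist a b < dist a c ↔
    (dist f a = dist f b ∧ dist f a = dist f c ∧ dist a b < dist a c) ∨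
    (dist f a = dist f b ∧ dist f a ≠ dist f c) ∨
    (dist f a ≠ dist f b ∧ dist f a < dist f c ∧ dist f b < dist f c) := by
  by_cases hb : dist f a = dist f b <;> by_cases hc : dist f a = dist f c
  · tauto
  · have h : dist a b < dist a c := by
      rw [dist_eq_max_of_ne hc]
      by_cases haf : a = f
      · subst haf
        rw [dist_self] at hb hc ⊢
        rw [← hb]
        exact lt_max_of_lt_right (lt_of_le_of_ne dist_nonneg hc)
      · exact lt_max_of_lt_left (dist_lt_of_eq hb haf)
    tauto
  · have h : dist a c ≤ dist a b := by
      rw [dist_eq_max_of_ne hb]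
      by_cases haf : a = f
      · subst haf
        rw [dist_self] at hc ⊢
        rw [← hc]
        exact le_max_left _ _
      · exact le_max_of_le_left (dist_lt_of_eq hc haf).le
    have h1 := not_lt.2 h
    have h2 := not_lt.2 hc.ge
    tauto
  · have h : dist a b < dist a c ↔ dist f a < dist f c ∧ dist f b < dist f c := by
      rw [dist_eq_max_of_ne hb, dist_eq_max_of_ne hc]
      grind
    tauto

end OrdUlt

/-! ### Partial isomorphisms -/

section PartialIso

variable {X Y : Type} [MetricSpace X] [LinearOrder X] [MetricSpace Y] [LinearOrder Y]

/-- A relation `H` between two ordered metric spaces is a partial isomorphism if it preserves and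
reflects the order and the comparison of distances from a common point. -/
structure IsPartialIso (H : Set (X × Y)) : Prop where
  lt_iff : ∀ {p q}, p ∈ H → q ∈ H → (p.1 < q.1 ↔ p.2 < q.2)
  dist_iff : ∀ {p q r}, p ∈ H → q ∈ H → r ∈ H →
    (dist p.1 q.1 < dist p.1 r.1 ↔ dist p.2 q.2 < dist p.2 r.2)

namespace IsPartialIso

variable {H K : Set (X × Y)}

lemma mono (hK : IsPartialIso K) (h : H ⊆ K) : IsPartialIso H :=
  ⟨fun hp hq => hK.lt_iff (h hp) (h hq), fun hp hq hr => hK.dist_iff (h hp) (h hq) (h hr)⟩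

lemma eq_iff (hH : IsPartialIso H) {p q : X × Y} (hp : p ∈ H) (hq : q ∈ H) :
    p.1 = q.1 ↔ p.2 = q.2 := by
  have h1 := hH.lt_iff hp hq
  have h2 := hH.lt_iff hq hp
  constructor
  · intro h
    rw [h] at h1 h2
    exact le_antisymm (not_lt.1 fun h3 => lt_irrefl _ (h2.2 h3))
      (not_lt.1 fun h3 => lt_irrefl _ (h1.2 h3))
  · intro h
    rw [h] at h1 h2
    exact le_antisymm (not_lt.1 fun h3 => lt_irrefl _ (h2.1 h3))
      (not_lt.1 fun h3 => lt_irrefl _ (h1.1 h3))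

lemma dist_eq_iff (hH : IsPartialIso H) {p q r : X × Y} (hp : p ∈ H) (hq : q ∈ H) (hr : r ∈ H) :
    dist p.1 q.1 = dist p.1 r.1 ↔ dist p.2 q.2 = dist p.2 r.2 := by
  have h1 := hH.dist_iff hp hq hr
  have h2 := hH.dist_iff hp hr hq
  constructor <;> intro h <;> rw [h] at h1 h2 <;>
    simp only [lt_irrefl, false_iff, iff_false, not_lt] at h1 h2 <;>
    exact le_antisymm (by assumption) (by assumption)

lemma swap (hH : IsPartialIso H) : IsPartialIso (Prod.swap ⁻¹' H) :=
  ⟨fun hp hq => (hH.lt_iff hp hq).symm, fun hp hq hr => (hH.dist_iff hp hq hr).symm⟩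

lemma empty : IsPartialIso (∅ : Set (X × Y)) := ⟨fun h => h.elim, fun h => h.elim⟩

lemma singleton (p : X × Y) : IsPartialIso {p} := by
  refine ⟨?_, ?_⟩
  · rintro _ _ rfl rfl
    simp
  · rintro _ _ _ rfl rfl rfl
    simp

variable [OrdUlt X] [OrdUlt Y]

/-- The criterion by which all partial isomorphisms below are recognized: seen from a base point
`f`, the space is a sum of cones, one for each distance from `f`, so that it is enough to preserve
the comparison of the distances from `f`, the side of `f`, and the structure within each cone. -/
lemma of_base {f : X × Y}
    (hlev : ∀ p ∈ H, ∀ q ∈ H, dist f.1 p.1 < dist f.1 q.1 ↔ dist f.2 p.2 < dist f.2 q.2)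
    (hside : ∀ p ∈ H, (p.1 < f.1 ↔ p.2 < f.2) ∧ (f.1 < p.1 ↔ f.2 < p.2))
    (hcone : ∀ p ∈ H, ∀ q ∈ H, ∀ r ∈ H, dist f.1 p.1 = dist f.1 q.1 → dist f.1 p.1 = dist f.1 r.1 →
      (p.1 < q.1 ↔ p.2 < q.2) ∧
      (dist p.1 q.1 < dist p.1 r.1 ↔ dist p.2 q.2 < dist p.2 r.2)) :
    IsPartialIso H := by
  have heq : ∀ p ∈ H, ∀ q ∈ H, dist f.1 p.1 = dist f.1 q.1 ↔ dist f.2 p.2 = dist f.2 q.2 := by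
    intro p hp q hq
    have h1 := hlev p hp q hq
    have h2 := hlev q hq p hp
    constructor
    · intro h
      rw [h] at h1 h2
      exact le_antisymm (not_lt.1 fun h3 => lt_irrefl _ (h2.2 h3))
        (not_lt.1 fun h3 => lt_irrefl _ (h1.2 h3))
    · intro h
      rw [h] at h1 h2
      exact le_antisymm (not_lt.1 fun h3 => lt_irrefl _ (h2.1 h3))
        (not_lt.1 fun h3 => lt_irrefl _ (h1.1 h3))
  constructor
  · intro p q hp hq
    rcases lt_trichotomy (dist f.1 p.1) (dist f.1 q.1) with h | h | h
    · rw [← OrdUlt.lt_iff_of_dist_lt h, ← OrdUlt.lt_iff_of_dist_lt ((hlev p hp q hq).1 h)]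
      exact (hside q hq).2
    · exact (hcone p hp q hq q hq h h).1
    · rw [← OrdUlt.gt_iff_of_dist_lt h, ← OrdUlt.gt_iff_of_dist_lt ((hlev q hq p hp).1 h)]
      exact (hside p hp).1
  · intro p q r hp hq hr
    rw [OrdUlt.dist_lt_dist_iff (f := f.1), OrdUlt.dist_lt_dist_iff (f := f.2) (a := p.2)]
    have h1 := heq p hp q hq
    have h2 := heq p hp r hr
    have h3 := hlev p hp r hr
    have h4 := hlev q hq r hr
    have h5 := fun h h' => (hcone p hp q hq r hr h h').2
    tauto

/-- A partial isomorphism extends by a pair whose first component has a new distance from the base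
point `f`. -/
lemma insert_of_base (hH : IsPartialIso H) {f : X × Y} (hf : f ∈ H) {x : X} {y : Y}
    (hlt : ∀ p ∈ H, dist f.1 p.1 < dist f.1 x → dist f.2 p.2 < dist f.2 y)
    (hgt : ∀ p ∈ H, dist f.1 x < dist f.1 p.1 → dist f.2 y < dist f.2 p.2)
    (hne : ∀ p ∈ H, dist f.1 p.1 ≠ dist f.1 x)
    (hside : x < f.1 ↔ y < f.2) : IsPartialIso (insert (x, y) H) := by
  have hxf : x ≠ f.1 := by
    rintro rfl
    exact hne f hf rfl
  have hyf : y ≠ f.2 := by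
    rintro rfl
    have := hlt f hf (by simpa using hxf.symm)
    simp at this
  have hside' : f.1 < x ↔ f.2 < y := by
    constructor
    · intro h
      exact lt_of_le_of_ne (not_lt.1 fun h2 => (hside.2 h2).not_gt h) hyf.symm
    · intro h
      exact lt_of_le_of_ne (not_lt.1 fun h2 => (hside.1 h2).not_gt h) hxf.symm
  have hlt' : ∀ p ∈ H, dist f.1 p.1 < dist f.1 x ↔ dist f.2 p.2 < dist f.2 y := by
    intro p hp
    refine ⟨hlt p hp, fun h => ?_⟩
    rcases lt_or_gt_of_ne (hne p hp) with h1 | h1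
    · exact h1
    · exact absurd (hgt p hp h1) h.not_gt
  have hgt' : ∀ p ∈ H, dist f.1 x < dist f.1 p.1 ↔ dist f.2 y < dist f.2 p.2 := by
    intro p hp
    refine ⟨hgt p hp, fun h => ?_⟩
    rcases lt_or_gt_of_ne (hne p hp) with h1 | h1
    · exact absurd (hlt p hp h1) h.not_gt
    · exact h1
  refine of_base (f := f) ?_ ?_ ?_
  · rintro p (rfl | hp) q (rfl | hq)
    · simp
    · exact hgt' q hq
    · exact hlt' p hp
    · exact hH.dist_iff hf hp hq
  · rintro p (rfl | hp)
    · exact ⟨hside, hside'⟩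
    · exact ⟨hH.lt_iff hp hf, hH.lt_iff hf hp⟩
  · rintro p (rfl | hp) q (rfl | hq) r (rfl | hr) h1 h2
    · simp
    · exact absurd h2.symm (hne r hr)
    · exact absurd h1.symm (hne q hq)
    · exact absurd h1.symm (hne q hq)
    · exact absurd h1 (hne p hp)
    · exact absurd h1 (hne p hp)
    · exact absurd h2 (hne p hp)
    · exact ⟨hH.lt_iff hp hq, hH.dist_iff hp hq hr⟩

end IsPartialIso

end PartialIso

/-! ### Rich ordered ultrametric spaces and back-and-forth -/

/-- A countable ordered ultrametric space in which new points can be inserted at any distance from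
a given point `f` between two given finite sets of distances, on either side of `f`. These are the
universal ordered boron trees, in metric language. -/
class RichOrdUlt (X : Type) [MetricSpace X] [LinearOrder X] : Prop extends OrdUlt X where
  countable : Countable X
  nonempty : Nonempty X
  exists_insert : ∀ (f : X) (Z W : Set X), Z.Finite → W.Finite → f ∉ W →
    (∀ z ∈ Z, ∀ w ∈ W, dist f z < dist f w) → ∀ left : Prop, ∃ u, u ≠ f ∧ (u < f ↔ left) ∧
      (∀ z ∈ Z, dist f z < dist f u) ∧ ∀ w ∈ W, dist f u < dist f w

section Rich

variable {X Y : Type} [MetricSpace X] [LinearOrder X] [MetricSpace Y] [LinearOrder Y]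

/-- Finite partial isomorphisms into a rich space extend to any further point: choose `f` in the
domain nearest to `x`; then no point of the domain has the same distance from `f` as `x`, because
balls have two halves only. -/
lemma IsPartialIso.exists_insert [OrdUlt X] [RichOrdUlt Y] {H : Set (X × Y)}
    (hH : IsPartialIso H) (hfin : H.Finite) (x : X) : ∃ y, IsPartialIso (insert (x, y) H) := by
  by_cases hx : ∃ p ∈ H, p.1 = x
  · obtain ⟨p, hp, rfl⟩ := hx
    exact ⟨p.2, by rwa [Prod.mk.eta, Set.insert_eq_of_mem hp]⟩
  rcases H.eq_empty_or_nonempty with rfl | hne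
  · obtain ⟨y⟩ := RichOrdUlt.nonempty (X := Y)
    exact ⟨y, by simpa using IsPartialIso.singleton (x, y)⟩
  obtain ⟨f, hf, hmin⟩ := Set.exists_min_image H (fun p => dist p.1 x) hfin hne
  have hxf : f.1 ≠ x := fun h => hx ⟨f, hf, h⟩
  have hlev : ∀ p ∈ H, dist f.1 p.1 ≠ dist f.1 x := by
    intro p hp h
    have := OrdUlt.dist_lt_of_eq h.symm hxf.symm
    rw [dist_comm x] at this
    exact absurd (hmin p hp) (not_le.2 this)
  obtain ⟨u, hu, hside, hZ, hW⟩ := RichOrdUlt.exists_insert f.2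
    (Prod.snd '' {p ∈ H | dist f.1 p.1 < dist f.1 x})
    (Prod.snd '' {p ∈ H | dist f.1 x < dist f.1 p.1})
    ((hfin.subset (Set.sep_subset _ _)).image _) ((hfin.subset (Set.sep_subset _ _)).image _)
    (by
      rintro ⟨p, ⟨hp, h⟩, h2⟩
      rw [← hH.eq_iff hp hf] at h2
      rw [h2, dist_self] at h
      exact absurd h (not_lt.2 dist_nonneg))
    (by
      rintro _ ⟨p, ⟨hp, h⟩, rfl⟩ _ ⟨q, ⟨hq, h'⟩, rfl⟩
      exact (hH.dist_iff hf hp hq).1 (h.trans h'))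
    (x < f.1)
  exact ⟨u, hH.insert_of_base hf (fun p hp h => hZ _ ⟨p, ⟨hp, h⟩, rfl⟩)
    (fun p hp h => hW _ ⟨p, ⟨hp, h⟩, rfl⟩) hlev hside.symm⟩

/-- The back-and-forth argument, for a family `S` of partial isomorphisms. -/
lemma exists_equiv_of_back_and_forth [Countable X] [Countable Y] (S : Set (Set (X × Y)))
    (hS : ∀ H ∈ S, IsPartialIso H)
    (hforth : ∀ H ∈ S, ∀ x, ∃ H' ∈ S, H ⊆ H' ∧ ∃ y, (x, y) ∈ H')
    (hback : ∀ H ∈ S, ∀ y, ∃ H' ∈ S, H ⊆ H' ∧ ∃ x, (x, y) ∈ H')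
    {H₀ : Set (X × Y)} (h₀ : H₀ ∈ S) :
    ∃ e : X ≃ Y, IsPartialIso {p : X × Y | e p.1 = p.2} ∧ (∀ p ∈ H₀, e p.1 = p.2) ∧
      ∀ x, ∃ H ∈ S, (x, e x) ∈ H ∧ ∀ p ∈ H, e p.1 = p.2 := by
  have := Encodable.ofCountable X
  have := Encodable.ofCountable Y
  have hstep : ∀ (n : ℕ) (H : S), ∃ H' : S, H.1 ⊆ H'.1 ∧
      (∀ x, Encodable.decode (α := X) n = some x → ∃ y, (x, y) ∈ H'.1) ∧
      (∀ y, Encodable.decode (α := Y) n = some y → ∃ x, (x, y) ∈ H'.1) := by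
    rintro n ⟨H, hH⟩
    obtain ⟨H1, h1, h01, hx⟩ : ∃ H' ∈ S, H ⊆ H' ∧
        ∀ x, Encodable.decode (α := X) n = some x → ∃ y, (x, y) ∈ H' := by
      cases h : Encodable.decode (α := X) n with
      | none => exact ⟨H, hH, subset_rfl, by simp⟩
      | some x =>
        obtain ⟨H', h1, h2, h3⟩ := hforth H hH x
        refine ⟨H', h1, h2, ?_⟩
        rintro _ ⟨⟩
        exact h3
    obtain ⟨H2, h2, h12, hy⟩ : ∃ H' ∈ S, H1 ⊆ H' ∧
        ∀ y, Encodable.decode (α := Y) n = some y → ∃ x, (x, y) ∈ H' := by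
      cases h : Encodable.decode (α := Y) n with
      | none => exact ⟨H1, h1, subset_rfl, by simp⟩
      | some y =>
        obtain ⟨H', h1, h2, h3⟩ := hback H1 h1 y
        refine ⟨H', h1, h2, ?_⟩
        rintro _ ⟨⟩
        exact h3
    refine ⟨⟨H2, h2⟩, h01.trans h12, fun x hxn => ?_, hy⟩
    obtain ⟨y, h⟩ := hx x hxn
    exact ⟨y, h12 h⟩
  choose next hnext hnextx hnexty using hstep
  let K : ℕ → S := fun n => Nat.rec ⟨H₀, h₀⟩ (fun n H => next n H) n
  have hK : ∀ n, K (n + 1) = next n (K n) := fun n => rfl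
  have hmono : Monotone fun n => (K n).1 := monotone_nat_of_le_succ fun n => by
    rw [hK]
    exact hnext n _
  set U : Set (X × Y) := ⋃ n, (K n).1 with hU
  have hcommon : ∀ {p q r}, p ∈ U → q ∈ U → r ∈ U →
      ∃ n, p ∈ (K n).1 ∧ q ∈ (K n).1 ∧ r ∈ (K n).1 := by
    intro p q r hp hq hr
    simp only [hU, Set.mem_iUnion] at hp hq hr
    obtain ⟨a, ha⟩ := hp
    obtain ⟨b, hb⟩ := hq
    obtain ⟨c, hc⟩ := hr
    exact ⟨max a (max b c), hmono (le_max_left _ _) ha,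
      hmono ((le_max_left _ _).trans (le_max_right _ _)) hb,
      hmono ((le_max_right _ _).trans (le_max_right _ _)) hc⟩
  have hPI : IsPartialIso U := by
    constructor
    · intro p q hp hq
      obtain ⟨n, h1, h2, -⟩ := hcommon hp hq hq
      exact (hS _ (K n).2).lt_iff h1 h2
    · intro p q r hp hq hr
      obtain ⟨n, h1, h2, h3⟩ := hcommon hp hq hr
      exact (hS _ (K n).2).dist_iff h1 h2 h3
  have hX : ∀ x, ∃ y, (x, y) ∈ U := by
    intro x
    obtain ⟨y, h⟩ := hnextx (Encodable.encode x) (K _) x (Encodable.encodek x)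
    exact ⟨y, Set.mem_iUnion.2 ⟨Encodable.encode x + 1, h⟩⟩
  have hY : ∀ y, ∃ x, (x, y) ∈ U := by
    intro y
    obtain ⟨x, h⟩ := hnexty (Encodable.encode y) (K _) y (Encodable.encodek y)
    exact ⟨x, Set.mem_iUnion.2 ⟨Encodable.encode y + 1, h⟩⟩
  choose e he using hX
  choose e' he' using hY
  have hgraph : ∀ p ∈ U, e p.1 = p.2 := fun p hp => (hPI.eq_iff (he p.1) hp).1 rfl
  refine ⟨⟨e, e', fun x => ?_, fun y => hgraph _ (he' y)⟩, ?_, ?_, ?_⟩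
  · exact (hPI.eq_iff (he' (e x)) (he x)).2 rfl
  · refine hPI.mono ?_
    rintro ⟨x, y⟩ h
    simp only [Equiv.coe_fn_mk, Set.mem_ofPred_eq] at h
    rw [← h]
    exact he x
  · exact fun p hp => hgraph p (Set.mem_iUnion.2 ⟨0, hp⟩)
  · intro x
    obtain ⟨n, hn⟩ := Set.mem_iUnion.1 (he x)
    exact ⟨(K n).1, (K n).2, hn, fun p hp => hgraph p (Set.mem_iUnion.2 ⟨n, hp⟩)⟩

/-- Rich spaces are ultrahomogeneous. -/
lemma IsPartialIso.exists_equiv [RichOrdUlt X] [RichOrdUlt Y] {H : Set (X × Y)}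
    (hH : IsPartialIso H) (hfin : H.Finite) :
    ∃ e : X ≃ Y, IsPartialIso {p : X × Y | e p.1 = p.2} ∧ ∀ p ∈ H, e p.1 = p.2 := by
  have := RichOrdUlt.countable (X := X)
  have := RichOrdUlt.countable (X := Y)
  obtain ⟨e, h1, h2, -⟩ := exists_equiv_of_back_and_forth {H | IsPartialIso H ∧ H.Finite}
    (fun H hH => hH.1)
    (fun H hH x => by
      obtain ⟨y, hy⟩ := hH.1.exists_insert hH.2 x
      exact ⟨_, ⟨hy, hH.2.insert _⟩, Set.subset_insert _ _, y, Set.mem_insert _ _⟩)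
    (fun H hH y => by
      have hfin' : (Prod.swap ⁻¹' H).Finite := hH.2.preimage Prod.swap_injective.injOn
      obtain ⟨x, hx⟩ := hH.1.swap.exists_insert hfin' y
      refine ⟨insert (x, y) H, ⟨?_, hH.2.insert _⟩, Set.subset_insert _ _, x, Set.mem_insert _ _⟩
      refine hx.swap.mono ?_
      rintro p (rfl | hp)
      · exact Or.inl rfl
      · exact Or.inr hp)
    (show H ∈ _ from ⟨hH, hfin⟩)
  exact ⟨e, h1, h2⟩

/-- Finite ordered ultrametric spaces embed into rich ones. -/
lemma exists_embedding_of_finite [OrdUlt X] [RichOrdUlt Y] [Finite X] :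
    ∃ e : X → Y, IsPartialIso {p : X × Y | e p.1 = p.2} := by
  have key : ∀ s : Set X, s.Finite → ∃ H : Set (X × Y), IsPartialIso H ∧ H.Finite ∧
      ∀ x ∈ s, ∃ y, (x, y) ∈ H := by
    intro s hs
    induction s, hs using Set.Finite.induction_on with
    | empty => exact ⟨∅, IsPartialIso.empty, Set.finite_empty, by simp⟩
    | insert _ _ ih =>
      rename_i a s _ _
      obtain ⟨H, h1, h2, h3⟩ := ih
      obtain ⟨y, hy⟩ := h1.exists_insert h2 a
      refine ⟨_, hy, h2.insert _, ?_⟩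
      rintro x (rfl | hx)
      · exact ⟨y, Or.inl rfl⟩
      · obtain ⟨z, hz⟩ := h3 x hx
        exact ⟨z, Or.inr hz⟩
  obtain ⟨H, h1, -, h3⟩ := key Set.univ Set.finite_univ
  choose e he using fun x => h3 x (Set.mem_univ x)
  refine ⟨e, h1.mono ?_⟩
  rintro ⟨x, y⟩ h
  simp only [Set.mem_ofPred_eq] at h
  rw [← h]
  exact he x

end Rich

/-! ### A concrete rich space -/

/-- The labels of the inner nodes of the concrete rich space: a countable set of positive reals in
which both the rational and the irrational elements are dense. -/
def IsNodeLabel (q : NNReal) : Prop :=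
  0 < q ∧ ((∃ r : ℚ, (q : ℝ) = r) ∨ ∃ r : ℚ, (q : ℝ) = r + √2)

/-- Rational labels mark the nodes at which branches move to the right. -/
def IsRightLabel (q : NNReal) : Prop := ∃ r : ℚ, (q : ℝ) = r

lemma countable_isNodeLabel : {q | IsNodeLabel q}.Countable := by
  have h : ((Set.range ((↑) : ℚ → ℝ)) ∪ Set.range (fun r : ℚ => (r : ℝ) + √2)).Countable :=
    (Set.countable_range _).union (Set.countable_range _)
  refine (h.preimage NNReal.coe_injective).mono ?_
  rintro q ⟨-, ⟨r, h⟩ | ⟨r, h⟩⟩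
  · exact Or.inl ⟨r, h.symm⟩
  · exact Or.inr ⟨r, h.symm⟩

lemma exists_isNodeLabel {a b : NNReal} (hab : a < b) (left : Prop) :
    ∃ q, a < q ∧ q < b ∧ IsNodeLabel q ∧ (IsRightLabel q ↔ ¬ left) := by
  have hab' : (a : ℝ) < b := NNReal.coe_lt_coe.2 hab
  have ha := NNReal.coe_nonneg a
  suffices h : ∃ x : ℝ, a < x ∧ x < b ∧ ((∃ r : ℚ, x = r) ∨ ∃ r : ℚ, x = r + √2) ∧
      ((∃ r : ℚ, x = r) ↔ ¬ left) by
    obtain ⟨x, h1, h2, h3, h4⟩ := h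
    lift x to NNReal using ha.trans h1.le
    exact ⟨x, NNReal.coe_lt_coe.1 h1, NNReal.coe_lt_coe.1 h2,
      ⟨NNReal.coe_pos.1 (lt_of_le_of_lt ha h1), h3⟩, h4⟩
  by_cases hl : left
  · obtain ⟨r, h1, h2⟩ := exists_rat_btwn (sub_lt_sub_right hab' (√2))
    refine ⟨r + √2, by linarith, by linarith, Or.inr ⟨r, rfl⟩, ?_⟩
    simp only [hl, not_true, iff_false]
    rintro ⟨t, ht⟩
    refine irrational_sqrt_two ⟨t - r, ?_⟩
    push_cast
    linarith
  · obtain ⟨r, h1, h2⟩ := exists_rat_btwn hab'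
    exact ⟨r, h1, h2, Or.inl ⟨r, rfl⟩, iff_of_true ⟨r, rfl⟩ hl⟩

/-- The points of the concrete rich space: finite sets of labels. A point stands for a branch of a
binary tree in which every label is an inner node of every branch; the finite set records at which
nodes the branch deviates from a fixed one. -/
@[ext]
structure TreePoint where
  support : Finset NNReal
  isNodeLabel : ∀ q ∈ support, IsNodeLabel q

namespace TreePoint

/-- The greatest label at which two points differ; zero if they are equal. -/
noncomputable def split (s t : TreePoint) : NNReal :=
  (symmDiff s.support t.support).sup id

lemma split_self (s : TreePoint) : split s s = 0 := by simp [split]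

lemma split_comm (s t : TreePoint) : split s t = split t s := by
  rw [split, split, symmDiff_comm]

lemma split_mem {s t : TreePoint} (h : s ≠ t) :
    split s t ∈ symmDiff s.support t.support := by
  have hne : (symmDiff s.support t.support).Nonempty := by
    rw [Finset.nonempty_iff_ne_empty]
    intro h1
    exact h (TreePoint.ext (symmDiff_eq_bot.1 h1))
  obtain ⟨q, hq, h2⟩ := Finset.exists_mem_eq_sup _ hne id
  rw [split, h2]
  exact hq

lemma split_mem_iff {s t : TreePoint} (h : s ≠ t) :
    split s t ∈ s.support ↔ split s t ∉ t.support := by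
  have := split_mem h
  rw [Finset.mem_symmDiff] at this
  tauto

lemma mem_iff_of_split_lt {s t : TreePoint} {q : NNReal} (h : split s t < q) :
    q ∈ s.support ↔ q ∈ t.support := by
  by_contra h1
  have h2 : q ∈ symmDiff s.support t.support := by
    rw [Finset.mem_symmDiff]
    tauto
  exact absurd (Finset.le_sup (f := id) h2) (not_le.2 h)

lemma split_le {s t : TreePoint} {a : NNReal}
    (h : ∀ q, a < q → (q ∈ s.support ↔ q ∈ t.support)) : split s t ≤ a := by
  refine Finset.sup_le fun q hq => ?_
  by_contra h1
  rw [Finset.mem_symmDiff] at hq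
  have := h q (not_le.1 h1)
  tauto

lemma split_pos {s t : TreePoint} (h : s ≠ t) : 0 < split s t := by
  have := split_mem h
  rw [Finset.mem_symmDiff] at this
  rcases this with h | h
  · exact (s.isNodeLabel _ h.1).1
  · exact (t.isNodeLabel _ h.1).1

lemma split_triangle (s t u : TreePoint) : split s u ≤ max (split s t) (split t u) :=
  split_le fun _ hq => (mem_iff_of_split_lt ((le_max_left _ _).trans_lt hq)).trans
    (mem_iff_of_split_lt ((le_max_right _ _).trans_lt hq))

noncomputable instance : MetricSpace TreePoint where
  dist s t := split s t
  dist_self s := by simp [split_self]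
  dist_comm s t := by rw [split_comm]
  dist_triangle s t u := by
    rw [← NNReal.coe_add, NNReal.coe_le_coe]
    exact (split_triangle s t u).trans (max_le_add_of_nonneg zero_le zero_le)
  eq_of_dist_eq_zero := by
    intro s t h
    by_contra h1
    have := split_pos h1
    rw [NNReal.coe_eq_zero] at h
    exact this.ne' h

lemma dist_def (s t : TreePoint) : dist s t = split s t := rfl

/-- Two distinct points are compared at the greatest label at which they differ: at a rational
label the point containing it is the larger one, at an irrational label the smaller one. -/
def lexLT (s t : TreePoint) : Prop :=
  s ≠ t ∧ (split s t ∈ t.support ↔ IsRightLabel (split s t))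

lemma lexLT_total (s t : TreePoint) (h : s ≠ t) : lexLT s t ∨ lexLT t s := by
  have := split_mem_iff h
  rw [lexLT, lexLT, split_comm t s]
  have := h.symm
  tauto

lemma split_ne {s t u : TreePoint} (h : lexLT s t) (h' : lexLT t u) : split s t ≠ split t u := by
  intro heq
  have h1 := split_mem_iff h'.1
  have h2 := h.2
  have h3 := h'.2
  rw [heq] at h2
  tauto

lemma lexLT_trans_aux {s t u : TreePoint} (h : lexLT s t) (h' : lexLT t u) :
    lexLT s u ∧ split s u = max (split s t) (split t u) := by
  have hne := split_ne h h'
  rcases lt_or_gt_of_ne hne with hlt | hlt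
  · have h1 := mem_iff_of_split_lt hlt
    have h2 : split s u = split t u := by
      refine le_antisymm ((split_triangle s t u).trans (max_le hlt.le le_rfl)) ?_
      refine Finset.le_sup (f := id) ?_
      have := split_mem h'.1
      rw [Finset.mem_symmDiff] at this ⊢
      tauto
    refine ⟨⟨?_, ?_⟩, ?_⟩
    · rintro rfl
      rw [split_self] at h2
      exact (split_pos h'.1).ne h2
    · rw [h2]
      exact h'.2
    · rw [h2, max_eq_right hlt.le]
  · have h1 := mem_iff_of_split_lt hlt
    have h2 : split s u = split s t := by
      refine le_antisymm ((split_triangle s t u).trans (max_le le_rfl hlt.le)) ?_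
      refine Finset.le_sup (f := id) ?_
      have := split_mem h.1
      rw [Finset.mem_symmDiff] at this ⊢
      tauto
    refine ⟨⟨?_, ?_⟩, ?_⟩
    · rintro rfl
      rw [split_self] at h2
      exact (split_pos h.1).ne h2
    · rw [h2, ← h1]
      exact h.2
    · rw [h2, max_eq_left hlt.le]

noncomputable instance : LinearOrder TreePoint :=
  have : IsStrictTotalOrder TreePoint lexLT :=
    { trichotomous := fun s t h1 h2 => by
        by_contra h
        rcases lexLT_total s t h with h3 | h3
        · exact h1 h3
        · exact h2 h3
      irrefl := fun s h => h.1 rfl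
      trans := fun s t u h h' => (lexLT_trans_aux h h').1 }
  have := Classical.decRel lexLT
  linearOrderOfSTO lexLT

lemma lt_def (s t : TreePoint) : s < t ↔ lexLT s t := Iff.rfl

instance : RichOrdUlt TreePoint where
  dist_triangle_max s t u := by
    rw [dist_def, dist_def, dist_def, ← NNReal.coe_max, NNReal.coe_le_coe]
    exact split_triangle s t u
  dist_eq_max h h' := by
    rw [dist_def, dist_def, dist_def, ← NNReal.coe_max, NNReal.coe_inj]
    exact (lexLT_trans_aux h h').2
  dist_ne h h' := by
    rw [dist_def, dist_def, ne_eq, NNReal.coe_inj]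
    exact split_ne h h'
  countable := by
    have : Countable {q | IsNodeLabel q} := countable_isNodeLabel.to_subtype
    refine Function.Injective.countable
      (f := fun s : TreePoint => s.support.attach.image
        fun q => (⟨q.1, s.isNodeLabel _ q.2⟩ : {q | IsNodeLabel q})) fun s t h => ?_
    have h2 := congrArg (Finset.image Subtype.val) h
    ext q
    by_cases hq : IsNodeLabel q
    · simpa [hq] using Finset.ext_iff.1 h2 q
    · exact iff_of_false (fun h => hq (s.isNodeLabel q h)) (fun h => hq (t.isNodeLabel q h))
  nonempty := ⟨⟨∅, by simp⟩⟩
  exists_insert f Z W hZ hW hfW hZW left := by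
    -- an interval of labels that avoids the support of `f`
    obtain ⟨a, b, hab, hZa, hbW, hfree⟩ : ∃ a b : NNReal, a < b ∧ (∀ z ∈ Z, split f z ≤ a) ∧
        (∀ w ∈ W, b ≤ split f w) ∧ ∀ q ∈ f.support, a < q → b ≤ q := by
      have hZW' : ∀ z ∈ Z, ∀ w ∈ W, split f z < split f w := fun z hz w hw =>
        NNReal.coe_lt_coe.1 (hZW z hz w hw)
      obtain ⟨a, haZ, haW⟩ : ∃ a, (∀ z ∈ Z, split f z ≤ a) ∧ ∀ w ∈ W, a < split f w := by
        rcases Z.eq_empty_or_nonempty with rfl | hne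
        · refine ⟨0, by simp, fun w hw => split_pos ?_⟩
          rintro rfl
          exact hfW hw
        · obtain ⟨z, hz, hmax⟩ := Set.exists_max_image Z (split f) hZ hne
          exact ⟨split f z, hmax, hZW' z hz⟩
      have hfin : (split f '' W ∪ {q | q ∈ f.support ∧ a < q}).Finite :=
        (hW.image _).union (f.support.finite_toSet.subset fun q hq => hq.1)
      have hgt : ∀ q ∈ split f '' W ∪ {q | q ∈ f.support ∧ a < q}, a < q := by
        rintro q (⟨w, hw, rfl⟩ | h)
        · exact haW w hw
        · exact h.2
      rcases (split f '' W ∪ {q | q ∈ f.support ∧ a < q}).eq_empty_or_nonempty with he | hne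
      · refine ⟨a, a + 1, lt_add_one a, haZ, fun w hw => ?_, fun q hq haq => ?_⟩
        · exact absurd (he ▸ Or.inl ⟨w, hw, rfl⟩ : split f w ∈ (∅ : Set NNReal)) (by simp)
        · exact absurd (he ▸ Or.inr ⟨hq, haq⟩ : q ∈ (∅ : Set NNReal)) (by simp)
      · obtain ⟨b, hb, hmin⟩ := Set.exists_min_image _ id hfin hne
        exact ⟨a, b, hgt b hb, haZ, fun w hw => hmin _ (Or.inl ⟨w, hw, rfl⟩),
          fun q hq haq => hmin _ (Or.inr ⟨hq, haq⟩)⟩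
    obtain ⟨q, haq, hqb, hq, hside⟩ := exists_isNodeLabel hab left
    have hqf : q ∉ f.support := fun h => absurd (hfree q h haq) (not_le.2 hqb)
    let u : TreePoint := ⟨insert q f.support, by
      intro p hp
      rcases Finset.mem_insert.1 hp with rfl | hp
      · exact hq
      · exact f.isNodeLabel p hp⟩
    have hqu : q ∈ u.support := Finset.mem_insert_self _ _
    have hsplit : split f u = q := by
      have : symmDiff f.support u.support = {q} := by
        ext p
        simp only [u, Finset.mem_symmDiff, Finset.mem_insert, Finset.mem_singleton]
        by_cases hp : p = q
        · subst hp
          tauto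
        · tauto
      rw [split, this, Finset.sup_singleton, id]
    have huf : u ≠ f := by
      rintro h
      rw [h] at hqu
      exact hqf hqu
    refine ⟨u, huf, ?_, fun z hz => ?_, fun w hw => ?_⟩
    · rw [lt_def, lexLT, split_comm, hsplit]
      simp only [huf, ne_eq, not_false_eq_true, hqf, true_and, false_iff, hside, not_not]
    · rw [dist_def, dist_def, hsplit, NNReal.coe_lt_coe]
      exact (hZa z hz).trans_lt haq
    · rw [dist_def, dist_def, hsplit, NNReal.coe_lt_coe]
      exact hqb.trans_le (hbW w hw)

end TreePoint

/-! ### Automorphisms -/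

section ZPow

variable {X : Type*}

lemma zpow_succ_apply (g : Equiv.Perm X) (i : ℤ) (x : X) : (g ^ (i + 1)) x = g ((g ^ i) x) := by
  rw [add_comm, zpow_add, zpow_one, Equiv.Perm.mul_apply]

lemma zpow_succ_apply' (g : Equiv.Perm X) (i : ℤ) (x : X) : (g ^ (i + 1)) x = (g ^ i) (g x) := by
  rw [zpow_add, zpow_one, Equiv.Perm.mul_apply]

lemma zpow_apply_fixed {g : Equiv.Perm X} {x : X} (h : g x = x) (i : ℤ) : (g ^ i) x = x :=
  Equiv.Perm.zpow_apply_eq_self_of_apply_eq_self h i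

lemma zpow_neg_apply_zpow (g : Equiv.Perm X) (i : ℤ) (x : X) : (g ^ (-i)) ((g ^ i) x) = x := by
  rw [← Equiv.Perm.mul_apply, ← zpow_add, neg_add_cancel, zpow_zero, Equiv.Perm.one_apply]

end ZPow

section Automorphisms

variable {X : Type} [MetricSpace X] [LinearOrder X]

/-- The permutations preserving the order and the comparison of distances from a common point. -/
def isoGroup (X : Type) [MetricSpace X] [LinearOrder X] : Subgroup (Equiv.Perm X) where
  carrier := {g | (∀ x y, x < y ↔ g x < g y) ∧
    ∀ x y z, dist x y < dist x z ↔ dist (g x) (g y) < dist (g x) (g z)}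
  one_mem' := ⟨fun _ _ => Iff.rfl, fun _ _ _ => Iff.rfl⟩
  mul_mem' ha hb := ⟨fun _ _ => (hb.1 _ _).trans (ha.1 _ _),
    fun _ _ _ => (hb.2 _ _ _).trans (ha.2 _ _ _)⟩
  inv_mem' {g} h := ⟨fun x y => by simpa using (h.1 (g⁻¹ x) (g⁻¹ y)).symm,
    fun x y z => by simpa using (h.2 (g⁻¹ x) (g⁻¹ y) (g⁻¹ z)).symm⟩

namespace isoGroup

variable {g : Equiv.Perm X}

lemma lt_iff (hg : g ∈ isoGroup X) {x y : X} : x < y ↔ g x < g y := hg.1 x y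

lemma dist_lt_iff (hg : g ∈ isoGroup X) {x y z : X} :
    dist x y < dist x z ↔ dist (g x) (g y) < dist (g x) (g z) := hg.2 x y z

lemma dist_le_iff (hg : g ∈ isoGroup X) {x y z : X} :
    dist x y ≤ dist x z ↔ dist (g x) (g y) ≤ dist (g x) (g z) := by
  rw [← not_lt, ← not_lt, dist_lt_iff hg]

lemma dist_eq_iff (hg : g ∈ isoGroup X) {x y z : X} :
    dist x y = dist x z ↔ dist (g x) (g y) = dist (g x) (g z) := by
  rw [le_antisymm_iff, le_antisymm_iff, dist_le_iff hg, dist_le_iff hg (y := z)]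

lemma isPartialIso (hg : g ∈ isoGroup X) : IsPartialIso {p : X × X | g p.1 = p.2} := by
  refine ⟨?_, ?_⟩
  · intro p q hp hq
    rw [← Set.mem_ofPred_eq.mp hp, ← Set.mem_ofPred_eq.mp hq]
    exact lt_iff hg
  · intro p q r hp hq hr
    rw [← Set.mem_ofPred_eq.mp hp, ← Set.mem_ofPred_eq.mp hq, ← Set.mem_ofPred_eq.mp hr]
    exact dist_lt_iff hg

lemma of_isPartialIso (h : IsPartialIso {p : X × X | g p.1 = p.2}) : g ∈ isoGroup X :=
  ⟨fun x y => h.lt_iff (p := (x, g x)) (q := (y, g y)) rfl rfl,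
    fun x y z => h.dist_iff (p := (x, g x)) (q := (y, g y)) (r := (z, g z)) rfl rfl rfl⟩

end isoGroup

lemma IsPartialIso.exists_isoGroup [RichOrdUlt X] {H : Set (X × X)} (hH : IsPartialIso H)
    (hfin : H.Finite) : ∃ g ∈ isoGroup X, ∀ p ∈ H, g p.1 = p.2 := by
  obtain ⟨g, h1, h2⟩ := hH.exists_equiv hfin
  exact ⟨g, isoGroup.of_isPartialIso h1, h2⟩

/-! ### Approximation of automorphisms by automorphisms with prescribed fixed points -/

/-- Insertion of a point just above a set `L` that is a union of balls around `f`, as seen from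
the finite set `R`. -/
lemma exists_insert_above [RichOrdUlt X] (f : X) (R : Set X) (hR : R.Finite) (L : X → Prop)
    (hL : ∀ z w, L w → dist f z ≤ dist f w → L z) (hf : L f) (left : Prop) :
    ∃ u, u ≠ f ∧ (u < f ↔ left) ∧ ∀ z ∈ R, (L z → dist f z < dist f u) ∧
      (¬ L z → dist f u < dist f z) := by
  obtain ⟨u, h1, h2, h3, h4⟩ := RichOrdUlt.exists_insert f {z ∈ R | L z} {z ∈ R | ¬ L z}
    (hR.subset (Set.sep_subset _ _)) (hR.subset (Set.sep_subset _ _)) (fun h => h.2 hf)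
    (fun z hz w hw => by
      by_contra h
      exact hw.2 (hL w z hz.2 (not_lt.1 h))) left
  exact ⟨u, h1, h2, fun z hz => ⟨fun h => h3 z ⟨hz, h⟩, fun h => h4 z ⟨hz, h⟩⟩⟩

/-- An automorphism fixing `f` can be approximated by one that moves `u` to `v`, if `u` and `v`
lie on the same side of `f`, above the same part of a sufficiently large finite set. -/
lemma exists_approx_of_level [RichOrdUlt X] {g : Equiv.Perm X} (hg : g ∈ isoGroup X) {f : X}
    (hf : g f = f) {R : Set X} (hR : R.Finite) (L : X → Prop)
    {u v : X} (huv : u < f ↔ v < f)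
    (hu : ∀ z ∈ insert f R, (L z → dist f z < dist f u) ∧ (¬ L z → dist f u < dist f z))
    (hv : ∀ z ∈ insert f R,
      (L z → dist f (g z) < dist f v) ∧ (¬ L z → dist f v < dist f (g z))) :
    ∃ g' ∈ isoGroup X, (∀ z ∈ R, g' z = g z) ∧ g' u = v := by
  set H : Set (X × X) := (fun z => (z, g z)) '' insert f R with hH
  have hHpi : IsPartialIso H := (isoGroup.isPartialIso hg).mono (by
    rintro _ ⟨z, -, rfl⟩
    rfl)
  have hfH : (f, f) ∈ H := ⟨f, Or.inl rfl, by simp [hf]⟩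
  have hpi : IsPartialIso (insert (u, v) H) := by
    refine hHpi.insert_of_base hfH ?_ ?_ ?_ huv
    · rintro _ ⟨z, hz, rfl⟩ h
      by_cases hLz : L z
      · exact (hv z hz).1 hLz
      · exact absurd ((hu z hz).2 hLz) h.not_gt
    · rintro _ ⟨z, hz, rfl⟩ h
      by_cases hLz : L z
      · exact absurd ((hu z hz).1 hLz) h.not_gt
      · exact (hv z hz).2 hLz
    · rintro _ ⟨z, hz, rfl⟩
      by_cases hLz : L z
      · exact ((hu z hz).1 hLz).ne
      · exact ((hu z hz).2 hLz).ne'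
  obtain ⟨g', h1, h2⟩ := hpi.exists_isoGroup (((hR.insert f).image _).insert _)
  exact ⟨g', h1, fun z hz => h2 (z, g z) (Or.inr ⟨z, Or.inr hz, rfl⟩), h2 (u, v) (Or.inl rfl)⟩

/-- Near every automorphism that fixes `f` there is one with a fixed point between the orbits of
two finite sets: a point just above the invariant set `L` of the points not farther from `f` than
some point of the orbits of `P`. -/
lemma exists_approx_insert_fixed [RichOrdUlt X] {g : Equiv.Perm X} (hg : g ∈ isoGroup X) {f : X}
    (hf : g f = f) {R P Q : Set X} (hR : R.Finite) (hP : P.Finite) (hQ : Q.Finite) (hfP : f ∈ P)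
    (hPQ : ∀ p ∈ P, ∀ q ∈ Q, ∀ i j : ℤ, dist f ((g ^ i) p) < dist f ((g ^ j) q)) (left : Prop) :
    ∃ g' ∈ isoGroup X, (∀ z ∈ R, g' z = g z) ∧ ∃ u, g' u = u ∧ (u < f ↔ left) ∧
      (∀ p ∈ P, dist f p < dist f u) ∧ ∀ q ∈ Q, dist f u < dist f q := by
  have hfi : ∀ i : ℤ, (g ^ i) f = f := zpow_apply_fixed hf
  let L : X → Prop := fun z => ∃ p ∈ P, ∃ i : ℤ, dist f z ≤ dist f ((g ^ i) p)
  have hLg : ∀ z, L (g z) ↔ L z := by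
    intro z
    constructor
    · rintro ⟨p, hp, i, h⟩
      refine ⟨p, hp, i - 1, ?_⟩
      rw [isoGroup.dist_le_iff hg, hf, ← zpow_succ_apply, sub_add_cancel]
      exact h
    · rintro ⟨p, hp, i, h⟩
      refine ⟨p, hp, i + 1, ?_⟩
      rw [isoGroup.dist_le_iff hg, hf, ← zpow_succ_apply] at h
      exact h
  obtain ⟨u, -, h2, h3⟩ := exists_insert_above f (insert f R ∪ g '' (insert f R) ∪ P ∪ Q)
    ((((hR.insert f).union ((hR.insert f).image _)).union hP).union hQ) L
    (fun z w ⟨p, hp, i, h⟩ h' => ⟨p, hp, i, h'.trans h⟩) ⟨f, hfP, 0, by simp⟩ left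
  obtain ⟨g', h4, h5, h6⟩ := exists_approx_of_level hg hf hR L (u := u) (v := u) Iff.rfl
    (fun z hz => h3 z (Or.inl (Or.inl (Or.inl hz))))
    (fun z hz => by
      have := h3 (g z) (Or.inl (Or.inl (Or.inr ⟨z, hz, rfl⟩)))
      rwa [hLg] at this)
  refine ⟨g', h4, h5, u, h6, h2, fun p hp => ?_, fun q hq => ?_⟩
  · exact (h3 p (Or.inl (Or.inr hp))).1 ⟨p, hp, 0, by simp⟩
  · refine (h3 q (Or.inr hq)).2 ?_
    rintro ⟨p, hp, i, h⟩
    exact absurd (hPQ p hp q hq i 0) (not_lt.2 (by simpa using h))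

/-- Near every automorphism with fixed points `f`, `s`, `t` there is one that moves a point between
`s` and `t`, as seen from `f`, in a prescribed direction: of two points just above `s`, one can be
mapped to the other. -/
lemma exists_approx_insert_moving [RichOrdUlt X] {g : Equiv.Perm X} (hg : g ∈ isoGroup X)
    {f s t : X} (hf : g f = f) (hs : g s = s) {R : Set X} (hR : R.Finite)
    (hst : dist f s < dist f t) (left up : Prop) :
    ∃ g' ∈ isoGroup X, (∀ z ∈ R, g' z = g z) ∧ ∃ u, (u < f ↔ left) ∧ dist f s < dist f u ∧
      dist f u < dist f t ∧ dist f u ≠ dist f (g' u) ∧ (dist f u < dist f (g' u) ↔ up) := by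
  let L : X → Prop := fun z => dist f z ≤ dist f s
  have hLg : ∀ z, L (g z) ↔ L z := by
    intro z
    simp only [L]
    rw [isoGroup.dist_le_iff hg (y := z), hf, hs]
  have hL : ∀ z w, L w → dist f z ≤ dist f w → L z := fun z w h h' => h'.trans h
  have hLf : L f := by
    simp only [L, dist_self]
    exact dist_nonneg
  set R' := insert f R ∪ g '' (insert f R) ∪ {s, t} with hR'
  have hR'fin : R'.Finite :=
    ((hR.insert f).union ((hR.insert f).image _)).union ((Set.finite_singleton t).insert s)
  obtain ⟨b, -, hb1, hb2⟩ := exists_insert_above f R' hR'fin L hL hLf left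
  obtain ⟨a, -, ha1, ha2⟩ := exists_insert_above f (insert b R') (hR'fin.insert b) L hL hLf left
  have hsR : s ∈ R' := Or.inr (Or.inl rfl)
  have htR : t ∈ R' := Or.inr (Or.inr rfl)
  have hab : dist f a < dist f b := (ha2 b (Or.inl rfl)).2 (not_le.2 ((hb2 s hsR).1 le_rfl))
  have ha2' := fun z hz => ha2 z (Or.inr hz)
  have key : ∀ u v, (u < f ↔ left) → (v < f ↔ left) →
      (∀ z ∈ R', (L z → dist f z < dist f u) ∧ (¬ L z → dist f u < dist f z)) →
      (∀ z ∈ R', (L z → dist f z < dist f v) ∧ (¬ L z → dist f v < dist f z)) →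
      dist f u ≠ dist f v → (dist f u < dist f v ↔ up) →
      ∃ g' ∈ isoGroup X, (∀ z ∈ R, g' z = g z) ∧ ∃ u, (u < f ↔ left) ∧ dist f s < dist f u ∧
      dist f u < dist f t ∧ dist f u ≠ dist f (g' u) ∧ (dist f u < dist f (g' u) ↔ up) := by
    intro u v hu1 hv1 hu2 hv2 hne hup
    obtain ⟨g', h4, h5, h6⟩ := exists_approx_of_level hg hf hR L (u := u) (v := v)
      (hu1.trans hv1.symm) (fun z hz => hu2 z (Or.inl (Or.inl hz)))
      (fun z hz => by
        have := hv2 (g z) (Or.inl (Or.inr ⟨z, hz, rfl⟩))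
        rwa [hLg] at this)
    exact ⟨g', h4, h5, u, hu1, (hu2 s hsR).1 le_rfl, (hu2 t htR).2 (not_le.2 hst),
      by rwa [h6], by rwa [h6]⟩
  by_cases hup : up
  · exact key a b ha1 hb1 ha2' hb2 hab.ne (iff_of_true hab hup)
  · exact key b a hb1 ha1 hb2 ha2' hab.ne' (iff_of_false hab.not_gt hup)

/-- If `x` is moved so that the balls spanned by consecutive points of its orbit expand, then a
fixed point can be added at the lower end of this chain of balls. -/
lemma exists_approx_fixed_of_expanding [RichOrdUlt X] {g : Equiv.Perm X} (hg : g ∈ isoGroup X)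
    {x : X} (hx : dist (g x) x < dist (g x) (g (g x))) {R : Set X} (hR : R.Finite) :
    ∃ u, IsPartialIso (insert (u, u) ((fun z => (z, g z)) '' R)) ∧ dist u x ≠ dist u (g x) := by
  let o : ℤ → X := fun n => (g ^ n) x
  let r : ℤ → ℝ := fun n => dist (o n) (o (n + 1))
  have ho : ∀ n, o (n + 1) = g (o n) := fun n => zpow_succ_apply g n x
  have hr : StrictMono r := by
    refine strictMono_int_of_lt_succ fun n => ?_
    have h := (isoGroup.dist_lt_iff (zpow_mem hg n)).1 hx
    rw [← zpow_succ_apply', ← zpow_succ_apply', ← zpow_succ_apply'] at h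
    simp only [r, o]
    rwa [dist_comm]
  -- the chain of balls `B n` spanned by consecutive points of the orbit, and its intersection `E`
  let B : ℤ → X → Prop := fun n z => dist (o n) z ≤ r n
  have hBsucc : ∀ n z, B n z → B (n + 1) z := by
    intro n z h
    simp only [B] at h ⊢
    calc dist (o (n + 1)) z ≤ max (dist (o (n + 1)) (o n)) (dist (o n) z) :=
          IsUltrametricDist.dist_triangle_max _ _ _
      _ ≤ r n := max_le (dist_comm (o n) _).ge h
      _ ≤ r (n + 1) := (hr (lt_add_one n)).le
  have hBmono : ∀ z, Monotone fun n => B n z := fun z => monotone_int_of_le_succ fun n => hBsucc n z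
  have hBg : ∀ n z, B (n + 1) (g z) ↔ B n z := by
    intro n z
    simp only [B, r]
    rw [isoGroup.dist_le_iff hg (y := z), ho (n + 1), ho n]
  let E : X → Prop := fun z => ∀ n, B n z
  have hEg : ∀ z, E (g z) ↔ E z := by
    intro z
    refine ⟨fun h n => (hBg n z).1 (h (n + 1)), fun h n => ?_⟩
    have := (hBg (n - 1) z).2 (h (n - 1))
    rwa [sub_add_cancel] at this
  have ho0 : o 0 = x := by simp [o]
  have ho1 : o (-1 + 1) = x := ho0
  have ho2 : g x = o (0 + 1) := by rw [ho, ho0]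
  -- points of the ball `B (-1)` are nearer to `x` than to `g x`
  have hlow : ∀ v, B (-1) v → dist v x ≤ r (-1) ∧ r (-1) < dist v (g x) := by
    intro v hv
    have h1 : dist v x ≤ r (-1) := by
      have h2 := IsUltrametricDist.dist_triangle_max v (o (-1)) x
      refine h2.trans (max_le ?_ ?_)
      · rw [dist_comm]
        exact hv
      · simp only [r]
        rw [ho1]
    refine ⟨h1, ?_⟩
    by_contra h2
    have h3 := IsUltrametricDist.dist_triangle_max x v (g x)
    rw [dist_comm x v] at h3
    have h4 : r 0 = dist x (g x) := by
      simp only [r]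
      rw [ho0, ← ho2]
    have h5 : r (-1) < r 0 := hr (by norm_num)
    rw [h4] at h5
    exact absurd (h3.trans (max_le h1 (not_lt.1 h2))) (not_le.2 h5)
  set H : Set (X × X) := (fun z => (z, g z)) '' R with hH
  -- if `R` meets `E`, a point just above the part of `R` in `E` can be fixed; otherwise a point of
  -- the orbit so far back that its ball contains no point of `R` and of its image
  by_cases hE : ∃ f ∈ R, E f
  · obtain ⟨f, hfR, hEf⟩ := hE
    have hElow : ∀ z w, E w → dist f z ≤ dist f w → E z := by
      intro z w hw h n
      have h1 := IsUltrametricDist.dist_triangle_max (o n) f z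
      have h2 := IsUltrametricDist.dist_triangle_max f (o n) w
      rw [dist_comm f (o n)] at h2
      exact h1.trans (max_le (hEf n) (h.trans (h2.trans (max_le (hEf n) (hw n)))))
    obtain ⟨u, hu1, -, hu2⟩ := exists_insert_above f (R ∪ g '' R ∪ {x, g x})
      ((hR.union (hR.image _)).union ((Set.finite_singleton (g x)).insert x)) E hElow hEf True
    have hgf := (hu2 (g f) (Or.inl (Or.inr ⟨f, hfR, rfl⟩))).1 ((hEg f).2 hEf)
    have hfx : ¬ E x := by
      intro h
      have h1 := h (-2)
      have h2 := (hlow (o (-2)) (hBsucc (-2) _ (by simp only [B, dist_self]; exact dist_nonneg))).2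
      have h3 := hr (show (-2 : ℤ) < -1 by norm_num)
      have h4 := IsUltrametricDist.dist_triangle_max x (o (-2)) (g x)
      have h5 := h (-1)
      simp only [B] at h1 h5
      have h6 : o (-2 + 1) = o (-1) := rfl
      have h7 := OrdUlt.dist_eq_of_lt (u := o (-1)) (v := o (-2)) (w := x) (by
        have : r (-2) = dist (o (-1)) (o (-2)) := by
          simp only [r]
          rw [h6, dist_comm]
        rw [← this]
        have : r (-1) = dist (o (-1)) x := by
          simp only [r]
          rw [ho1]
        rwa [← this])
      rw [h7] at h1
      have : r (-1) = dist (o (-1)) x := by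
        simp only [r]
        rw [ho1]
      rw [← this] at h1
      exact absurd h1 (not_le.2 h3)
    have hfgx : ¬ E (g x) := fun h => hfx ((hEg x).1 h)
    have hux := OrdUlt.dist_eq_of_lt ((hu2 x (Or.inr (Or.inl rfl))).2 hfx)
    have hugx := OrdUlt.dist_eq_of_lt ((hu2 (g x) (Or.inr (Or.inr rfl))).2 hfgx)
    refine ⟨u, ?_, ?_⟩
    · have hHpi : IsPartialIso H := (isoGroup.isPartialIso hg).mono (by
        rintro _ ⟨z, -, rfl⟩
        rfl)
      have hgfu := OrdUlt.dist_eq_of_lt hgf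
      have hin : ∀ z ∈ R, E z → dist (g f) (g z) < dist (g f) u := by
        intro z hz hEz
        rw [hgfu]
        refine lt_of_le_of_lt (IsUltrametricDist.dist_triangle_max (g f) f (g z)) (max_lt ?_ ?_)
        · rwa [dist_comm]
        · exact (hu2 (g z) (Or.inl (Or.inr ⟨z, hz, rfl⟩))).1 ((hEg z).2 hEz)
      have hout : ∀ z ∈ R, ¬ E z → dist (g f) u < dist (g f) (g z) := by
        intro z hz hEz
        have h1 := (hu2 (g z) (Or.inl (Or.inr ⟨z, hz, rfl⟩))).2 (fun h => hEz ((hEg z).1 h))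
        rw [hgfu, OrdUlt.dist_eq_of_lt (hgf.trans h1)]
        exact h1
      refine hHpi.insert_of_base (f := (f, g f)) ⟨f, hfR, rfl⟩ ?_ ?_ ?_ ?_
      · rintro _ ⟨z, hz, rfl⟩ h
        by_cases hEz : E z
        · exact hin z hz hEz
        · exact absurd ((hu2 z (Or.inl (Or.inl hz))).2 hEz) h.not_gt
      · rintro _ ⟨z, hz, rfl⟩ h
        by_cases hEz : E z
        · exact absurd ((hu2 z (Or.inl (Or.inl hz))).1 hEz) h.not_gt
        · exact hout z hz hEz
      · rintro _ ⟨z, hz, rfl⟩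
        by_cases hEz : E z
        · exact ((hu2 z (Or.inl (Or.inl hz))).1 hEz).ne
        · exact ((hu2 z (Or.inl (Or.inl hz))).2 hEz).ne'
      · exact OrdUlt.gt_iff_of_dist_lt hgf
    · rw [hux, hugx]
      exact ((hlow f (hEf _)).1.trans_lt (hlow f (hEf _)).2).ne
  · push Not at hE
    have hev : ∀ᶠ n : ℤ in Filter.atBot, ∀ z ∈ R ∪ g '' R, ¬ B n z := by
      rw [Filter.eventually_all_finite (hR.union (hR.image _))]
      intro z hz
      have hz' : ¬ E z := by
        rcases hz with hz | ⟨w, hw, rfl⟩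
        · exact hE z hz
        · exact fun h => hE w hw ((hEg w).1 h)
      obtain ⟨n, hn⟩ := not_forall.1 hz'
      filter_upwards [Filter.eventually_le_atBot n] with m hm h
      exact hn (hBmono z hm h)
    obtain ⟨N, hN, hN1⟩ := (hev.and (Filter.eventually_le_atBot (-1 : ℤ))).exists
    have hBN : B N (o N) := by
      simp only [B, dist_self]
      exact dist_nonneg
    have hfar : ∀ z ∈ R, dist (o N) (g (o N)) < dist (o N) (g z) := by
      intro z hz
      rw [← ho]
      exact not_le.1 (hN (g z) (Or.inr ⟨z, hz, rfl⟩))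
    have hl := hlow (o N) (hBmono _ hN1 hBN)
    refine ⟨o N, ?_, (hl.1.trans_lt hl.2).ne⟩
    -- on the finite set, the map looks like `g` because `o N` and `g (o N)` are twins
    have htwin : ∀ p ∈ insert (o N, o N) H, ∀ q ∈ insert (o N, o N) H,
        dist p.2 q.2 = dist (g p.1) (g q.1) ∧ (p.2 < q.2 ↔ g p.1 < g q.1) := by
      rintro _ (rfl | ⟨z, hz, rfl⟩) _ (rfl | ⟨w, hw, rfl⟩)
      · simp
      · exact ⟨(OrdUlt.dist_eq_of_lt (hfar w hw)).symm, OrdUlt.lt_iff_of_dist_lt (hfar w hw)⟩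
      · refine ⟨?_, OrdUlt.gt_iff_of_dist_lt (hfar z hz)⟩
        rw [dist_comm, dist_comm _ (g (o N))]
        exact (OrdUlt.dist_eq_of_lt (hfar z hz)).symm
      · simp
    refine ⟨fun {p q} hp hq => ?_, fun {p q r} hp hq hr => ?_⟩
    · rw [(htwin p hp q hq).2]
      exact isoGroup.lt_iff hg
    · rw [(htwin p hp q hq).1, (htwin p hp r hr).1]
      exact isoGroup.dist_lt_iff hg

/-- Near every automorphism that moves `x` there is one with a fixed point that has different
distances from `x` and its image. Replacing the automorphism by its inverse, one may assume that the
balls spanned by consecutive points of the orbit expand. -/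
lemma exists_approx_fixed [RichOrdUlt X] {g : Equiv.Perm X} (hg : g ∈ isoGroup X)
    {x : X} (hx : g x ≠ x) {R : Set X} (hR : R.Finite) :
    ∃ g' ∈ isoGroup X, (∀ z ∈ R, g' z = g z) ∧ ∃ u, g' u = u ∧ dist u x ≠ dist u (g x) := by
  have key : ∃ u, IsPartialIso (insert (u, u) ((fun z => (z, g z)) '' R)) ∧
      dist u x ≠ dist u (g x) := by
    have hne : dist (g x) x ≠ dist (g x) (g (g x)) := by
      rcases lt_or_gt_of_ne hx with h | h
      · have h2 := (isoGroup.lt_iff hg).1 h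
        have := OrdUlt.dist_ne h2 h
        rw [dist_comm] at this
        exact this.symm
      · have h2 := (isoGroup.lt_iff hg).1 h
        rw [dist_comm]
        exact OrdUlt.dist_ne h h2
    rcases lt_or_gt_of_ne hne with h | h
    · exact exists_approx_fixed_of_expanding hg h hR
    · have hg' : g⁻¹ ∈ isoGroup X := inv_mem hg
      obtain ⟨u, h1, h2⟩ := exists_approx_fixed_of_expanding hg' (x := g x) (by
        have := (isoGroup.dist_lt_iff hg').1 h
        simpa using this) (hR.image g)
      refine ⟨u, h1.swap.mono ?_, by simpa using h2.symm⟩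
      rintro _ (rfl | ⟨z, hz, rfl⟩)
      · exact Or.inl rfl
      · exact Or.inr ⟨g z, ⟨z, hz, rfl⟩, by simp⟩
  obtain ⟨u, h1, h2⟩ := key
  obtain ⟨g', h3, h4⟩ := h1.exists_isoGroup ((hR.image _).insert _)
  exact ⟨g', h3, fun z hz => h4 (z, g z) (Or.inr ⟨z, hz, rfl⟩), u, h4 (u, u) (Or.inl rfl), h2⟩

end Automorphisms

/-! ### Conjugacy of generic automorphisms -/

section Conjugacy

variable {X : Type} [MetricSpace X] [LinearOrder X]

/-- The genericity conditions that determine an automorphism up to conjugacy. -/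
structure IsGenericAut (g : Equiv.Perm X) : Prop where
  /-- From some fixed point, the images of a moved point have different distances. -/
  exists_fixed : ∀ x, g x ≠ x → ∃ f, g f = f ∧ dist f x ≠ dist f (g x)
  /-- Fixed points occur wherever the orbits of the points of a finite set permit it. -/
  insert_fixed : ∀ (f : X) (P Q : Finset X) (left : Bool), g f = f → f ∈ P →
    (∀ p ∈ P, ∀ q ∈ Q, ∀ i j : ℤ, dist f ((g ^ i) p) < dist f ((g ^ j) q)) →
    ∃ u, g u = u ∧ (u < f ↔ left = true) ∧ (∀ p ∈ P, dist f p < dist f u) ∧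
      ∀ q ∈ Q, dist f u < dist f q
  /-- Between any two distances of fixed points from a fixed point, points are moved upwards and
  points are moved downwards. -/
  insert_moving : ∀ (f s t : X) (left up : Bool), g f = f → g s = s → g t = t →
    dist f s < dist f t → ∃ u, (u < f ↔ left = true) ∧ dist f s < dist f u ∧
      dist f u < dist f t ∧ dist f u ≠ dist f (g u) ∧ (dist f u < dist f (g u) ↔ up = true)

/-- The stages of the construction of a conjugation of `g` into `h`: partial isomorphisms that
intertwine `g` and `h`, consist of finitely many orbits, and contain with every moved point a fixed
point that sees it moving. -/
structure IsConjState (g h : Equiv.Perm X) (H : Set (X × X)) : Prop where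
  pi : IsPartialIso H
  inv : ∀ p ∈ H, ∀ i : ℤ, ((g ^ i) p.1, (h ^ i) p.2) ∈ H
  fg : ∃ s : Set (X × X), s.Finite ∧ s ⊆ H ∧
    ∀ p ∈ H, ∃ q ∈ s, ∃ i : ℤ, p = ((g ^ i) q.1, (h ^ i) q.2)
  moving : ∀ p ∈ H, g p.1 ≠ p.1 → ∃ f ∈ H, g f.1 = f.1 ∧ dist f.1 p.1 ≠ dist f.1 (g p.1)

namespace IsConjState

variable {g h : Equiv.Perm X} {H : Set (X × X)}

lemma empty : IsConjState g h ∅ :=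
  ⟨IsPartialIso.empty, by simp, ⟨∅, by simp⟩, by simp⟩

lemma inv_one (hH : IsConjState g h H) {p : X × X} (hp : p ∈ H) : (g p.1, h p.2) ∈ H := by
  simpa using hH.inv p hp 1

lemma fixed_iff (hH : IsConjState g h H) {p : X × X} (hp : p ∈ H) :
    g p.1 = p.1 ↔ h p.2 = p.2 :=
  hH.pi.eq_iff (hH.inv_one hp) hp

lemma swap (hH : IsConjState g h H) : IsConjState h g (Prod.swap ⁻¹' H) where
  pi := hH.pi.swap
  inv p hp i := hH.inv p.swap hp i
  fg := by
    obtain ⟨s, h1, h2, h3⟩ := hH.fg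
    refine ⟨Prod.swap ⁻¹' s, h1.preimage Prod.swap_injective.injOn, fun p hp => h2 hp, ?_⟩
    intro p hp
    obtain ⟨q, hq, i, hi⟩ := h3 _ hp
    refine ⟨q.swap, by simpa using hq, i, ?_⟩
    rw [← Prod.swap_swap p, hi]
    rfl
  moving := by
    intro p hp hne
    obtain ⟨f, hf, h1, h2⟩ := hH.moving p.swap hp (fun h => hne ((hH.fixed_iff hp).1 h))
    refine ⟨f.swap, by simpa using hf, (hH.fixed_iff hf).1 h1, ?_⟩
    exact fun h => h2 ((hH.pi.dist_eq_iff hf hp (hH.inv_one hp)).2 h)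

lemma inverse (hH : IsConjState g h H) : IsConjState g⁻¹ h⁻¹ H where
  pi := hH.pi
  inv p hp i := by
    have := hH.inv p hp (-i)
    rwa [zpow_neg, zpow_neg, ← inv_zpow, ← inv_zpow] at this
  fg := by
    obtain ⟨s, h1, h2, h3⟩ := hH.fg
    refine ⟨s, h1, h2, fun p hp => ?_⟩
    obtain ⟨q, hq, i, hi⟩ := h3 p hp
    refine ⟨q, hq, -i, ?_⟩
    rw [hi, inv_zpow, inv_zpow, zpow_neg, zpow_neg, inv_inv, inv_inv]
  moving := by
    intro p hp hne
    have hpre : (g⁻¹ p.1, h⁻¹ p.2) ∈ H := by simpa using hH.inv p hp (-1)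
    obtain ⟨f, hf, h1, h2⟩ := hH.moving _ hpre (by
      intro h
      refine hne ?_
      simpa using h.symm)
    refine ⟨f, hf, ?_, ?_⟩
    · rw [Equiv.Perm.inv_eq_iff_eq, h1]
    · simpa using h2.symm

/-- An orbit can be added to a stage, if its distances from some fixed point `f`, and its relation
to the points of the same distance from `f`, are reproduced. -/
lemma add_orbit [OrdUlt X] (hg : g ∈ isoGroup X) (hh : h ∈ isoGroup X) (hH : IsConjState g h H)
    {f : X × X} (hf : f ∈ H) (hgf : g f.1 = f.1) {x y : X}
    (hlt : ∀ p ∈ H, dist f.1 p.1 < dist f.1 x ↔ dist f.2 p.2 < dist f.2 y)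
    (hgt : ∀ p ∈ H, dist f.1 x < dist f.1 p.1 ↔ dist f.2 y < dist f.2 p.2)
    (hside : (x < f.1 ↔ y < f.2) ∧ (f.1 < x ↔ f.2 < y))
    (hmove : (g x = x ∧ h y = y) ∨
      (dist f.1 x < dist f.1 (g x) ∧ dist f.2 y < dist f.2 (h y)) ∨
      (dist f.1 (g x) < dist f.1 x ∧ dist f.2 (h y) < dist f.2 y))
    (hcone : IsPartialIso (insert (x, y) {p ∈ H | dist f.1 p.1 = dist f.1 x})) :
    IsConjState g h (H ∪ Set.range fun i : ℤ => ((g ^ i) x, (h ^ i) y)) := by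
  have hhf : h f.2 = f.2 := (hH.fixed_iff hf).1 hgf
  have hgi : ∀ i : ℤ, (g ^ i) f.1 = f.1 := zpow_apply_fixed hgf
  have hhi : ∀ i : ℤ, (h ^ i) f.2 = f.2 := zpow_apply_fixed hhf
  -- translations preserve all the data
  have hgd : ∀ (i : ℤ) z w, dist f.1 z < dist f.1 w ↔
      dist f.1 ((g ^ i) z) < dist f.1 ((g ^ i) w) := by
    intro i z w
    have := isoGroup.dist_lt_iff (zpow_mem hg i) (x := f.1) (y := z) (z := w)
    rwa [hgi] at this
  have hhd : ∀ (i : ℤ) z w, dist f.2 z < dist f.2 w ↔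
      dist f.2 ((h ^ i) z) < dist f.2 ((h ^ i) w) := by
    intro i z w
    have := isoGroup.dist_lt_iff (zpow_mem hh i) (x := f.2) (y := z) (z := w)
    rwa [hhi] at this
  have horb : ∀ i j : ℤ, dist f.1 ((g ^ i) x) < dist f.1 ((g ^ j) x) ↔
      dist f.2 ((h ^ i) y) < dist f.2 ((h ^ j) y) := by
    intro i j
    rcases hmove with ⟨h1, h2⟩ | ⟨h1, h2⟩ | ⟨h1, h2⟩
    · rw [zpow_apply_fixed h1, zpow_apply_fixed h1, zpow_apply_fixed h2, zpow_apply_fixed h2]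
      simp
    · have m1 : StrictMono fun n : ℤ => dist f.1 ((g ^ n) x) :=
        strictMono_int_of_lt_succ fun n => by
          rw [zpow_succ_apply', ← hgd]
          exact h1
      have m2 : StrictMono fun n : ℤ => dist f.2 ((h ^ n) y) :=
        strictMono_int_of_lt_succ fun n => by
          rw [zpow_succ_apply', ← hhd]
          exact h2
      exact m1.lt_iff_lt.trans m2.lt_iff_lt.symm
    · have m1 : StrictAnti fun n : ℤ => dist f.1 ((g ^ n) x) :=
        strictAnti_int_of_succ_lt fun n => by
          rw [zpow_succ_apply', ← hgd]
          exact h1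
      have m2 : StrictAnti fun n : ℤ => dist f.2 ((h ^ n) y) :=
        strictAnti_int_of_succ_lt fun n => by
          rw [zpow_succ_apply', ← hhd]
          exact h2
      exact m1.lt_iff_gt.trans m2.lt_iff_gt.symm
  have horb_eq : ∀ i j : ℤ, dist f.1 ((g ^ i) x) = dist f.1 ((g ^ j) x) →
      (g ^ i) x = (g ^ j) x ∧ (h ^ i) y = (h ^ j) y := by
    intro i j hij
    rcases hmove with ⟨h1, h2⟩ | ⟨h1, h2⟩ | ⟨h1, h2⟩
    · rw [zpow_apply_fixed h1, zpow_apply_fixed h1, zpow_apply_fixed h2, zpow_apply_fixed h2]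
      simp
    · have m1 : StrictMono fun n : ℤ => dist f.1 ((g ^ n) x) :=
        strictMono_int_of_lt_succ fun n => by
          rw [zpow_succ_apply', ← hgd]
          exact h1
      rw [m1.injective hij]
      exact ⟨rfl, rfl⟩
    · have m1 : StrictAnti fun n : ℤ => dist f.1 ((g ^ n) x) :=
        strictAnti_int_of_succ_lt fun n => by
          rw [zpow_succ_apply', ← hgd]
          exact h1
      rw [m1.injective hij]
      exact ⟨rfl, rfl⟩
  have hlt' : ∀ p ∈ H, ∀ i : ℤ, dist f.1 p.1 < dist f.1 ((g ^ i) x) ↔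
      dist f.2 p.2 < dist f.2 ((h ^ i) y) := by
    intro p hp i
    have := hlt _ (hH.inv p hp (-i))
    rwa [hgd i, hhd i, ← Equiv.Perm.mul_apply, ← Equiv.Perm.mul_apply, ← zpow_add, ← zpow_add,
      add_neg_cancel, zpow_zero, zpow_zero] at this
  have hgt' : ∀ p ∈ H, ∀ i : ℤ, dist f.1 ((g ^ i) x) < dist f.1 p.1 ↔
      dist f.2 ((h ^ i) y) < dist f.2 p.2 := by
    intro p hp i
    have := hgt _ (hH.inv p hp (-i))
    rwa [hgd i, hhd i, ← Equiv.Perm.mul_apply, ← Equiv.Perm.mul_apply, ← zpow_add, ← zpow_add,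
      add_neg_cancel, zpow_zero, zpow_zero] at this
  -- pairs at the same distance from `f` as the `i`-th point of the orbit come from the cone of `x`
  have htrans : ∀ i : ℤ, ∀ p ∈ H ∪ Set.range fun i : ℤ => ((g ^ i) x, (h ^ i) y),
      dist f.1 p.1 = dist f.1 ((g ^ i) x) →
      ((g ^ (-i)) p.1, (h ^ (-i)) p.2) ∈ insert (x, y) {p ∈ H | dist f.1 p.1 = dist f.1 x} := by
    rintro i p (hp | ⟨j, rfl⟩) hd
    · refine Or.inr ⟨hH.inv p hp _, ?_⟩
      have := (isoGroup.dist_eq_iff (zpow_mem hg (-i))).1 hd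
      rwa [hgi, zpow_neg_apply_zpow] at this
    · obtain ⟨h1, h2⟩ := horb_eq j i hd
      left
      simp only [h1, h2, zpow_neg_apply_zpow]
  have hcone' : ∀ i : ℤ, ∀ p ∈ H ∪ Set.range fun i : ℤ => ((g ^ i) x, (h ^ i) y),
      ∀ q ∈ H ∪ Set.range fun i : ℤ => ((g ^ i) x, (h ^ i) y),
      ∀ r ∈ H ∪ Set.range fun i : ℤ => ((g ^ i) x, (h ^ i) y),
      dist f.1 p.1 = dist f.1 ((g ^ i) x) → dist f.1 q.1 = dist f.1 ((g ^ i) x) →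
      dist f.1 r.1 = dist f.1 ((g ^ i) x) → (p.1 < q.1 ↔ p.2 < q.2) ∧
      (dist p.1 q.1 < dist p.1 r.1 ↔ dist p.2 q.2 < dist p.2 r.2) := by
    intro i p hp q hq r hr h1 h2 h3
    have h4 := htrans i p hp h1
    have h5 := htrans i q hq h2
    have h6 := htrans i r hr h3
    have h7 := hcone.lt_iff h4 h5
    have h8 := hcone.dist_iff h4 h5 h6
    rw [← isoGroup.lt_iff (zpow_mem hg _), ← isoGroup.lt_iff (zpow_mem hh _)] at h7
    rw [← isoGroup.dist_lt_iff (zpow_mem hg _), ← isoGroup.dist_lt_iff (zpow_mem hh _)] at h8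
    exact ⟨h7, h8⟩
  refine ⟨?_, ?_, ?_, ?_⟩
  · refine IsPartialIso.of_base (f := f) ?_ ?_ ?_
    · rintro p (hp | ⟨i, rfl⟩) q (hq | ⟨j, rfl⟩)
      · exact hH.pi.dist_iff hf hp hq
      · exact hlt' p hp j
      · exact hgt' q hq i
      · exact horb i j
    · rintro p (hp | ⟨i, rfl⟩)
      · exact ⟨hH.pi.lt_iff hp hf, hH.pi.lt_iff hf hp⟩
      · have h1 := isoGroup.lt_iff (zpow_mem hg i) (x := x) (y := f.1)
        have h2 := isoGroup.lt_iff (zpow_mem hh i) (x := y) (y := f.2)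
        have h3 := isoGroup.lt_iff (zpow_mem hg i) (x := f.1) (y := x)
        have h4 := isoGroup.lt_iff (zpow_mem hh i) (x := f.2) (y := y)
        rw [hgi] at h1 h3
        rw [hhi] at h2 h4
        exact ⟨h1.symm.trans (hside.1.trans h2), h3.symm.trans (hside.2.trans h4)⟩
    · intro p hp q hq r hr h1 h2
      by_cases hall : p ∈ H ∧ q ∈ H ∧ r ∈ H
      · exact ⟨hH.pi.lt_iff hall.1 hall.2.1, hH.pi.dist_iff hall.1 hall.2.1 hall.2.2⟩
      · obtain ⟨i, hi⟩ : ∃ i : ℤ, dist f.1 p.1 = dist f.1 ((g ^ i) x) := by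
          rcases hp with hp | ⟨i, rfl⟩
          · rcases hq with hq | ⟨i, rfl⟩
            · rcases hr with hr | ⟨i, rfl⟩
              · exact absurd ⟨hp, hq, hr⟩ hall
              · exact ⟨i, h2⟩
            · exact ⟨i, h1⟩
          · exact ⟨i, rfl⟩
        exact hcone' i p hp q hq r hr hi (h1.symm.trans hi) (h2.symm.trans hi)
  · rintro p (hp | ⟨j, rfl⟩) i
    · exact Or.inl (hH.inv p hp i)
    · refine Or.inr ⟨i + j, ?_⟩
      simp only [zpow_add, Equiv.Perm.mul_apply]
  · obtain ⟨s, h1, h2, h3⟩ := hH.fg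
    refine ⟨insert (x, y) s, h1.insert _, ?_, ?_⟩
    · rintro p (rfl | hp)
      · exact Or.inr ⟨0, by simp⟩
      · exact Or.inl (h2 hp)
    · rintro p (hp | ⟨j, rfl⟩)
      · obtain ⟨q, hq, i, hi⟩ := h3 p hp
        exact ⟨q, Or.inr hq, i, hi⟩
      · exact ⟨(x, y), Or.inl rfl, j, rfl⟩
  · rintro p (hp | ⟨j, rfl⟩) hne
    · obtain ⟨f', hf', h1, h2⟩ := hH.moving p hp hne
      exact ⟨f', Or.inl hf', h1, h2⟩
    · refine ⟨f, Or.inl hf, hgf, ?_⟩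
      simp only [← zpow_succ_apply] at hne ⊢
      intro hd
      exact hne (horb_eq _ _ hd).1.symm

/-- A stage extends by any fixed point. -/
lemma exists_add_fixed [RichOrdUlt X] (hg : g ∈ isoGroup X) (hh : h ∈ isoGroup X)
    (hgen : IsGenericAut h) (hH : IsConjState g h H) {x : X} (hx : g x = x) :
    ∃ H', IsConjState g h H' ∧ H ⊆ H' ∧ ∃ y, (x, y) ∈ H' := by
  by_cases hxH : ∃ p ∈ H, p.1 = x
  · obtain ⟨p, hp, rfl⟩ := hxH
    exact ⟨H, hH, subset_rfl, p.2, hp⟩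
  rcases H.eq_empty_or_nonempty with rfl | ⟨p₀, hp₀⟩
  · obtain ⟨y, hy⟩ : ∃ y, h y = y := by
      obtain ⟨z⟩ := RichOrdUlt.nonempty (X := X)
      by_cases hz : h z = z
      · exact ⟨z, hz⟩
      · obtain ⟨f, hf, -⟩ := hgen.exists_fixed z hz
        exact ⟨f, hf⟩
    refine ⟨{(x, y)}, ⟨IsPartialIso.singleton _, ?_, ⟨{(x, y)}, by simp, subset_rfl, ?_⟩, ?_⟩,
      Set.empty_subset _, y, rfl⟩
    · rintro p rfl i
      rw [zpow_apply_fixed hx, zpow_apply_fixed hy]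
      rfl
    · rintro p rfl
      exact ⟨_, rfl, 0, by simp⟩
    · rintro p rfl hne
      exact absurd hx hne
  obtain ⟨s, hs1, hs2, hs3⟩ := hH.fg
  -- all fixed points of the stage belong to the finite generating set
  have hfix : ∀ p ∈ H, g p.1 = p.1 → p ∈ s := by
    intro p hp hgp
    obtain ⟨q, hq, i, rfl⟩ := hs3 p hp
    have hgq : g q.1 = q.1 := by
      simp only [← zpow_succ_apply] at hgp
      rw [zpow_succ_apply'] at hgp
      exact (g ^ i).injective hgp
    rw [zpow_apply_fixed hgq, zpow_apply_fixed ((hH.fixed_iff (hs2 hq)).1 hgq)]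
    exact hq
  have hex : {p ∈ s | g p.1 = p.1}.Nonempty := by
    by_cases h0 : g p₀.1 = p₀.1
    · exact ⟨p₀, hfix p₀ hp₀ h0, h0⟩
    · obtain ⟨f, hf, h1, -⟩ := hH.moving p₀ hp₀ h0
      exact ⟨f, hfix f hf h1, h1⟩
  obtain ⟨f, ⟨hfs, hgf⟩, hmin⟩ := Set.exists_min_image _ (fun p : X × X => dist p.1 x)
    (hs1.subset (Set.sep_subset _ _)) hex
  have hf : f ∈ H := hs2 hfs
  have hhf := (hH.fixed_iff hf).1 hgf
  have hxf : x ≠ f.1 := fun h => hxH ⟨f, hf, h.symm⟩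
  -- no point of the stage has the same distance from `f` as `x`
  have hne : ∀ p ∈ H, dist f.1 p.1 ≠ dist f.1 x := by
    intro z hz hd
    have h1 := OrdUlt.dist_lt_of_eq hd.symm hxf
    by_cases hgz : g z.1 = z.1
    · have := hmin z ⟨hfix z hz hgz, hgz⟩
      rw [dist_comm z.1] at this
      exact absurd h1 (not_lt.2 this)
    · obtain ⟨f', hf', h2, h3⟩ := hH.moving z hz hgz
      have hmin' := hmin f' ⟨hfix f' hf' h2, h2⟩
      have hd' : dist f.1 x = dist f.1 (g z.1) := by
        have := (isoGroup.dist_eq_iff hg).1 hd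
        rw [hgf, hx] at this
        exact this.symm
      have h4 := OrdUlt.dist_lt_of_eq hd' hxf
      rw [dist_comm f'.1] at hmin'
      have h5 := OrdUlt.dist_eq_of_lt (h1.trans_le hmin')
      have h6 := OrdUlt.dist_eq_of_lt (h4.trans_le hmin')
      rw [dist_comm f'.1, dist_comm f'.1, h5, h6] at h3
      exact h3 rfl
  have hgi : ∀ i : ℤ, (g ^ i) f.1 = f.1 := zpow_apply_fixed hgf
  have hxi : ∀ i : ℤ, (g ^ i) x = x := zpow_apply_fixed hx
  have hlow : ∀ p ∈ H, ∀ i : ℤ, dist f.1 p.1 < dist f.1 x →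
      dist f.1 ((g ^ i) p.1) < dist f.1 x := by
    intro p hp i hlt
    have := (isoGroup.dist_lt_iff (zpow_mem hg i)).1 hlt
    rwa [hgi, hxi] at this
  have hupp : ∀ p ∈ H, ∀ i : ℤ, dist f.1 x < dist f.1 p.1 →
      dist f.1 x < dist f.1 ((g ^ i) p.1) := by
    intro p hp i hlt
    have := (isoGroup.dist_lt_iff (zpow_mem hg i)).1 hlt
    rwa [hgi, hxi] at this
  have hPfin : (Prod.snd '' {p ∈ s | dist f.1 p.1 < dist f.1 x}).Finite :=
    (hs1.subset (Set.sep_subset _ _)).image _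
  have hQfin : (Prod.snd '' {p ∈ s | dist f.1 x < dist f.1 p.1}).Finite :=
    (hs1.subset (Set.sep_subset _ _)).image _
  classical
  obtain ⟨y, hy, hyside, hyP, hyQ⟩ := hgen.insert_fixed f.2 hPfin.toFinset hQfin.toFinset
    (decide (x < f.1)) hhf
    (by
      rw [Set.Finite.mem_toFinset]
      exact ⟨f, ⟨hfs, by simpa using hxf.symm⟩, rfl⟩)
    (by
      intro p' hp' q' hq' i j
      rw [Set.Finite.mem_toFinset] at hp' hq'
      obtain ⟨p, ⟨hp, h1⟩, rfl⟩ := hp'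
      obtain ⟨q, ⟨hq, h2⟩, rfl⟩ := hq'
      refine (hH.pi.dist_iff hf (hH.inv p (hs2 hp) i) (hH.inv q (hs2 hq) j)).1 ?_
      exact (hlow p (hs2 hp) i h1).trans (hupp q (hs2 hq) j h2))
  simp only [Set.Finite.mem_toFinset, decide_eq_true_eq] at hyP hyQ hyside
  have hhi : ∀ i : ℤ, (h ^ i) f.2 = f.2 := zpow_apply_fixed hhf
  have hyi : ∀ i : ℤ, (h ^ i) y = y := zpow_apply_fixed hy
  have hlt : ∀ p ∈ H, dist f.1 p.1 < dist f.1 x → dist f.2 p.2 < dist f.2 y := by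
    intro p hp hd
    obtain ⟨q, hq, i, rfl⟩ := hs3 p hp
    have h1 := hlow _ hp (-i) hd
    simp only [zpow_neg_apply_zpow] at h1
    have h2 := (isoGroup.dist_lt_iff (zpow_mem hh i)).1 (hyP q.2 ⟨q, ⟨hq, h1⟩, rfl⟩)
    rwa [hhi, hyi] at h2
  have hgt : ∀ p ∈ H, dist f.1 x < dist f.1 p.1 → dist f.2 y < dist f.2 p.2 := by
    intro p hp hd
    obtain ⟨q, hq, i, rfl⟩ := hs3 p hp
    have h1 := hupp _ hp (-i) hd
    simp only [zpow_neg_apply_zpow] at h1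
    have h2 := (isoGroup.dist_lt_iff (zpow_mem hh i)).1 (hyQ q.2 ⟨q, ⟨hq, h1⟩, rfl⟩)
    rwa [hhi, hyi] at h2
  have hyf : y ≠ f.2 := by
    rintro rfl
    have := hlt f hf (by simpa using hxf.symm)
    simp at this
  refine ⟨_, hH.add_orbit hg hh hf hgf (x := x) (y := y) ?_ ?_ ⟨hyside.symm, ?_⟩
    (Or.inl ⟨hx, hy⟩) ?_, Set.subset_union_left, y, Or.inr ⟨0, by simp⟩⟩
  · intro p hp
    refine ⟨hlt p hp, fun h1 => ?_⟩
    by_contra h2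
    exact (hgt p hp (lt_of_le_of_ne (not_lt.1 h2) (hne p hp).symm)).not_gt h1
  · intro p hp
    refine ⟨hgt p hp, fun h1 => ?_⟩
    by_contra h2
    exact (hlt p hp (lt_of_le_of_ne (not_lt.1 h2) (hne p hp))).not_gt h1
  · rw [← not_iff_not, not_lt, not_lt, le_iff_lt_or_eq, le_iff_lt_or_eq, hyside]
    simp [hxf, hyf]
  · have : {p ∈ H | dist f.1 p.1 = dist f.1 x} = ∅ := by
      ext p
      simpa using fun hp => hne p hp
    rw [this]
    simpa using IsPartialIso.singleton (x, y)

/-- If the distance of `x` from the fixed point `f` falls into a fundamental domain of an orbit of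
the stage, then finitely many points of the stage determine the position of the orbit of `x`. -/
lemma exists_add_of_interleaved [RichOrdUlt X] (hg : g ∈ isoGroup X) (hh : h ∈ isoGroup X)
    (hH : IsConjState g h H) {f : X × X} (hf : f ∈ H) (hgf : g f.1 = f.1) {x : X}
    {y : X × X} (hy : y ∈ H) (h1 : dist f.1 y.1 ≤ dist f.1 x)
    (h2 : dist f.1 x < dist f.1 (g y.1)) :
    ∃ H', IsConjState g h H' ∧ H ⊆ H' ∧ ∃ y, (x, y) ∈ H' := by
  have hgi : ∀ i : ℤ, (g ^ i) f.1 = f.1 := zpow_apply_fixed hgf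
  have hhf := (hH.fixed_iff hf).1 hgf
  have hgd : ∀ (i : ℤ) z w, dist f.1 z ≤ dist f.1 w ↔
      dist f.1 ((g ^ i) z) ≤ dist f.1 ((g ^ i) w) := by
    intro i z w
    have := isoGroup.dist_le_iff (zpow_mem hg i) (x := f.1) (y := z) (z := w)
    rwa [hgi] at this
  have hymono : StrictMono fun n : ℤ => dist f.1 ((g ^ n) y.1) :=
    strictMono_int_of_lt_succ fun n => by
      rw [zpow_succ_apply', ← not_le, ← hgd, not_le]
      exact h1.trans_lt h2
  have hgy : (g y.1, h y.2) ∈ H := hH.inv_one hy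
  set K : Set (X × X) := {p ∈ H | dist f.1 y.1 ≤ dist f.1 p.1 ∧ dist f.1 p.1 ≤ dist f.1 (g y.1)}
    with hK
  -- every orbit meets the fundamental domain in at most two points
  have hKfin : K.Finite := by
    obtain ⟨s, hs1, -, hs3⟩ := hH.fg
    have hsub : K ⊆ ⋃ q ∈ s, (fun i : ℤ => ((g ^ i) q.1, (h ^ i) q.2)) ''
        {i : ℤ | dist f.1 y.1 ≤ dist f.1 ((g ^ i) q.1) ∧
          dist f.1 ((g ^ i) q.1) ≤ dist f.1 (g y.1)} := by
      rintro p ⟨hp, h3⟩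
      obtain ⟨q, hq, i, rfl⟩ := hs3 p hp
      exact Set.mem_biUnion hq ⟨i, h3, rfl⟩
    refine (hs1.biUnion fun q hq => Set.Finite.image _ ?_).subset hsub
    have hclose : ∀ i j : ℤ, dist f.1 y.1 ≤ dist f.1 ((g ^ i) q.1) →
        dist f.1 ((g ^ j) q.1) ≤ dist f.1 (g y.1) → j ≤ i + 1 := by
      intro i j h3 h4
      have h5 := (hgd (j - i) _ _).1 h3
      rw [← Equiv.Perm.mul_apply, ← zpow_add, sub_add_cancel] at h5
      have h6 := h5.trans h4
      have h7 : dist f.1 (g y.1) = dist f.1 ((g ^ (1 : ℤ)) y.1) := by rw [zpow_one]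
      rw [h7] at h6
      have := hymono.le_iff_le.1 h6
      linarith
    rcases Set.eq_empty_or_nonempty {i : ℤ | dist f.1 y.1 ≤ dist f.1 ((g ^ i) q.1) ∧
          dist f.1 ((g ^ i) q.1) ≤ dist f.1 (g y.1)} with he | ⟨i, hi⟩
    · rw [he]
      exact Set.finite_empty
    · refine (Set.finite_Icc (i - 1) (i + 1)).subset fun j hj => ⟨?_, ?_⟩
      · have := hclose j i hj.1 hi.2
        linarith
      · exact hclose i j hi.1 hj.2
  have hfinpi : IsPartialIso (insert f K) := hH.pi.mono (by
    rintro p (rfl | hp)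
    · exact hf
    · exact hp.1)
  obtain ⟨x', hx'⟩ := hfinpi.exists_insert (hKfin.insert f) x
  have hfm : f ∈ insert (x, x') (insert f K) := Or.inr (Or.inl rfl)
  have hxm : (x, x') ∈ insert (x, x') (insert f K) := Or.inl rfl
  have hKm : ∀ p ∈ K, p ∈ insert (x, x') (insert f K) := fun p hp => Or.inr (Or.inr hp)
  have hyK : y ∈ K := ⟨hy, le_rfl, (h1.trans_lt h2).le⟩
  have hgyK : (g y.1, h y.2) ∈ K := ⟨hgy, (h1.trans_lt h2).le, le_rfl⟩
  have h1' : dist f.2 y.2 ≤ dist f.2 x' :=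
    not_lt.1 fun hc => absurd ((hx'.dist_iff hfm hxm (hKm y hyK)).2 hc) (not_lt.2 h1)
  have h2' : dist f.2 x' < dist f.2 (h y.2) := (hx'.dist_iff hfm hxm (hKm _ hgyK)).1 h2
  have hxmove : dist f.1 x < dist f.1 (g x) := by
    refine h2.trans_le ?_
    have := (isoGroup.dist_le_iff hg).1 h1
    rwa [hgf] at this
  have hxmove' : dist f.2 x' < dist f.2 (h x') := by
    refine h2'.trans_le ?_
    have := (isoGroup.dist_le_iff hh).1 h1'
    rwa [hhf] at this
  refine ⟨_, hH.add_orbit hg hh hf hgf (x := x) (y := x') ?_ ?_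
    ⟨hx'.lt_iff hxm hfm, hx'.lt_iff hfm hxm⟩ (Or.inr (Or.inl ⟨hxmove, hxmove'⟩)) (hx'.mono ?_),
    Set.subset_union_left, x', Or.inr ⟨0, by simp⟩⟩
  · intro p hp
    by_cases h3 : dist f.1 y.1 ≤ dist f.1 p.1
    · by_cases h4 : dist f.1 p.1 ≤ dist f.1 (g y.1)
      · exact hx'.dist_iff hfm (hKm p ⟨hp, h3, h4⟩) hxm
      · have h5 := (hH.pi.dist_iff hf hgy hp).1 (not_le.1 h4)
        exact iff_of_false (not_lt.2 (h2.trans (not_le.1 h4)).le) (not_lt.2 (h2'.trans h5).le)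
    · have h5 := (hH.pi.dist_iff hf hp hy).1 (not_le.1 h3)
      exact iff_of_true ((not_le.1 h3).trans_le h1) (h5.trans_le h1')
  · intro p hp
    by_cases h3 : dist f.1 y.1 ≤ dist f.1 p.1
    · by_cases h4 : dist f.1 p.1 ≤ dist f.1 (g y.1)
      · exact hx'.dist_iff hfm hxm (hKm p ⟨hp, h3, h4⟩)
      · have h5 := (hH.pi.dist_iff hf hgy hp).1 (not_le.1 h4)
        exact iff_of_true (h2.trans (not_le.1 h4)) (h2'.trans h5)
    · have h5 := (hH.pi.dist_iff hf hp hy).1 (not_le.1 h3)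
      exact iff_of_false (not_lt.2 ((not_le.1 h3).trans_le h1).le) (not_lt.2 (h5.trans_le h1').le)
  · rintro p (rfl | ⟨hp, h3⟩)
    · exact hxm
    · exact hKm p ⟨hp, h3 ▸ h1, h3 ▸ h2.le⟩

/-- A stage containing a fixed point `f` extends by any point that moves as seen from `f`. -/
lemma exists_add_moving [RichOrdUlt X] (hg : g ∈ isoGroup X) (hh : h ∈ isoGroup X)
    (hgen : IsGenericAut h) (hH : IsConjState g h H) {f : X × X} (hf : f ∈ H)
    (hgf : g f.1 = f.1) {x : X} (hx : dist f.1 x ≠ dist f.1 (g x)) :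
    ∃ H', IsConjState g h H' ∧ H ⊆ H' ∧ ∃ y, (x, y) ∈ H' := by
  by_cases hint : ∃ y ∈ H, dist f.1 y.1 ≤ dist f.1 x ∧ dist f.1 x < dist f.1 (g y.1)
  · obtain ⟨y, hy, h1, h2⟩ := hint
    exact hH.exists_add_of_interleaved hg hh hf hgf hy h1 h2
  by_cases hint' : ∃ y ∈ H, dist f.1 (g y.1) ≤ dist f.1 x ∧ dist f.1 x < dist f.1 y.1
  · obtain ⟨y, hy, h1, h2⟩ := hint'
    obtain ⟨H', h3, h4⟩ := hH.inverse.exists_add_of_interleaved (inv_mem hg) (inv_mem hh) hf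
      (by rw [Equiv.Perm.inv_eq_iff_eq, hgf]) (hH.inv_one hy) h1 (by simpa using h2)
    refine ⟨H', ?_, h4⟩
    simpa using h3.inverse
  push Not at hint hint'
  have hhf := (hH.fixed_iff hf).1 hgf
  have hgi : ∀ i : ℤ, (g ^ i) f.1 = f.1 := zpow_apply_fixed hgf
  have hhi : ∀ i : ℤ, (h ^ i) f.2 = f.2 := zpow_apply_fixed hhf
  -- the whole orbit of every point of the stage lies on one side of `x`
  have hup : ∀ p ∈ H, dist f.1 x < dist f.1 p.1 → dist f.1 x < dist f.1 (g p.1) := by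
    intro p hp h1
    by_contra h2
    exact absurd h1 (not_lt.2 (hint' p hp (not_lt.1 h2)))
  have hdown : ∀ p ∈ H, dist f.1 p.1 ≤ dist f.1 x → dist f.1 (g p.1) ≤ dist f.1 x := hint
  have hupi : ∀ p ∈ H, dist f.1 x < dist f.1 p.1 →
      ∀ i : ℤ, dist f.1 x < dist f.1 ((g ^ i) p.1) := by
    intro p hp h1 i
    induction i using Int.induction_on with
    | zero => simpa using h1
    | succ i ih =>
      rw [zpow_succ_apply]
      exact hup _ (hH.inv p hp _) ih
    | pred i ih =>
      by_contra h2
      have h3 := hdown _ (hH.inv p hp _) (not_lt.1 h2)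
      simp only [← zpow_succ_apply, sub_add_cancel] at h3
      exact absurd ih (not_lt.2 h3)
  have hdowni : ∀ p ∈ H, dist f.1 p.1 ≤ dist f.1 x →
      ∀ i : ℤ, dist f.1 ((g ^ i) p.1) ≤ dist f.1 x := by
    intro p hp h1 i
    by_contra h2
    have h3 := hupi _ (hH.inv p hp i) (not_le.1 h2) (-i)
    simp only [zpow_neg_apply_zpow] at h3
    exact absurd h1 (not_le.2 h3)
  have hne : ∀ p ∈ H, dist f.1 p.1 ≠ dist f.1 x := by
    intro p hp h1
    have h2 := (isoGroup.dist_eq_iff hg).1 h1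
    rw [hgf] at h2
    rcases lt_or_gt_of_ne hx with h3 | h3
    · have := hdown p hp h1.le
      rw [h2] at this
      exact absurd h3 (not_lt.2 this)
    · have h4 := hdowni p hp h1.le (-1)
      have h5 := (isoGroup.dist_lt_iff (inv_mem hg)).1 h3
      have h6 := (isoGroup.dist_eq_iff (inv_mem hg)).1 h1
      have h7 : g⁻¹ f.1 = f.1 := by rw [Equiv.Perm.inv_eq_iff_eq, hgf]
      rw [h7] at h5 h6
      rw [zpow_neg_one, h6] at h4
      have h8 : g⁻¹ (g x) = x := g.symm_apply_apply x
      rw [h8] at h5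
      exact absurd h5 (not_lt.2 h4)
  obtain ⟨s, hs1, hs2, hs3⟩ := hH.fg
  have hPfin : (insert f.2 (Prod.snd '' {p ∈ s | dist f.1 p.1 < dist f.1 x})).Finite :=
    ((hs1.subset (Set.sep_subset _ _)).image _).insert _
  have hQfin : (Prod.snd '' {p ∈ s | dist f.1 x < dist f.1 p.1}).Finite :=
    (hs1.subset (Set.sep_subset _ _)).image _
  have hxf : x ≠ f.1 := by
    rintro rfl
    exact hx (by rw [hgf])
  classical
  -- a fixed point below and a fixed point above the place of the new orbit
  obtain ⟨a, ha, -, haP, haQ⟩ := hgen.insert_fixed f.2 hPfin.toFinset hQfin.toFinset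
    true hhf (by simp)
    (by
      intro p' hp' q' hq' i j
      rw [Set.Finite.mem_toFinset] at hp' hq'
      obtain ⟨q, ⟨hq, h2⟩, rfl⟩ := hq'
      rcases hp' with rfl | ⟨p, ⟨hp, h1⟩, rfl⟩
      · refine (hH.pi.dist_iff hf (hH.inv f hf i) (hH.inv q (hs2 hq) j)).1 ?_
        rw [hgi, dist_self]
        exact lt_of_le_of_lt dist_nonneg (hupi q (hs2 hq) h2 j)
      · refine (hH.pi.dist_iff hf (hH.inv p (hs2 hp) i) (hH.inv q (hs2 hq) j)).1 ?_
        exact (hdowni p (hs2 hp) h1.le i).trans_lt (hupi q (hs2 hq) h2 j))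
  have hai : ∀ i : ℤ, (h ^ i) a = a := zpow_apply_fixed ha
  simp only [Set.Finite.mem_toFinset] at haP haQ
  have haf := haP f.2 (Or.inl rfl)
  rw [dist_self] at haf
  obtain ⟨b, hb, -, hbP, hbQ⟩ := hgen.insert_fixed f.2 {f.2, a} hQfin.toFinset
    true hhf (by simp)
    (by
      intro p' hp' q' hq' i j
      rw [Set.Finite.mem_toFinset] at hq'
      have h3 := (isoGroup.dist_lt_iff (zpow_mem hh j)).1 (haQ q' hq')
      rw [hhi, hai] at h3
      simp only [Finset.mem_insert, Finset.mem_singleton] at hp'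
      rcases hp' with rfl | rfl
      · rw [hhi, dist_self]
        exact haf.trans h3
      · rwa [hai])
  have hbi : ∀ i : ℤ, (h ^ i) b = b := zpow_apply_fixed hb
  simp only [Set.Finite.mem_toFinset] at hbQ
  have hab := hbP a (by simp)
  obtain ⟨u, huside, hau, hub, humove, hudir⟩ := hgen.insert_moving f.2 a b (decide (x < f.1))
    (decide (dist f.1 x < dist f.1 (g x))) hhf ha hb hab
  simp only [decide_eq_true_eq] at huside hudir
  have hlt : ∀ p ∈ H, dist f.1 p.1 < dist f.1 x → dist f.2 p.2 < dist f.2 u := by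
    intro p hp hd
    obtain ⟨q, hq, i, rfl⟩ := hs3 p hp
    have h1 := hdowni _ hp hd.le (-i)
    simp only [zpow_neg_apply_zpow] at h1
    have h1' := lt_of_le_of_ne h1 (hne q (hs2 hq))
    have h2 := (isoGroup.dist_lt_iff (zpow_mem hh i)).1 (haP q.2 (Or.inr ⟨q, ⟨hq, h1'⟩, rfl⟩))
    rw [hhi, hai] at h2
    exact h2.trans hau
  have hgt : ∀ p ∈ H, dist f.1 x < dist f.1 p.1 → dist f.2 u < dist f.2 p.2 := by
    intro p hp hd
    obtain ⟨q, hq, i, rfl⟩ := hs3 p hp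
    have h1 := hupi _ hp hd (-i)
    simp only [zpow_neg_apply_zpow] at h1
    have h2 := (isoGroup.dist_lt_iff (zpow_mem hh i)).1 (hbQ q.2 ⟨q, ⟨hq, h1⟩, rfl⟩)
    rw [hhi, hbi] at h2
    exact hub.trans h2
  have huf : u ≠ f.2 := by
    rintro rfl
    rw [dist_self] at hau
    exact absurd haf hau.not_gt
  refine ⟨_, hH.add_orbit hg hh hf hgf (x := x) (y := u) ?_ ?_ ⟨huside.symm, ?_⟩
    (Or.inr ?_) ?_, Set.subset_union_left, u, Or.inr ⟨0, by simp⟩⟩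
  · intro p hp
    refine ⟨hlt p hp, fun h1 => ?_⟩
    by_contra h2
    exact (hgt p hp (lt_of_le_of_ne (not_lt.1 h2) (hne p hp).symm)).not_gt h1
  · intro p hp
    refine ⟨hgt p hp, fun h1 => ?_⟩
    by_contra h2
    exact (hlt p hp (lt_of_le_of_ne (not_lt.1 h2) (hne p hp))).not_gt h1
  · rw [← not_iff_not, not_lt, not_lt, le_iff_lt_or_eq, le_iff_lt_or_eq, huside]
    simp [hxf, huf]
  · rcases lt_or_gt_of_ne hx with h1 | h1
    · exact Or.inl ⟨h1, hudir.2 h1⟩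
    · exact Or.inr ⟨h1, lt_of_le_of_ne (not_lt.1 fun h2 => (hudir.1 h2).not_gt h1) humove.symm⟩
  · have : {p ∈ H | dist f.1 p.1 = dist f.1 x} = ∅ := by
      ext p
      simpa using fun hp => hne p hp
    rw [this]
    simpa using IsPartialIso.singleton (x, u)

/-- A stage extends by any point: first by a fixed point that sees it moving. -/
lemma exists_add [RichOrdUlt X] (hg : g ∈ isoGroup X) (hh : h ∈ isoGroup X)
    (hgen : IsGenericAut g) (hgen' : IsGenericAut h) (hH : IsConjState g h H) (x : X) :
    ∃ H', IsConjState g h H' ∧ H ⊆ H' ∧ ∃ y, (x, y) ∈ H' := by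
  by_cases hx : g x = x
  · exact hH.exists_add_fixed hg hh hgen' hx
  · obtain ⟨f, hf, hne⟩ := hgen.exists_fixed x hx
    obtain ⟨H1, h1, h2, f', h3⟩ := hH.exists_add_fixed hg hh hgen' hf
    obtain ⟨H2, h4, h5, h6⟩ := h1.exists_add_moving hg hh hgen' h3 hf hne
    exact ⟨H2, h4, h2.trans h5, h6⟩

end IsConjState

/-- Any two generic automorphisms are conjugate. -/
theorem IsGenericAut.exists_conj [RichOrdUlt X] {g h : Equiv.Perm X} (hg : g ∈ isoGroup X)
    (hh : h ∈ isoGroup X) (hgen : IsGenericAut g) (hgen' : IsGenericAut h) :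
    ∃ k ∈ isoGroup X, h = k⁻¹ * g * k := by
  have := RichOrdUlt.countable (X := X)
  obtain ⟨e, h1, -, h3⟩ := exists_equiv_of_back_and_forth {H | IsConjState h g H}
    (fun H hH => hH.pi)
    (fun H hH x => hH.exists_add hh hg hgen' hgen x)
    (fun H hH y => by
      obtain ⟨H', h4, h5, x, h6⟩ := hH.swap.exists_add hg hh hgen hgen' y
      exact ⟨Prod.swap ⁻¹' H', h4.swap, fun p hp => h5 (by simpa using hp), x, h6⟩)
    (show ∅ ∈ _ from IsConjState.empty)
  refine ⟨e, isoGroup.of_isPartialIso h1, ?_⟩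
  ext x
  obtain ⟨H, hH, hxe, hgraph⟩ := h3 x
  have h4 := hgraph _ (IsConjState.inv_one hH hxe)
  simp only at h4
  rw [Equiv.Perm.mul_apply, Equiv.Perm.mul_apply, ← h4]
  exact (e.symm_apply_apply (h x)).symm

end Conjugacy

/-! ### Boron structures in metric language -/

section Compat

open FirstOrder

/-- The boron structure of `M` is the one defined by its order and its metric. -/
class BoronCompat (M : Type) [boronLang.Structure M] [MetricSpace M] [LinearOrder M] : Prop where
  prec_iff : ∀ x y : M, boronPrec x y ↔ x < y
  sep_iff : ∀ x y z : M, boronSep x y z ↔ x < y ∧ y < z ∧ dist x y < dist y z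

section Maps

variable {C C' : Type} [boronLang.Structure C] [boronLang.Structure C']

/-- An injection preserving and reflecting both relations, as an embedding. -/
def boronEmbedding (f : C → C') (hinj : Function.Injective f)
    (hprec : ∀ x y, boronPrec (f x) (f y) ↔ boronPrec x y)
    (hsep : ∀ x y z, boronSep (f x) (f y) (f z) ↔ boronSep x y z) :
    boronLang.Embedding C C' where
  toFun := f
  inj' := hinj
  map_fun' φ := isEmptyElim φ
  map_rel' := by
    intro n r x
    cases r with
    | prec =>
      have h := hprec (x 0) (x 1)
      have h1 : x = ![x 0, x 1] := by
        ext i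
        fin_cases i <;> rfl
      have h2 : f ∘ x = ![f (x 0), f (x 1)] := by
        ext i
        fin_cases i <;> rfl
      rw [h2, h1]
      exact h
    | sep =>
      have h := hsep (x 0) (x 1) (x 2)
      have h1 : x = ![x 0, x 1, x 2] := by
        ext i
        fin_cases i <;> rfl
      have h2 : f ∘ x = ![f (x 0), f (x 1), f (x 2)] := by
        ext i
        fin_cases i <;> rfl
      rw [h2, h1]
      exact h

lemma boronPrec_map (f : boronLang.Embedding C C') (x y : C) :
    boronPrec (f x) (f y) ↔ boronPrec x y := by
  have h := f.map_rel (BoronRel.prec : boronLang.Relations 2) ![x, y]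
  have h2 : f ∘ ![x, y] = ![f x, f y] := by
    ext i
    fin_cases i <;> rfl
  rw [h2] at h
  exact h

lemma boronSep_map (f : boronLang.Embedding C C') (x y z : C) :
    boronSep (f x) (f y) (f z) ↔ boronSep x y z := by
  have h := f.map_rel (BoronRel.sep : boronLang.Relations 3) ![x, y, z]
  have h2 : f ∘ ![x, y, z] = ![f x, f y, f z] := by
    ext i
    fin_cases i <;> rfl
  rw [h2] at h
  exact h

variable [MetricSpace C] [LinearOrder C] [OrdUlt C] [BoronCompat C]
  [MetricSpace C'] [LinearOrder C'] [OrdUlt C'] [BoronCompat C']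

/-- The comparison of distances from a common point, in terms of the structure. -/
lemma dist_lt_dist_iff_boronSep {a b c : C} : dist a b < dist a c ↔
    (b = a ∧ a ≠ c) ∨ (b < a ∧ a < c ∧ boronSep b a c) ∨ (c < a ∧ a < b ∧ ¬ boronSep c a b) ∨
    (a < b ∧ b < c ∧ boronSep a b c) ∨ (c < b ∧ b < a ∧ ¬ boronSep c b a) := by
  simp only [BoronCompat.sep_iff]
  rcases lt_trichotomy a b with hab | rfl | hab
  · rcases lt_trichotomy a c with hac | rfl | hac
    · rcases lt_trichotomy b c with hbc | rfl | hbc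
      · have := OrdUlt.dist_eq_max hab hbc
        grind
      · simp [hab.ne', hab.not_gt]
      · have := OrdUlt.dist_eq_max hac hbc
        grind
    · have : ¬ dist a b < dist a a := by simp
      grind
    · have h1 := OrdUlt.dist_ne hac hab
      rw [dist_comm a c]
      grind
  · simp
  · rcases lt_trichotomy a c with hac | rfl | hac
    · rw [dist_comm a b]
      grind
    · have : ¬ dist a b < dist a a := by simp
      grind
    · rcases lt_trichotomy b c with hbc | rfl | hbc
      · have := OrdUlt.dist_eq_max hbc hac
        rw [dist_comm a b, dist_comm a c]
        grind
      · simp [hab.ne, hab.not_gt]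
      · have h1 := OrdUlt.dist_eq_max hbc hab
        have h2 := OrdUlt.dist_ne hbc hab
        rw [dist_comm a b, dist_comm a c]
        grind

lemma boron_maps_iff {f : C → C'} :
    ((∀ x y, boronPrec (f x) (f y) ↔ boronPrec x y) ∧
      ∀ x y z, boronSep (f x) (f y) (f z) ↔ boronSep x y z) ↔
    ((∀ x y, x < y ↔ f x < f y) ∧
      ∀ x y z, dist x y < dist x z ↔ dist (f x) (f y) < dist (f x) (f z)) := by
  simp only [BoronCompat.prec_iff]
  constructor
  · rintro ⟨h1, h2⟩
    have hinj : ∀ x y, f x = f y ↔ x = y := by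
      intro x y
      have := h1 x y
      have := h1 y x
      grind
    refine ⟨fun x y => (h1 x y).symm, fun x y z => ?_⟩
    rw [dist_lt_dist_iff_boronSep, dist_lt_dist_iff_boronSep (a := f x)]
    simp only [h1, h2, hinj, ne_eq]
  · rintro ⟨h1, h2⟩
    refine ⟨fun x y => (h1 x y).symm, fun x y z => ?_⟩
    rw [BoronCompat.sep_iff, BoronCompat.sep_iff, ← h1, ← h1, dist_comm, ← h2, dist_comm y x]

end Maps

variable {M : Type} [boronLang.Structure M] [MetricSpace M] [LinearOrder M] [OrdUlt M]
  [BoronCompat M]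

lemma autGroup_eq_isoGroup : autGroup boronLang M = isoGroup M := by
  ext g
  have key : g ∈ isoGroup M ↔ (∀ x y, boronPrec (g x) (g y) ↔ boronPrec x y) ∧
      ∀ x y z, boronSep (g x) (g y) (g z) ↔ boronSep x y z :=
    boron_maps_iff.symm
  rw [key]
  constructor
  · rintro ⟨φ, rfl⟩
    exact ⟨boronPrec_map φ.toEmbedding, boronSep_map φ.toEmbedding⟩
  · rintro ⟨h1, h2⟩
    exact ⟨{ g with
      map_fun' := fun f => isEmptyElim f
      map_rel' := (boronEmbedding g g.injective h1 h2).map_rel' }, rfl⟩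

end Compat

/-! ### The topology of the automorphism group -/

section Topology

open FirstOrder Topology

variable {L : Language} {M : Type} [L.Structure M]

lemma isOpen_apply_eq (x y : M) : IsOpen {φ : autGroup L M | φ.1 x = y} := by
  let _ : TopologicalSpace M := ⊥
  have h2 : Continuous fun φ : autGroup L M => φ.1 x :=
    (continuous_apply x).comp continuous_induced_dom
  have h3 : IsOpen ({y} : Set M) := @isOpen_discrete _ ⊥ ⟨rfl⟩ _
  exact h3.preimage h2

lemma exists_finite_of_isOpen {U : Set (autGroup L M)} (hU : IsOpen U) {φ : autGroup L M}
    (hφ : φ ∈ U) : ∃ R : Set M, R.Finite ∧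
      ∀ ψ : autGroup L M, (∀ z ∈ R, ψ.1 z = φ.1 z) → ψ ∈ U := by
  let _ : TopologicalSpace M := ⊥
  obtain ⟨V, hV, rfl⟩ := isOpen_induced_iff.1 hU
  obtain ⟨I, u, h1, h2⟩ := isOpen_pi_iff.1 hV _ hφ
  refine ⟨I, I.finite_toSet, fun ψ hψ => h2 ?_⟩
  intro z hz
  change ψ.1 z ∈ u z
  rw [hψ z hz]
  exact (h1 z hz).2

lemma isOpen_zpow_apply_eq (i : ℤ) (x y : M) : IsOpen {φ : autGroup L M | (φ.1 ^ i) x = y} := by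
  have hnat : ∀ (n : ℕ) (x y : M), IsOpen {φ : autGroup L M | (φ.1 ^ n) x = y} := by
    intro n
    induction n with
    | zero =>
      intro x y
      simp
    | succ n ih =>
      intro x y
      have : {φ : autGroup L M | (φ.1 ^ (n + 1)) x = y} =
          ⋃ z, {φ : autGroup L M | (φ.1 ^ n) z = y} ∩ {φ | φ.1 x = z} := by
        ext φ
        simp [pow_succ]
      rw [this]
      exact isOpen_iUnion fun z => (ih z y).inter (isOpen_apply_eq x z)
  obtain ⟨n, rfl | rfl⟩ := i.eq_nat_or_neg
  · simpa using hnat n x y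
  · have : {φ : autGroup L M | (φ.1 ^ (-(n : ℤ))) x = y} = {φ | (φ.1 ^ n) y = x} := by
      ext φ
      simp only [zpow_neg, zpow_natCast, Set.mem_ofPred_eq]
      rw [Equiv.Perm.inv_eq_iff_eq, eq_comm]
    rw [this]
    exact hnat n y x

lemma dense_of_exists_approx {S : Set (autGroup L M)} (h : ∀ φ : autGroup L M, ∀ R : Set M,
    R.Finite → ∃ ψ ∈ S, ∀ z ∈ R, ψ.1 z = φ.1 z) : Dense S := by
  rw [dense_iff_inter_open]
  rintro U hU ⟨φ, hφ⟩
  obtain ⟨R, hR, hRU⟩ := exists_finite_of_isOpen hU hφ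
  obtain ⟨ψ, hψ, hagree⟩ := h φ R hR
  exact ⟨ψ, hRU ψ hagree, hψ⟩

/-- The automorphism group of a countable structure is a Polish space: taking `φ` to the pair of `φ`
and its inverse identifies it with a closed subspace of the space of pairs of self-maps. -/
instance [Countable M] : PolishSpace (autGroup L M) := by
  let _ : TopologicalSpace M := ⊥
  have : DiscreteTopology M := ⟨rfl⟩
  have : PolishSpace M := inferInstance
  have : PolishSpace (M → M) := inferInstance
  let Φ : autGroup L M → (M → M) × (M → M) := fun φ => (fun x => φ.1 x, fun x => φ.1⁻¹ x)
  have hΦ1 : Continuous fun (φ : autGroup L M) (x : M) => φ.1 x := continuous_induced_dom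
  have hΦ2 : Continuous fun (φ : autGroup L M) (x : M) => φ.1⁻¹ x := by
    refine continuous_pi fun x => continuous_discrete_rng.2 fun y => ?_
    have : (fun φ : autGroup L M => φ.1⁻¹ x) ⁻¹' {y} = {φ | φ.1 y = x} := by
      ext φ
      simp only [Set.mem_preimage, Set.mem_singleton_iff, Set.mem_ofPred_eq]
      rw [Equiv.Perm.inv_eq_iff_eq, eq_comm]
    rw [this]
    exact isOpen_apply_eq y x
  have hind : IsInducing Φ :=
    IsInducing.of_comp (hΦ1.prodMk hΦ2) continuous_fst ⟨rfl⟩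
  have hinj : Function.Injective Φ := by
    intro φ ψ h
    ext x
    exact congrFun (congrArg Prod.fst h) x
  have hcl : IsClosed (Set.range Φ) := by
    have : Set.range Φ = {p | (∀ x, p.2 (p.1 x) = x) ∧ (∀ x, p.1 (p.2 x) = x) ∧
        (∀ (n) (f : L.Functions n) (x : Fin n → M),
          p.1 (Language.Structure.funMap f x) = Language.Structure.funMap f (p.1 ∘ x)) ∧
        ∀ (n) (r : L.Relations n) (x : Fin n → M),
          (Language.Structure.RelMap r (p.1 ∘ x) ↔ Language.Structure.RelMap r x)} := by
      ext p
      constructor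
      · rintro ⟨⟨_, φ, rfl⟩, rfl⟩
        exact ⟨fun x => φ.toEquiv.symm_apply_apply x, fun x => φ.toEquiv.apply_symm_apply x,
          fun n f x => φ.map_fun f x, fun n r x => φ.map_rel r x⟩
      · rintro ⟨h1, h2, h3, h4⟩
        exact ⟨⟨⟨p.1, p.2, h1, h2⟩,
          ⟨⟨⟨p.1, p.2, h1, h2⟩, fun f x => h3 _ f x, fun r x => h4 _ r x⟩, rfl⟩⟩, rfl⟩
    rw [this]
    have hev : ∀ x : M, Continuous fun p : (M → M) × (M → M) => p.1 x := fun x =>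
      (continuous_apply x).comp continuous_fst
    have hev' : ∀ x : M, Continuous fun p : (M → M) × (M → M) => p.2 x := fun x =>
      (continuous_apply x).comp continuous_snd
    have hcomp : ∀ (n : ℕ) (x : Fin n → M), Continuous fun p : (M → M) × (M → M) => p.1 ∘ x :=
      fun n x => continuous_pi fun i => hev (x i)
    have happ : Continuous fun q : (M → M) × M => q.1 q.2 := by
      rw [continuous_prod_of_discrete_right]
      exact fun x => continuous_apply x
    simp only [Set.ofPred_and, Set.ofPred_forall]
    refine IsClosed.inter ?_ (IsClosed.inter ?_ (IsClosed.inter ?_ ?_))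
    · exact isClosed_iInter fun x => isClosed_eq
        (happ.comp (continuous_snd.prodMk (hev x))) continuous_const
    · exact isClosed_iInter fun x => isClosed_eq
        (happ.comp (continuous_fst.prodMk (hev' x))) continuous_const
    · exact isClosed_iInter fun n => isClosed_iInter fun f => isClosed_iInter fun x =>
        isClosed_eq (hev _) (continuous_of_discreteTopology.comp (hcomp n x))
    · exact isClosed_iInter fun n => isClosed_iInter fun r => isClosed_iInter fun x =>
        (isClosed_discrete {y : Fin n → M | Language.Structure.RelMap r y ↔
          Language.Structure.RelMap r x}).preimage (hcomp n x)
  exact IsClosedEmbedding.polishSpace ⟨⟨hind, hinj⟩, hcl⟩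

end Topology

/-! ### The comeager conjugacy class -/

section ConjClass

variable {M : Type} [boronLang.Structure M] [MetricSpace M] [LinearOrder M] [RichOrdUlt M]
  [BoronCompat M]

lemma mem_residual_of_exists_approx {S : Set (autGroup boronLang M)} (hS : IsOpen S)
    (h : ∀ g ∈ isoGroup M, ∀ R : Set M, R.Finite → ∃ g', ∃ hg' : g' ∈ isoGroup M,
      (∀ z ∈ R, g' z = g z) ∧
      (⟨g', autGroup_eq_isoGroup (M := M) ▸ hg'⟩ : autGroup boronLang M) ∈ S) :
    S ∈ residual (autGroup boronLang M) := by
  refine residual_of_dense_open hS (dense_of_exists_approx fun φ R hR => ?_)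
  obtain ⟨g', hg', h1, h2⟩ := h φ.1 (autGroup_eq_isoGroup (M := M) ▸ φ.2) R hR
  exact ⟨_, h2, h1⟩

/-- Genericity is the conjunction of countably many conditions, each of which is open and, by the
approximation of automorphisms, dense. -/
lemma eventually_isGenericAut :
    ∀ᶠ φ : autGroup boronLang M in residual (autGroup boronLang M), IsGenericAut φ.1 := by
  have := RichOrdUlt.countable (X := M)
  have hfixed : ∀ u : M, IsOpen {φ : autGroup boronLang M | φ.1 u = u} := fun u =>
    isOpen_apply_eq u u
  have h1 : ∀ x : M, ∀ᶠ φ : autGroup boronLang M in residual _, φ.1 x ≠ x →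
      ∃ f, φ.1 f = f ∧ dist f x ≠ dist f (φ.1 x) := by
    intro x
    refine mem_residual_of_exists_approx ?_ ?_
    · have : {φ : autGroup boronLang M | φ.1 x ≠ x → ∃ f, φ.1 f = f ∧ dist f x ≠ dist f (φ.1 x)} =
          {φ | φ.1 x = x} ∪ ⋃ (f : M) (y : M) (_ : dist f x ≠ dist f y),
            {φ | φ.1 f = f} ∩ {φ | φ.1 x = y} := by
        ext φ
        simp only [Set.mem_ofPred_eq, Set.mem_union, Set.mem_iUnion, Set.mem_inter_iff, ne_eq]
        grind
      rw [this]
      exact (hfixed x).union (isOpen_iUnion fun f => isOpen_iUnion fun y => isOpen_iUnion fun _ =>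
        (hfixed f).inter (isOpen_apply_eq x y))
    · intro g hg R hR
      by_cases hx : g x = x
      · exact ⟨g, hg, fun _ _ => rfl, fun h => absurd hx h⟩
      · obtain ⟨g', hg', h2, u, h3, h4⟩ := exists_approx_fixed hg hx (hR.insert x)
        refine ⟨g', hg', fun z hz => h2 z (Or.inr hz), fun _ => ⟨u, h3, ?_⟩⟩
        have h5 : g' x = g x := h2 x (Or.inl rfl)
        simp only [h5]
        exact h4
  have h2 : ∀ q : M × Finset M × Finset M × Bool, ∀ᶠ φ : autGroup boronLang M in residual _,
      φ.1 q.1 = q.1 → q.1 ∈ q.2.1 →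
      (∀ p ∈ q.2.1, ∀ p' ∈ q.2.2.1, ∀ i j : ℤ,
        dist q.1 ((φ.1 ^ i) p) < dist q.1 ((φ.1 ^ j) p')) →
      ∃ u, φ.1 u = u ∧ (u < q.1 ↔ q.2.2.2 = true) ∧ (∀ p ∈ q.2.1, dist q.1 p < dist q.1 u) ∧
        ∀ p ∈ q.2.2.1, dist q.1 u < dist q.1 p := by
    rintro ⟨f, P, Q, left⟩
    simp only
    refine mem_residual_of_exists_approx ?_ ?_
    · have : {φ : autGroup boronLang M | φ.1 f = f → f ∈ P →
          (∀ p ∈ P, ∀ p' ∈ Q, ∀ i j : ℤ, dist f ((φ.1 ^ i) p) < dist f ((φ.1 ^ j) p')) →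
          ∃ u, φ.1 u = u ∧ (u < f ↔ left = true) ∧ (∀ p ∈ P, dist f p < dist f u) ∧
            ∀ p ∈ Q, dist f u < dist f p} =
          {φ | φ.1 f ≠ f} ∪ ({_φ | f ∉ P} ∪
          ((⋃ (p : M) (_ : p ∈ P) (p' : M) (_ : p' ∈ Q) (i : ℤ) (j : ℤ) (y : M) (y' : M)
            (_ : ¬ dist f y < dist f y'), {φ | (φ.1 ^ i) p = y} ∩ {φ | (φ.1 ^ j) p' = y'}) ∪
          ⋃ (u : M) (_ : (u < f ↔ left = true) ∧ (∀ p ∈ P, dist f p < dist f u) ∧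
            ∀ p ∈ Q, dist f u < dist f p), {φ | φ.1 u = u})) := by
        ext φ
        simp only [Set.mem_ofPred_eq, Set.mem_union, Set.mem_iUnion, Set.mem_inter_iff,
          exists_prop, ne_eq]
        constructor
        · intro h
          by_contra hcon
          push Not at hcon
          obtain ⟨a1, a2, a3, a4⟩ := hcon
          obtain ⟨u, b1, b2⟩ := h a1 a2 (by
            intro p hp p' hp' i j
            by_contra hc
            exact a3 p hp p' hp' i j _ _ (not_lt.1 hc) rfl rfl)
          exact a4 u b2 b1
        · rintro (h | h | ⟨p, hp, p', hp', i, j, y, y', h, rfl, rfl⟩ | ⟨u, h, h'⟩) c1 c2 c3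
          · exact absurd c1 h
          · exact absurd c2 h
          · exact absurd (c3 p hp p' hp' i j) h
          · exact ⟨u, h', h⟩
      rw [this]
      have hne : IsOpen {φ : autGroup boronLang M | φ.1 f ≠ f} := by
        have : {φ : autGroup boronLang M | φ.1 f ≠ f} =
            ⋃ (y : M) (_ : y ≠ f), {φ | φ.1 f = y} := by
          ext φ
          simp
        rw [this]
        exact isOpen_iUnion fun y => isOpen_iUnion fun _ => isOpen_apply_eq f y
      refine hne.union (isOpen_const.union (IsOpen.union ?_ ?_))
      · exact isOpen_iUnion fun p => isOpen_iUnion fun _ => isOpen_iUnion fun p' =>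
          isOpen_iUnion fun _ => isOpen_iUnion fun i => isOpen_iUnion fun j =>
          isOpen_iUnion fun y => isOpen_iUnion fun y' => isOpen_iUnion fun _ =>
          (isOpen_zpow_apply_eq i p y).inter (isOpen_zpow_apply_eq j p' y')
      · exact isOpen_iUnion fun u => isOpen_iUnion fun _ => hfixed u
    · intro g hg R hR
      by_cases hcase : g f = f ∧ f ∈ P ∧
          ∀ p ∈ P, ∀ p' ∈ Q, ∀ i j : ℤ, dist f ((g ^ i) p) < dist f ((g ^ j) p')
      · obtain ⟨g', hg', h3, h4⟩ := exists_approx_insert_fixed hg hcase.1 hR P.finite_toSet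
          Q.finite_toSet hcase.2.1 hcase.2.2 (left = true)
        exact ⟨g', hg', h3, fun _ _ _ => h4⟩
      · exact ⟨g, hg, fun _ _ => rfl, fun a b c => absurd ⟨a, b, c⟩ hcase⟩
  have h3 : ∀ q : M × M × M × Bool × Bool, ∀ᶠ φ : autGroup boronLang M in residual _,
      φ.1 q.1 = q.1 → φ.1 q.2.1 = q.2.1 → φ.1 q.2.2.1 = q.2.2.1 →
      dist q.1 q.2.1 < dist q.1 q.2.2.1 → ∃ u, (u < q.1 ↔ q.2.2.2.1 = true) ∧
      dist q.1 q.2.1 < dist q.1 u ∧ dist q.1 u < dist q.1 q.2.2.1 ∧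
      dist q.1 u ≠ dist q.1 (φ.1 u) ∧ (dist q.1 u < dist q.1 (φ.1 u) ↔ q.2.2.2.2 = true) := by
    rintro ⟨f, s, t, left, up⟩
    simp only
    refine mem_residual_of_exists_approx ?_ ?_
    · have : {φ : autGroup boronLang M | φ.1 f = f → φ.1 s = s → φ.1 t = t →
          dist f s < dist f t → ∃ u, (u < f ↔ left = true) ∧ dist f s < dist f u ∧
          dist f u < dist f t ∧ dist f u ≠ dist f (φ.1 u) ∧
          (dist f u < dist f (φ.1 u) ↔ up = true)} =
          (⋃ (y : M) (y' : M) (y'' : M) (_ : ¬ (y = f ∧ y' = s ∧ y'' = t ∧ dist f s < dist f t)),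
            {φ | φ.1 f = y} ∩ ({φ | φ.1 s = y'} ∩ {φ | φ.1 t = y''})) ∪
          ⋃ (u : M) (y : M) (_ : (u < f ↔ left = true) ∧ dist f s < dist f u ∧
            dist f u < dist f t ∧ dist f u ≠ dist f y ∧ (dist f u < dist f y ↔ up = true)),
            {φ | φ.1 u = y} := by
        ext φ
        simp only [Set.mem_ofPred_eq, Set.mem_union, Set.mem_iUnion, Set.mem_inter_iff,
          exists_prop]
        constructor
        · intro h
          by_cases hc : φ.1 f = f ∧ φ.1 s = s ∧ φ.1 t = t ∧ dist f s < dist f t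
          · obtain ⟨u, hu⟩ := h hc.1 hc.2.1 hc.2.2.1 hc.2.2.2
            exact Or.inr ⟨u, _, hu, rfl⟩
          · exact Or.inl ⟨_, _, _, hc, rfl, rfl, rfl⟩
        · rintro (⟨_, _, _, h, rfl, rfl, rfl⟩ | ⟨u, _, h, rfl⟩) a b c d
          · exact absurd ⟨a, b, c, d⟩ h
          · exact ⟨u, h⟩
      rw [this]
      refine IsOpen.union ?_ ?_
      · exact isOpen_iUnion fun y => isOpen_iUnion fun y' => isOpen_iUnion fun y'' =>
          isOpen_iUnion fun _ => (isOpen_apply_eq f y).inter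
            ((isOpen_apply_eq s y').inter (isOpen_apply_eq t y''))
      · exact isOpen_iUnion fun u => isOpen_iUnion fun y => isOpen_iUnion fun _ =>
          isOpen_apply_eq u y
    · intro g hg R hR
      by_cases hcase : g f = f ∧ g s = s ∧ dist f s < dist f t
      · obtain ⟨g', hg', h3, h4⟩ := exists_approx_insert_moving hg hcase.1 hcase.2.1 hR
          hcase.2.2 (left = true) (up = true)
        exact ⟨g', hg', h3, fun _ _ _ _ => h4⟩
      · exact ⟨g, hg, fun _ _ => rfl, fun a b _ c => absurd ⟨a, b, c⟩ hcase⟩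
  filter_upwards [eventually_countable_forall.2 h1, eventually_countable_forall.2 h2,
    eventually_countable_forall.2 h3] with φ a b c
  exact ⟨a, fun f P Q left => b (f, P, Q, left), fun f s t left up => c (f, s, t, left, up)⟩

/-- By the Baire category theorem there is a generic automorphism; the generic ones are its
conjugates. -/
theorem hasComeagerConjClass : HasComeagerConjClass (autGroup boronLang M) := by
  have := RichOrdUlt.countable (X := M)
  obtain ⟨φ, hφ⟩ := (dense_of_mem_residual (eventually_isGenericAut (M := M))).nonempty
  refine ⟨φ, Filter.mem_of_superset eventually_isGenericAut fun ψ hψ => ?_⟩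
  obtain ⟨k, hk, h1⟩ := IsGenericAut.exists_conj (autGroup_eq_isoGroup (M := M) ▸ φ.2)
    (autGroup_eq_isoGroup (M := M) ▸ ψ.2) hφ hψ
  exact ⟨⟨k, autGroup_eq_isoGroup (M := M) ▸ hk⟩, Subtype.ext h1⟩

end ConjClass

/-! ### Words in two automorphisms -/

section Words

variable {M : Type}

/-- The permutation denoted by a letter: a member of the pair or its inverse. -/
def letterPerm (F : Fin 2 → Equiv.Perm M) (s : Fin 2 × Bool) : Equiv.Perm M :=
  if s.2 then F s.1 else (F s.1)⁻¹

/-- The permutation denoted by a word; the last letter acts first. -/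
def wordPerm (F : Fin 2 → Equiv.Perm M) (w : List (Fin 2 × Bool)) : Equiv.Perm M :=
  (w.map (letterPerm F)).prod

lemma wordPerm_cons (F : Fin 2 → Equiv.Perm M) (s : Fin 2 × Bool) (w : List (Fin 2 × Bool))
    (b : M) : wordPerm F (s :: w) b = letterPerm F s (wordPerm F w b) := by
  simp [wordPerm]

lemma letterPerm_conj (F : Fin 2 → Equiv.Perm M) (k : Equiv.Perm M) (s : Fin 2 × Bool) (x : M) :
    k (letterPerm (fun i => k⁻¹ * F i * k) s x) = letterPerm F s (k x) := by
  rcases s with ⟨i, _ | _⟩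
  · simp [letterPerm, mul_assoc]
  · simp [letterPerm, mul_assoc]

lemma wordPerm_conj (F : Fin 2 → Equiv.Perm M) (k : Equiv.Perm M) (w : List (Fin 2 × Bool))
    (x : M) : k (wordPerm (fun i => k⁻¹ * F i * k) w x) = wordPerm F w (k x) := by
  induction w with
  | nil => rfl
  | cons s w ih => rw [wordPerm_cons, wordPerm_cons, letterPerm_conj, ih]

lemma letterPerm_fixed {F : Fin 2 → Equiv.Perm M} {a : M} (ha : ∀ i, F i a = a)
    (s : Fin 2 × Bool) : letterPerm F s a = a := by
  rcases s with ⟨i, _ | _⟩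
  · simp only [letterPerm, Bool.false_eq_true, if_false]
    rw [Equiv.Perm.inv_eq_iff_eq, ha]
  · exact ha i

lemma wordPerm_fixed {F : Fin 2 → Equiv.Perm M} {a : M} (ha : ∀ i, F i a = a)
    (w : List (Fin 2 × Bool)) : wordPerm F w a = a := by
  induction w with
  | nil => rfl
  | cons s w ih => rw [wordPerm_cons, ih, letterPerm_fixed ha]

variable [MetricSpace M] [LinearOrder M]

lemma letterPerm_mem {F : Fin 2 → Equiv.Perm M} (hF : ∀ i, F i ∈ isoGroup M) (s : Fin 2 × Bool) :
    letterPerm F s ∈ isoGroup M := by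
  rcases s with ⟨i, _ | _⟩
  · exact inv_mem (hF i)
  · exact hF i

lemma wordPerm_mem {F : Fin 2 → Equiv.Perm M} (hF : ∀ i, F i ∈ isoGroup M)
    (w : List (Fin 2 × Bool)) : wordPerm F w ∈ isoGroup M := by
  refine Subgroup.list_prod_mem _ fun x hx => ?_
  obtain ⟨s, -, rfl⟩ := List.mem_map.1 hx
  exact letterPerm_mem hF s

/-- A pair of automorphisms with common fixed point `a`, the first of which moves `b` upwards over
`a`, is never determined on the orbit of `b` by its values on a finite set `E`. For let `w` be a
shortest word that takes `b` above all those relevant points of `E` which the orbit of `b` exceeds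
at all. Then the letter `α` with which `w` ends and a letter `β` for the other automorphism are
unconstrained at the point reached: their values can be chosen there in either order. -/
lemma exists_words_differ [RichOrdUlt M] {F : Fin 2 → Equiv.Perm M} (hF : ∀ i, F i ∈ isoGroup M)
    {a b : M} (ha : ∀ i, F i a = a) (hb : dist a b < dist a (F 0 b)) {E : Set M}
    (hE : E.Finite) : ∃ w₁ w₂ : List (Fin 2 × Bool),
      (∃ F' : Fin 2 → Equiv.Perm M, (∀ i, F' i ∈ isoGroup M) ∧ (∀ i, ∀ z ∈ E, F' i z = F i z) ∧
        dist a (wordPerm F' w₁ b) < dist a (wordPerm F' w₂ b)) ∧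
      (∃ F' : Fin 2 → Equiv.Perm M, (∀ i, F' i ∈ isoGroup M) ∧ (∀ i, ∀ z ∈ E, F' i z = F i z) ∧
        ¬ dist a (wordPerm F' w₁ b) < dist a (wordPerm F' w₂ b)) := by
  classical
  have hword : ∀ w z z', dist a z < dist a z' ↔
      dist a (wordPerm F w z) < dist a (wordPerm F w z') := by
    intro w z z'
    have := isoGroup.dist_lt_iff (wordPerm_mem hF w) (x := a) (y := z) (z := z')
    rwa [wordPerm_fixed ha] at this
  have hletter : ∀ s z z', dist a z < dist a z' ↔
      dist a (letterPerm F s z) < dist a (letterPerm F s z') := by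
    intro s z z'
    have := isoGroup.dist_lt_iff (letterPerm_mem hF s) (x := a) (y := z) (z := z')
    rwa [letterPerm_fixed ha] at this
  -- the distances of the orbit of `b` from `a` have no maximum
  have hnomax : ∀ w, ∃ w', dist a (wordPerm F w b) < dist a (wordPerm F w' b) := by
    intro w
    refine ⟨w ++ [(0, true)], ?_⟩
    have : wordPerm F (w ++ [(0, true)]) b = wordPerm F w (F 0 b) := by
      simp [wordPerm, letterPerm]
    rw [this, ← hword]
    exact hb
  set E' : Set M := insert a (insert b E) with hE'
  have hE'fin : E'.Finite := (hE.insert b).insert a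
  let X : Fin 2 × Bool → Set M := fun s => if s.2 then E' else F s.1 '' E'
  set P : Set M := E' ∪ (F 0 '' E' ∪ F 1 '' E') with hP
  have hPfin : P.Finite := hE'fin.union ((hE'fin.image _).union (hE'fin.image _))
  have hFP : ∀ i, F i '' E' ⊆ P := by
    intro i
    fin_cases i
    · exact fun z hz => Or.inr (Or.inl hz)
    · exact fun z hz => Or.inr (Or.inr hz)
  have hXP : ∀ s, X s ⊆ P := by
    rintro ⟨i, _ | _⟩
    · exact hFP i
    · exact Set.subset_union_left
  have hXfin : ∀ s, (X s).Finite := fun s => hPfin.subset (hXP s)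
  have hXimg : ∀ s, ∀ z ∈ X s, letterPerm F s z ∈ P := by
    rintro ⟨i, _ | _⟩ z hz
    · obtain ⟨e, he, rfl⟩ := hz
      left
      have : letterPerm F (i, false) (F i e) = e := (F i).symm_apply_apply e
      rwa [this]
    · exact hFP i ⟨z, hz, rfl⟩
  have haX : ∀ s, a ∈ X s := by
    rintro ⟨i, _ | _⟩
    · exact ⟨a, Or.inl rfl, ha i⟩
    · exact Or.inl rfl
  -- the points whose distance from `a` the orbit of `b` never reaches
  let High : M → Prop := fun q => ∀ w, dist a (wordPerm F w b) < dist a q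
  have hHigh : ∀ s q, High q → High (letterPerm F s q) := by
    intro s q hq w
    have h1 := hq ((s.1, !s.2) :: w)
    rw [hletter s, wordPerm_cons] at h1
    have h2 : ∀ z, letterPerm F s (letterPerm F (s.1, !s.2) z) = z := by
      intro z
      rcases s with ⟨i, _ | _⟩
      · exact (F i).symm_apply_apply z
      · exact (F i).apply_symm_apply z
    rwa [h2] at h1
  have hexists : ∃ w, ∀ q ∈ P, High q ∨ dist a q < dist a (wordPerm F w b) := by
    rcases Set.eq_empty_or_nonempty {q ∈ P | ¬ High q} with he | hne
    · refine ⟨[], fun q hq => ?_⟩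
      by_contra h
      push Not at h
      exact (he ▸ ⟨hq, h.1⟩ : q ∈ (∅ : Set M))
    · obtain ⟨q, hq, hmax⟩ :=
        Set.exists_max_image _ (dist a) (hPfin.subset (Set.sep_subset _ _)) hne
      obtain ⟨w, hw⟩ := not_forall.1 hq.2
      obtain ⟨w', hw'⟩ := hnomax w
      refine ⟨w', fun p hp => ?_⟩
      by_cases hhp : High p
      · exact Or.inl hhp
      · exact Or.inr ((hmax p ⟨hp, hhp⟩).trans_lt ((not_lt.1 hw).trans_lt hw'))
  obtain ⟨w, hw, hwmin⟩ : ∃ w, (∀ q ∈ P, High q ∨ dist a q < dist a (wordPerm F w b)) ∧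
      ∀ w', (∀ q ∈ P, High q ∨ dist a q < dist a (wordPerm F w' b)) → w.length ≤ w'.length := by
    have hex : ∃ n, ∃ w : List (Fin 2 × Bool), w.length = n ∧
        ∀ q ∈ P, High q ∨ dist a q < dist a (wordPerm F w b) := by
      obtain ⟨w, hw⟩ := hexists
      exact ⟨_, w, rfl, hw⟩
    obtain ⟨w, h1, h2⟩ := Nat.find_spec hex
    exact ⟨w, h2, fun w' hw' => h1 ▸ Nat.find_min' hex ⟨w', rfl, hw'⟩⟩
  rcases w with _ | ⟨α, w₀⟩
  · rcases hw b (Or.inl (Or.inr (Or.inl rfl))) with h | h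
    · exact absurd (h []) (lt_irrefl _)
    · exact absurd h (lt_irrefl _)
  set w := α :: w₀ with hwdef
  set μ := wordPerm F w b with hμ
  -- the points that the letters of `w` pass through before `μ`; they have to be kept in place
  set tails : Set M := (fun w' => wordPerm F w' b) '' {w' | w' <:+ w₀} with htails
  have htails_fin : tails.Finite := by
    refine Set.Finite.image _ (Set.Finite.subset (w₀.tails.toFinset.finite_toSet) fun w' h => ?_)
    simpa using h
  have htails_lt : ∀ z ∈ tails, dist a z < dist a μ := by
    rintro _ ⟨w', hw', rfl⟩
    have h1 : ¬ w.length ≤ w'.length := by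
      have := List.IsSuffix.length_le hw'
      simp only [hwdef, List.length_cons]
      omega
    have h2 := mt (hwmin w') h1
    push Not at h2
    obtain ⟨q, hq, h3, h4⟩ := h2
    rcases hw q hq with h5 | h5
    · exact absurd h5 h3
    · exact h4.trans_lt h5
  obtain ⟨j, hj⟩ : ∃ j : Fin 2, j ≠ α.1 := exists_ne _
  set β : Fin 2 × Bool := (j, true) with hβ
  have hHighfin : {q ∈ P | High q}.Finite := hPfin.subset (Set.sep_subset _ _)
  -- modification of a letter at `μ`
  have hmodify : ∀ s y, (y < a ↔ μ < a) → dist a (letterPerm F s μ) < dist a y →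
      (∀ q ∈ P, High q → dist a y < dist a q) →
      ∃ σ ∈ isoGroup M, (∀ z ∈ X s ∪ tails, σ z = letterPerm F s z) ∧ σ μ = y := by
    intro s y hside hlow hhigh
    have hcases : ∀ z ∈ X s ∪ tails, dist a z < dist a μ ∨
        (dist a μ < dist a z ∧ dist a y < dist a (letterPerm F s z)) := by
      rintro z (hz | hz)
      · rcases hw z (hXP s hz) with h | h
        · exact Or.inr ⟨h w, hhigh _ (hXimg s z hz) (hHigh s z h)⟩
        · exact Or.inl h
      · exact Or.inl (htails_lt z hz)
    have haY : insert a (X s ∪ tails) = X s ∪ tails := Set.insert_eq_of_mem (Or.inl (haX s))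
    refine exists_approx_of_level (letterPerm_mem hF s) (letterPerm_fixed ha s)
      ((hXfin s).union htails_fin) (fun z => dist a z < dist a μ) hside.symm ?_ ?_
    · rw [haY]
      intro z hz
      refine ⟨id, fun h => ?_⟩
      rcases hcases z hz with h1 | h1
      · exact absurd h1 h
      · exact h1.1
    · rw [haY]
      intro z hz
      refine ⟨fun h => ((hletter s _ _).1 h).trans hlow, fun h => ?_⟩
      rcases hcases z hz with h1 | h1
      · exact absurd h1 h
      · exact h1.2
  -- simultaneous modification of both automorphisms
  have hboth : ∀ y y', (y < a ↔ μ < a) → (y' < a ↔ μ < a) →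
      dist a (letterPerm F α μ) < dist a y → dist a (letterPerm F β μ) < dist a y' →
      (∀ q ∈ P, High q → dist a y < dist a q) → (∀ q ∈ P, High q → dist a y' < dist a q) →
      ∃ F' : Fin 2 → Equiv.Perm M, (∀ i, F' i ∈ isoGroup M) ∧ (∀ i, ∀ z ∈ E, F' i z = F i z) ∧
        wordPerm F' (α :: w) b = y ∧ wordPerm F' (β :: w) b = y' := by
    intro y y' h1 h1' h2 h2' h3 h3'
    obtain ⟨σ, hσ, hσF, hσμ⟩ := hmodify α y h1 h2 h3
    obtain ⟨τ, hτ, hτF, hτμ⟩ := hmodify β y' h1' h2' h3'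
    let F' : Fin 2 → Equiv.Perm M := fun i => if i = α.1 then (if α.2 then σ else σ⁻¹) else τ
    have hα : letterPerm F' α = σ := by
      simp only [letterPerm, F', if_true]
      split_ifs
      · rfl
      · exact inv_inv σ
    have hβ' : letterPerm F' β = τ := by
      simp [letterPerm, F', hβ, hj]
    have hinv : ∀ s : Fin 2 × Bool, ∀ G : Fin 2 → Equiv.Perm M, ∀ z,
        letterPerm G (s.1, !s.2) (letterPerm G s z) = z := by
      rintro ⟨i, _ | _⟩ G z
      · exact (G i).apply_symm_apply z
      · exact (G i).symm_apply_apply z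
    have hletters : ∀ s, s = α ∨ s = β ∨ s = (α.1, !α.2) ∨ s = (β.1, !β.2) := by
      rintro ⟨i, ε⟩
      by_cases hi : i = α.1
      · subst hi
        rcases Bool.eq_or_eq_not ε α.2 with rfl | rfl
        · exact Or.inl rfl
        · exact Or.inr (Or.inr (Or.inl rfl))
      · have : i = j := by omega
        subst this
        rcases ε with _ | _
        · exact Or.inr (Or.inr (Or.inr rfl))
        · exact Or.inr (Or.inl rfl)
    have hstep : ∀ s, ∀ z ∈ tails, letterPerm F s z ∈ tails →
        letterPerm F' s z = letterPerm F s z := by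
      intro s z hz hsz
      have hback : ∀ t : Fin 2 × Bool, letterPerm F t (letterPerm F (t.1, !t.2) z) = z := by
        intro t
        have := hinv (t.1, !t.2) F z
        simpa using this
      rcases hletters s with rfl | rfl | rfl | rfl
      · rw [hα]
        exact hσF z (Or.inr hz)
      · rw [hβ']
        exact hτF z (Or.inr hz)
      · have h4 := hσF _ (Or.inr hsz)
        rw [hback] at h4
        have h5 := hinv α F' (letterPerm F (α.1, !α.2) z)
        rwa [hα, h4] at h5
      · have h4 := hτF _ (Or.inr hsz)
        rw [hback] at h4
        have h5 := hinv β F' (letterPerm F (β.1, !β.2) z)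
        rwa [hβ', h4] at h5
    have hsame : ∀ w', w' <:+ w₀ → wordPerm F' w' b = wordPerm F w' b := by
      intro w'
      induction w' with
      | nil => exact fun _ => rfl
      | cons s w' ih =>
        intro hsuf
        have hsuf' : w' <:+ w₀ := (List.suffix_cons s w').trans hsuf
        rw [wordPerm_cons, ih hsuf', wordPerm_cons]
        exact hstep s _ ⟨w', hsuf', rfl⟩ ⟨s :: w', hsuf, wordPerm_cons F s w' b⟩
    have hμ' : wordPerm F' w b = μ := by
      rw [hμ, hwdef, wordPerm_cons, wordPerm_cons, hsame w₀ List.suffix_rfl, hα]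
      exact hσF _ (Or.inr ⟨w₀, List.suffix_rfl, rfl⟩)
    refine ⟨F', fun i => ?_, fun i z hz => ?_, ?_, ?_⟩
    · simp only [F']
      split_ifs
      · exact hσ
      · exact inv_mem hσ
      · exact hτ
    · have hz' : z ∈ E' := Or.inr (Or.inr hz)
      by_cases hi : i = α.1
      · subst hi
        by_cases hε : α.2 = true
        · have h4 : X α = E' := by simp [X, hε]
          have h5 := hσF z (Or.inl (h4 ▸ hz'))
          simpa [F', letterPerm, hε] using h5
        · have h4 : X α = F α.1 '' E' := by simp [X, hε]
          have h5 := hσF (F α.1 z) (Or.inl (h4 ▸ ⟨z, hz', rfl⟩))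
          have h6 : letterPerm F α (F α.1 z) = z := by simp [letterPerm, hε]
          rw [h6] at h5
          simp only [F', if_true, hε]
          simp only [Bool.false_eq_true, if_false]
          rw [Equiv.Perm.inv_eq_iff_eq, h5]
      · have : i = j := by omega
        subst this
        have h4 : X β = E' := by simp [X, hβ]
        have h5 := hτF z (Or.inl (h4 ▸ hz'))
        simpa [F', hi, hβ, letterPerm] using h5
    · rw [wordPerm_cons, hμ', hα, hσμ]
    · rw [wordPerm_cons, hμ', hβ', hτμ]
  have haHigh : ∀ Z : Set M, a ∉ {q ∈ P | High q} := fun _ h =>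
    absurd (h.2 []) (not_lt.2 (by rw [dist_self]; exact dist_nonneg))
  obtain ⟨y₁, -, hs1, hl1, hu1⟩ := RichOrdUlt.exists_insert a
    {letterPerm F α μ, letterPerm F β μ} {q ∈ P | High q}
    ((Set.finite_singleton _).insert _) hHighfin (haHigh ∅)
    (by
      rintro z (rfl | rfl) q ⟨-, hq⟩
      · have := hq (α :: w)
        rwa [wordPerm_cons] at this
      · have := hq (β :: w)
        rwa [wordPerm_cons] at this) (μ < a)
  obtain ⟨y₂, -, hs2, hl2, hu2⟩ := RichOrdUlt.exists_insert a {y₁} {q ∈ P | High q}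
    (Set.finite_singleton _) hHighfin (haHigh ∅)
    (by
      rintro z rfl q hq
      exact hu1 q hq) (μ < a)
  have hy := hl2 y₁ rfl
  have hl1α := hl1 _ (Or.inl rfl)
  have hl1β := hl1 _ (Or.inr rfl)
  refine ⟨α :: w, β :: w, ?_, ?_⟩
  · obtain ⟨F', h1, h2, h3, h4⟩ := hboth y₁ y₂ hs1 hs2 hl1α (hl1β.trans hy)
      (fun q hq hh => hu1 q ⟨hq, hh⟩) (fun q hq hh => hu2 q ⟨hq, hh⟩)
    exact ⟨F', h1, h2, by rwa [h3, h4]⟩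
  · obtain ⟨F', h1, h2, h3, h4⟩ := hboth y₂ y₁ hs2 hs1 (hl1α.trans hy) hl1β
      (fun q hq hh => hu2 q ⟨hq, hh⟩) (fun q hq hh => hu1 q ⟨hq, hh⟩)
    exact ⟨F', h1, h2, by rw [h3, h4]; exact hy.not_gt⟩

end Words

/-! ### There is no comeager two-dimensional diagonal conjugacy class -/

section DiagonalClass

variable {M : Type} [boronLang.Structure M]

lemma isOpen_wordPerm_apply_eq (w : List (Fin 2 × Bool)) (b c : M) :
    IsOpen {F : Fin 2 → autGroup boronLang M | wordPerm (fun i => (F i).1) w b = c} := by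
  induction w generalizing c with
  | nil => simp [wordPerm]
  | cons s w ih =>
    have : {F : Fin 2 → autGroup boronLang M | wordPerm (fun i => (F i).1) (s :: w) b = c} =
        ⋃ y, {F | wordPerm (fun i => (F i).1) w b = y} ∩
          {F | letterPerm (fun i => (F i).1) s y = c} := by
      ext F
      simp [wordPerm_cons]
    rw [this]
    refine isOpen_iUnion fun y => (ih y).inter ?_
    rcases s with ⟨i, _ | _⟩
    · have : {F : Fin 2 → autGroup boronLang M | letterPerm (fun i => (F i).1) (i, false) y = c} =
          (fun F => F i) ⁻¹' {φ | φ.1 c = y} := by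
        ext F
        simp only [letterPerm, Bool.false_eq_true, if_false, Set.mem_ofPred_eq, Set.mem_preimage]
        rw [Equiv.Perm.inv_eq_iff_eq, eq_comm]
      rw [this]
      exact (isOpen_apply_eq c y).preimage (continuous_apply i)
    · have : {F : Fin 2 → autGroup boronLang M | letterPerm (fun i => (F i).1) (i, true) y = c} =
          (fun F => F i) ⁻¹' {φ | φ.1 y = c} := rfl
      rw [this]
      exact (isOpen_apply_eq y c).preimage (continuous_apply i)

variable [MetricSpace M] [LinearOrder M] [RichOrdUlt M] [BoronCompat M]

/-- A comeager diagonal class would be somewhere dense even when the conjugating elements are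
restricted to a coset of the stabilizer of two points `a`, `b`; but then comparisons of the
distances from `a` of the images of `b` under words would be locally constant. -/
theorem not_hasComeagerDiagonalClass :
    ¬ HasComeagerDiagonalClass (autGroup boronLang M) 2 := by
  have := RichOrdUlt.countable (X := M)
  rintro ⟨g, hg⟩
  obtain ⟨a⟩ := RichOrdUlt.nonempty (X := M)
  obtain ⟨b, hba, -⟩ := RichOrdUlt.exists_insert a ∅ ∅ Set.finite_empty Set.finite_empty (by simp)
    (by simp) True
  -- an open set of pairs that fix `a` and whose first member moves `b`
  let O : Set (Fin 2 → autGroup boronLang M) :=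
    {F | (∀ i, (F i).1 a = a) ∧ dist a b < dist a ((F 0).1 b)}
  have hOopen : IsOpen O := by
    have : O = (⋂ i, (fun F => F i) ⁻¹' {φ | φ.1 a = a}) ∩
        ⋃ (y : M) (_ : dist a b < dist a y), (fun F => F 0) ⁻¹' {φ | φ.1 b = y} := by
      ext F
      simp [O]
    rw [this]
    exact (isOpen_iInter_of_finite fun i =>
        (isOpen_apply_eq a a).preimage (continuous_apply i)).inter
      (isOpen_iUnion fun y => isOpen_iUnion fun _ =>
        (isOpen_apply_eq b y).preimage (continuous_apply 0))
  have hOne : O.Nonempty := by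
    obtain ⟨c, hca, hcside, hc, -⟩ := RichOrdUlt.exists_insert a {b} ∅ (Set.finite_singleton b)
      Set.finite_empty (by simp) (by simp) (b < a)
    have hbc := hc b rfl
    have hpi : IsPartialIso (insert (b, c) {(a, a)}) := by
      refine (IsPartialIso.singleton (a, a)).insert_of_base (f := (a, a)) rfl ?_ ?_ ?_ hcside.symm
      · rintro p rfl -
        simpa using hca.symm
      · rintro p rfl h
        simp only [dist_self] at h
        exact absurd h (not_lt.2 dist_nonneg)
      · rintro p rfl
        rw [dist_self]
        exact (dist_pos.2 hba.symm).ne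
    obtain ⟨φ, hφ, h1⟩ := hpi.exists_isoGroup ((Set.finite_singleton _).insert _)
    refine ⟨fun i => ⟨φ, autGroup_eq_isoGroup (M := M) ▸ hφ⟩, fun i => h1 (a, a) (Or.inr rfl), ?_⟩
    have h2 : φ b = c := h1 (b, c) (Or.inl rfl)
    simpa only [h2] using hbc
  -- the part of the class obtained from conjugating elements with prescribed values at `a`, `b`
  let S : M × M → Set (Fin 2 → autGroup boronLang M) := fun q =>
    {F | ∃ k : autGroup boronLang M, k.1 a = q.1 ∧ k.1 b = q.2 ∧ ∀ i, F i = k⁻¹ * g i * k}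
  obtain ⟨t, ht1, ht2, ht3⟩ := mem_residual.1 hg
  have hdense : Dense (⋃ q, interior (closure (S q))) := by
    refine IsGδ.dense_iUnion_interior_of_closed ht2 ht3 (fun q => isClosed_closure) ?_
    intro F hF
    obtain ⟨k, hk⟩ := ht1 hF
    exact Set.mem_iUnion.2 ⟨(k.1 a, k.1 b), subset_closure ⟨k, rfl, rfl, hk⟩⟩
  obtain ⟨F, hFO, hFS⟩ := hdense.inter_open_nonempty O hOopen hOne
  obtain ⟨q, hq⟩ := Set.mem_iUnion.1 hFS
  let V := interior (closure (S q))
  have hVopen : IsOpen V := isOpen_interior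
  -- a finite set such that pairs agreeing with `F` on it belong to `V`
  obtain ⟨E, hE, hEV⟩ : ∃ E : Set M, E.Finite ∧ ∀ F' : Fin 2 → autGroup boronLang M,
      (∀ i, ∀ z ∈ E, (F' i).1 z = (F i).1 z) → F' ∈ V := by
    obtain ⟨I, u, hu1, hu2⟩ := isOpen_pi_iff.1 hVopen F hq
    have h1 : ∀ i : Fin 2, ∃ R : Set M, R.Finite ∧ (i ∈ I → ∀ ψ : autGroup boronLang M,
        (∀ z ∈ R, ψ.1 z = (F i).1 z) → ψ ∈ u i) := by
      intro i
      by_cases hi : i ∈ I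
      · obtain ⟨R, h2, h3⟩ := exists_finite_of_isOpen (hu1 i hi).1 (hu1 i hi).2
        exact ⟨R, h2, fun _ => h3⟩
      · exact ⟨∅, Set.finite_empty, fun h => absurd h hi⟩
    choose R hR1 hR2 using h1
    refine ⟨⋃ i, R i, Set.finite_iUnion hR1, fun F' hF' => hu2 fun i hi => ?_⟩
    exact hR2 i hi _ fun z hz => hF' i z (Set.mem_iUnion.2 ⟨i, hz⟩)
  have hmem : ∀ φ : autGroup boronLang M, φ.1 ∈ isoGroup M := fun φ =>
    autGroup_eq_isoGroup (M := M) ▸ φ.2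
  obtain ⟨w₁, w₂, ⟨F₁, h1, h2, h3⟩, ⟨F₂, h4, h5, h6⟩⟩ :=
    exists_words_differ (F := fun i => (F i).1) (fun i => hmem (F i)) hFO.1 hFO.2 hE
  have hcmp : ∀ p : Prop, IsOpen {G : Fin 2 → autGroup boronLang M |
      (dist a (wordPerm (fun i => (G i).1) w₁ b) <
        dist a (wordPerm (fun i => (G i).1) w₂ b)) = p} := by
    intro p
    have : {G : Fin 2 → autGroup boronLang M |
      (dist a (wordPerm (fun i => (G i).1) w₁ b) < dist a (wordPerm (fun i => (G i).1) w₂ b)) = p} =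
      ⋃ (y : M) (y' : M) (_ : (dist a y < dist a y') = p),
        {G | wordPerm (fun i => (G i).1) w₁ b = y} ∩
          {G | wordPerm (fun i => (G i).1) w₂ b = y'} := by
      ext G
      simp
    rw [this]
    exact isOpen_iUnion fun y => isOpen_iUnion fun y' => isOpen_iUnion fun _ =>
      (isOpen_wordPerm_apply_eq w₁ b y).inter (isOpen_wordPerm_apply_eq w₂ b y')
  -- on members of the class in `S q`, the comparison is that of words in `g` at the points `q`
  have key : ∀ p : Prop, ∀ G : Fin 2 → autGroup boronLang M, G ∈ V →
      (dist a (wordPerm (fun i => (G i).1) w₁ b) < dist a (wordPerm (fun i => (G i).1) w₂ b)) = p →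
      (dist q.1 (wordPerm (fun i => (g i).1) w₁ q.2) <
        dist q.1 (wordPerm (fun i => (g i).1) w₂ q.2)) = p := by
    intro p G hGV hGp
    obtain ⟨G', hG', k, hk1, hk2, hk3⟩ := mem_closure_iff.1 (interior_subset hGV) _ (hcmp p) hGp
    rw [← hG', eq_iff_iff]
    have hG'' : (fun i => (G' i).1) = fun i => k.1⁻¹ * (g i).1 * k.1 := by
      ext i
      rw [hk3 i]
      rfl
    rw [hG'', isoGroup.dist_lt_iff (hmem k) (x := a), wordPerm_conj, wordPerm_conj, hk1, hk2]
  have k1 := key True (fun i => ⟨F₁ i, autGroup_eq_isoGroup (M := M) ▸ h1 i⟩) (hEV _ h2)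
    (eq_true h3)
  have k2 := key False (fun i => ⟨F₂ i, autGroup_eq_isoGroup (M := M) ▸ h4 i⟩) (hEV _ h5)
    (eq_false h6)
  exact (k1.symm.trans k2).mp trivial

end DiagonalClass

/-! ### Rooted trees given by parent functions -/

section ParentFunctions

variable {W : Type}

/-- The function `par`, of which only the values at vertices other than `r` matter, is the parent
function of a rooted tree with root `r` in which `ρ` is the height. -/
structure IsParentFun (r : W) (ρ : W → ℕ) (par : W → W) : Prop where
  rank_root : ρ r = 0
  rank_par : ∀ {x : W}, x ≠ r → ρ x = ρ (par x) + 1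

/-- The tree order determined by a parent function. -/
def ParentLE (r : W) (par : W → W) : W → W → Prop :=
  Relation.ReflTransGen fun u v => v ≠ r ∧ par v = u

lemma ParentLE.refl (r : W) (par : W → W) (x : W) : ParentLE r par x x :=
  Relation.ReflTransGen.refl

lemma ParentLE.trans {r : W} {par : W → W} {x y z : W} (h : ParentLE r par x y)
    (h' : ParentLE r par y z) : ParentLE r par x z :=
  Relation.ReflTransGen.trans h h'

lemma parentLE_iff {r : W} {par : W → W} {x y : W} :
    ParentLE r par x y ↔ y = x ∨ (y ≠ r ∧ ParentLE r par x (par y)) := by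
  rw [ParentLE, Relation.ReflTransGen.cases_tail_iff]
  refine or_congr Iff.rfl ⟨?_, ?_⟩
  · rintro ⟨c, h, h1, rfl⟩
    exact ⟨h1, h⟩
  · rintro ⟨h1, h⟩
    exact ⟨_, h, h1, rfl⟩

lemma ParentLE.par_le {r : W} {par : W → W} {x : W} (hx : x ≠ r) : ParentLE r par (par x) x :=
  parentLE_iff.2 (Or.inr ⟨hx, .refl _ _ _⟩)

/-- A vertex strictly below `y` has a child below `y`. -/
lemma ParentLE.exists_child {r : W} {par : W → W} {x y : W} (h : ParentLE r par x y) (hne : x ≠ y) :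
    ∃ c, c ≠ r ∧ par c = x ∧ ParentLE r par c y := by
  rcases Relation.ReflTransGen.cases_head h with h | ⟨c, ⟨h1, h2⟩, h3⟩
  · exact absurd h hne
  · exact ⟨c, h1, h2, h3⟩

namespace IsParentFun

variable {r : W} {ρ : W → ℕ} {par : W → W} (hp : IsParentFun r ρ par)
include hp

lemma rank_le {x y : W} (h : ParentLE r par x y) : ρ x ≤ ρ y := by
  induction h with
  | refl => exact le_rfl
  | tail _ h ih =>
    have := hp.rank_par h.1
    rw [h.2] at this
    omega

lemma eq_of_rank_eq {x y : W} (h : ParentLE r par x y) (hr : ρ x = ρ y) : x = y := by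
  rcases parentLE_iff.1 h with h1 | ⟨h1, h2⟩
  · exact h1.symm
  · have := hp.rank_le h2
    have := hp.rank_par h1
    omega

lemma rank_lt {x y : W} (h : ParentLE r par x y) (hne : x ≠ y) : ρ x < ρ y :=
  lt_of_le_of_ne (hp.rank_le h) fun h' => hne (hp.eq_of_rank_eq h h')

lemma not_le_par {x : W} (hx : x ≠ r) : ¬ ParentLE r par x (par x) := fun h => by
  have := hp.rank_le h
  have := hp.rank_par hx
  omega

lemma root_le (x : W) : ParentLE r par r x := by
  induction h : ρ x generalizing x with
  | zero =>
    have : x = r := by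
      by_contra hx
      have := hp.rank_par hx
      omega
    rw [this]
    exact .refl _ _ _
  | succ n ih =>
    by_cases hx : x = r
    · rw [hx]
      exact .refl _ _ _
    · have := hp.rank_par hx
      exact (ih (par x) (by omega)).trans (.par_le hx)

/-- The vertices below a given one form a chain. -/
lemma le_of_rank_le {x y z : W} (hx : ParentLE r par x z) (hy : ParentLE r par y z)
    (h : ρ x ≤ ρ y) : ParentLE r par x y := by
  induction hy with
  | refl => exact hx
  | tail hy1 hs ih =>
    rename_i b c
    rcases parentLE_iff.1 hx with rfl | ⟨-, h2⟩
    · have := hp.rank_le hy1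
      have := hp.rank_par hs.1
      rw [hs.2] at this
      omega
    · rw [hs.2] at h2
      exact ih h2

lemma exists_meet (x y : W) : ∃ m, ParentLE r par m x ∧ ParentLE r par m y ∧
    ∀ z, ParentLE r par z x → ParentLE r par z y → ParentLE r par z m := by
  induction h : ρ x generalizing x with
  | zero =>
    have hx : x = r := by
      by_contra hx
      have := hp.rank_par hx
      omega
    exact ⟨x, .refl _ _ _, hx ▸ hp.root_le y, fun z hz _ => hz⟩
  | succ n ih =>
    have hx : x ≠ r := by
      rintro rfl
      rw [hp.rank_root] at h
      omega
    by_cases hxy : ParentLE r par x y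
    · exact ⟨x, .refl _ _ _, hxy, fun z hz _ => hz⟩
    · obtain ⟨m, h1, h2, h3⟩ := ih (par x) (by have := hp.rank_par hx; omega)
      refine ⟨m, h1.trans (.par_le hx), h2, fun z hz hz' => ?_⟩
      rcases parentLE_iff.1 hz with rfl | ⟨-, h4⟩
      · exact absurd hz' hxy
      · exact h3 z h4 hz'

/-- Distinct children of one vertex have no common upper bound. -/
lemma child_eq {c c' x : W} (hc : c ≠ r) (hc' : c' ≠ r) (h : par c = par c')
    (hx : ParentLE r par c x) (hx' : ParentLE r par c' x) : c = c' := by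
  have h1 := hp.rank_par hc
  have h2 := hp.rank_par hc'
  rw [h, ← h2] at h1
  exact hp.eq_of_rank_eq (hp.le_of_rank_le hx hx' h1.le) h1

/-- The common lower bounds of vertices above distinct children of `m` are those of `m`. -/
lemma le_of_children {c c' x y z : W} (hc : c ≠ r) (hc' : c' ≠ r) (h : par c = par c')
    (hne : c ≠ c') (hx : ParentLE r par c x) (hy : ParentLE r par c' y)
    (hzx : ParentLE r par z x) (hzy : ParentLE r par z y) : ParentLE r par z (par c) := by
  have h1 := hp.rank_par hc
  have h2 := hp.rank_par hc'
  rcases le_or_gt (ρ z) (ρ (par c)) with h3 | h3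
  · exact hp.le_of_rank_le hzx ((ParentLE.par_le hc).trans hx) h3
  · have h4 := hp.le_of_rank_le hx hzx (by omega)
    exact absurd (hp.child_eq hc hc' h (h4.trans hzy) hy) hne

end IsParentFun

/-- The edges of the graph `T` join the vertices other than `r` to their parents. -/
def IsParentGraph (T : SimpleGraph W) (r : W) (par : W → W) : Prop :=
  ∀ x y, T.Adj x y ↔ (x ≠ r ∧ par x = y) ∨ (y ≠ r ∧ par y = x)

lemma IsParentGraph.mem_support_of_exit {T : SimpleGraph W} {r : W} {par : W → W}
    (hT : IsParentGraph T r par) {y z w : W} (p : T.Walk z w) (hz : ParentLE r par y z)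
    (hw : ¬ ParentLE r par y w) : y ∈ p.support := by
  induction p with
  | nil => exact absurd hz hw
  | cons h p ih =>
    rename_i u v w
    by_cases hv : ParentLE r par y v
    · exact List.mem_cons_of_mem _ (ih hv hw)
    · rcases (hT u v).1 h with ⟨-, rfl⟩ | ⟨h1, rfl⟩
      · rcases parentLE_iff.1 hz with rfl | ⟨-, h2⟩
        · simp
        · exact absurd h2 hv
      · exact absurd (hz.trans (.par_le h1)) hv

namespace IsParentFun

variable {T : SimpleGraph W} {r : W} {ρ : W → ℕ} {par : W → W} (hp : IsParentFun r ρ par)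
  (hT : IsParentGraph T r par)
include hp hT

lemma mem_support_iff {x y : W} (p : T.Walk y r) (hpath : p.IsPath) :
    x ∈ p.support ↔ ParentLE r par x y := by
  induction p with
  | nil =>
    rw [parentLE_iff]
    simp [eq_comm]
  | cons h p ih =>
    rename_i u v r
    rw [SimpleGraph.Walk.cons_isPath_iff] at hpath
    rw [SimpleGraph.Walk.support_cons, List.mem_cons, ih hp hT hpath.1, parentLE_iff (y := u)]
    rcases (hT u v).1 h with ⟨h1, rfl⟩ | ⟨h1, rfl⟩
    · simp [h1, eq_comm]
    · refine absurd ?_ hpath.2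
      by_cases hr : par v = r
      · rw [hr]
        exact p.end_mem_support
      · refine hT.mem_support_of_exit p (.par_le h1) fun h2 => ?_
        rcases parentLE_iff.1 h2 with h3 | ⟨h3, -⟩
        · exact hr h3.symm
        · exact h3 rfl

lemma exists_path (y : W) : ∃ p : T.Walk y r, p.IsPath ∧ p.length = ρ y := by
  induction h : ρ y generalizing y with
  | zero =>
    have hy : y = r := by
      by_contra hy
      have := hp.rank_par hy
      omega
    subst hy
    exact ⟨.nil, .nil, rfl⟩
  | succ n ih =>
    have hy : y ≠ r := by
      rintro rfl
      rw [hp.rank_root] at h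
      omega
    obtain ⟨p, h1, h2⟩ := ih (par y) (by have := hp.rank_par hy; omega)
    refine ⟨.cons ((hT _ _).2 (Or.inl ⟨hy, rfl⟩)) p, ?_, by simp [h2]⟩
    rw [SimpleGraph.Walk.cons_isPath_iff, hp.mem_support_iff hT p h1]
    exact ⟨h1, hp.not_le_par hy⟩

lemma isAncestor_iff {x y : W} : IsAncestor T r x y ↔ ParentLE r par x y := by
  constructor
  · rintro ⟨p, h1, h2⟩
    rw [← hp.mem_support_iff hT p.reverse h1.reverse]
    simpa using h2
  · intro h
    obtain ⟨p, h1, -⟩ := hp.exists_path hT y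
    refine ⟨p.reverse, h1.reverse, ?_⟩
    simpa using (hp.mem_support_iff hT p h1).2 h

lemma isTreeMeet_iff {x y m : W} : IsTreeMeet T r x y m ↔ ParentLE r par m x ∧ ParentLE r par m y ∧
    ∀ z, ParentLE r par z x → ParentLE r par z y → ParentLE r par z m := by
  simp only [IsTreeMeet, hp.isAncestor_iff hT]

lemma isChild_iff {m c : W} : IsChild T r m c ↔ c ≠ r ∧ par c = m := by
  rw [IsChild, hp.isAncestor_iff hT, hT]
  constructor
  · rintro ⟨⟨h1, rfl⟩ | h, h2⟩
    · exact absurd h2 (hp.not_le_par h1)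
    · exact h
  · rintro ⟨h, rfl⟩
    exact ⟨Or.inr ⟨h, rfl⟩, .par_le h⟩

lemma connected : T.Connected := by
  have : Nonempty W := ⟨r⟩
  refine ⟨fun x y => ?_⟩
  obtain ⟨p, -⟩ := hp.exists_path hT x
  obtain ⟨q, -⟩ := hp.exists_path hT y
  exact ⟨p.append q.reverse⟩

lemma dist_root (y : W) : T.dist r y = ρ y := by
  have hle : ∀ {u v : W} (p : T.Walk u v), ρ v ≤ ρ u + p.length := by
    intro u v p
    induction p with
    | nil => simp
    | cons h p ih =>
      rename_i u v w
      rw [SimpleGraph.Walk.length_cons]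
      rcases (hT u v).1 h with ⟨h1, rfl⟩ | ⟨h1, rfl⟩
      · have := hp.rank_par h1
        omega
      · have := hp.rank_par h1
        omega
  obtain ⟨p, -, h⟩ := hp.exists_path hT y
  apply le_antisymm
  · rw [← h, SimpleGraph.dist_comm]
    exact SimpleGraph.dist_le p
  · obtain ⟨q, hq⟩ := (hp.connected hT).exists_walk_length_eq_dist r y
    have := hle q
    rw [hp.rank_root] at this
    omega

lemma isAcyclic : T.IsAcyclic := by
  have key : ∀ x, x ≠ r → ¬ (T \ SimpleGraph.fromEdgeSet {s(x, par x)}).Reachable x (par x) := by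
    rintro x hx ⟨p⟩
    have hstay : ∀ {u v : W} (p : (T \ SimpleGraph.fromEdgeSet {s(x, par x)}).Walk u v),
        ParentLE r par x u → ParentLE r par x v := by
      intro u v p
      induction p with
      | nil => exact id
      | cons h p ih =>
        rename_i u v w
        intro hu
        refine ih ?_
        rw [SimpleGraph.sdiff_adj] at h
        rcases (hT u v).1 h.1 with ⟨h1, rfl⟩ | ⟨h1, rfl⟩
        · rcases parentLE_iff.1 hu with rfl | ⟨-, h2⟩
          · refine absurd ?_ h.2
            rw [SimpleGraph.fromEdgeSet_adj]
            exact ⟨rfl, h.1.ne⟩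
          · exact h2
        · exact hu.trans (.par_le h1)
    exact hp.not_le_par hx (hstay p (.refl _ _ _))
  rw [SimpleGraph.isAcyclic_iff_forall_adj_isBridge]
  intro u v huv
  rw [SimpleGraph.isBridge_iff]
  rcases (hT u v).1 huv with ⟨h1, rfl⟩ | ⟨h1, rfl⟩
  · exact key u h1
  · rw [Sym2.eq_swap]
    exact fun h => key v h1 h.symm

end IsParentFun

end ParentFunctions

/-! ### Subdivided trees -/

section Subdivision

/-- Every tree with a chosen root has a parent function. -/
lemma exists_isParentFun {W : Type} {T : SimpleGraph W} (hc : T.Connected) (ha : T.IsAcyclic)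
    (r : W) : ∃ ρ par, IsParentFun r ρ par ∧ IsParentGraph T r par := by
  have htree : T.IsTree := ⟨hc, ha⟩
  have hex : ∀ x, ∃ y, x ≠ r → T.Adj x y ∧ T.dist r x = T.dist r y + 1 := by
    intro x
    by_cases hx : x = r
    · exact ⟨x, fun h => absurd hx h⟩
    · obtain ⟨p, hp⟩ := hc.exists_walk_length_eq_dist x r
      rcases p with _ | ⟨h, p⟩
      · exact absurd rfl hx
      · rename_i y
        refine ⟨y, fun _ => ⟨h, ?_⟩⟩
        have h1 := SimpleGraph.dist_le p
        rw [SimpleGraph.Walk.length_cons, SimpleGraph.dist_comm] at hp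
        rw [SimpleGraph.dist_comm] at h1
        rcases htree.dist_eq_dist_add_one_of_adj r h with h2 | h2 <;> omega
  choose par hpar using hex
  -- the neighbour nearer to `r` is unique, because the geodesics through it are paths to `x`
  have huniq : ∀ x y, T.Adj x y → T.dist r x = T.dist r y + 1 → x ≠ r ∧ par x = y := by
    intro x y h h1
    have hx : x ≠ r := by
      rintro rfl
      simp at h1
    refine ⟨hx, ?_⟩
    have key : ∀ z, T.Adj x z → T.dist r x = T.dist r z + 1 →
        ∃ q : T.Path r x, q.1.penultimate = z := by
      intro z hz hd
      obtain ⟨q, hq⟩ := hc.exists_walk_length_eq_dist r z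
      refine ⟨⟨q.concat hz.symm, SimpleGraph.Walk.isPath_of_length_eq_dist _ ?_⟩, ?_⟩
      · rw [SimpleGraph.Walk.length_concat, hq, hd]
      · exact q.penultimate_concat hz.symm
    obtain ⟨q, h2⟩ := key y h h1
    obtain ⟨q', h3⟩ := key (par x) (hpar x hx).1 (hpar x hx).2
    rw [← h2, ← h3, (ha.subsingleton_path r x).elim q q']
  refine ⟨fun x => T.dist r x, par, ⟨SimpleGraph.dist_self, fun hx => (hpar _ hx).2⟩,
    fun x y => ⟨fun h => ?_, ?_⟩⟩
  · rcases htree.dist_eq_dist_add_one_of_adj r h with h1 | h1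
    · exact Or.inl (huniq x y h h1)
    · exact Or.inr (huniq y x h.symm h1)
  · rintro (⟨h, rfl⟩ | ⟨h, rfl⟩)
    · exact (hpar x h).1
    · exact (hpar y h).1.symm

variable {V : Type}

/-- Every vertex of a graph has one neighbour more than it has children after the edge `{a, b}`
has been subdivided and the new vertex has been made the root. -/
lemma ncard_neighborSet_of_subdivideEdge [Finite V] {G : SimpleGraph V} {a b : V} (hab : G.Adj a b)
    {ρ : Option V → ℕ} {par : Option V → Option V} (hp : IsParentFun none ρ par)
    (hT : IsParentGraph (subdivideEdge G a b) none par) (v : V) :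
    (G.neighborSet v).ncard = {w | par (some w) = some v}.ncard + 1 := by
  have hroot : ∀ v, par (some v) = none ↔ v = a ∨ v = b := by
    intro v
    have h := hT (some v) none
    simpa [subdivideEdge] using h.symm
  have hadj : ∀ u v, G.Adj u v ∧ s(u, v) ≠ s(a, b) ↔
      par (some u) = some v ∨ par (some v) = some u := by
    intro u v
    exact (hT (some u) (some v)).trans (by simp)
  have hcases : ∃ q, G.neighborSet v = insert q {w | par (some w) = some v} ∧
      ¬ par (some q) = some v := by
    by_cases hva : v = a
    · subst hva
      refine ⟨b, ?_, by simp [(hroot b).2 (Or.inr rfl)]⟩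
      ext w
      have h1 := hadj v w
      rw [(hroot v).2 (Or.inl rfl)] at h1
      simp only [SimpleGraph.mem_neighborSet, Set.mem_insert_iff, Set.mem_ofPred_eq]
      by_cases hw : w = b
      · simp [hw, hab]
      · simpa [hw, hab.ne] using h1
    · by_cases hvb : v = b
      · subst hvb
        refine ⟨a, ?_, by simp [(hroot a).2 (Or.inl rfl)]⟩
        ext w
        have h1 := hadj v w
        rw [(hroot v).2 (Or.inr rfl)] at h1
        simp only [SimpleGraph.mem_neighborSet, Set.mem_insert_iff, Set.mem_ofPred_eq]
        by_cases hw : w = a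
        · simp [hw, hab.symm]
        · simpa [hw, hva] using h1
      · obtain ⟨q, hq⟩ : ∃ q, par (some v) = some q := by
          rw [← Option.ne_none_iff_exists']
          exact fun h => ((hroot v).1 h).elim hva hvb
        refine ⟨q, ?_, fun h => ?_⟩
        · ext w
          have h1 := hadj v w
          rw [hq] at h1
          simpa [hva, hvb, Ne.symm hva, Ne.symm hvb, eq_comm] using h1
        · have h1 := hp.rank_par (x := some v) (by simp)
          have h2 := hp.rank_par (x := some q) (by simp)
          rw [h] at h2
          rw [hq] at h1
          omega
  obtain ⟨q, h1, h2⟩ := hcases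
  have h3 : q ∉ {w | par (some w) = some v} := h2
  rw [h1, Set.ncard_insert_of_notMem h3]

/-- The parent function of the subdivided tree is that of the tree rooted at `a`, except that `a`
and `b` become the children of the new vertex; this raises the height of the vertices not above
`b`. -/
lemma exists_isParentFun_subdivideEdge {G : SimpleGraph V} (hc : G.Connected) (hacyc : G.IsAcyclic)
    {a b : V} (hab : G.Adj a b) : ∃ ρ par, IsParentFun none ρ par ∧
      IsParentGraph (subdivideEdge G a b) none par := by
  classical
  obtain ⟨ρ, p, hp, hG, hb⟩ : ∃ ρ p, IsParentFun a ρ p ∧ IsParentGraph G a p ∧ p b = a := by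
    obtain ⟨ρ, p, hp, hG⟩ := exists_isParentFun hc hacyc a
    refine ⟨ρ, p, hp, hG, ?_⟩
    rcases (hG a b).1 hab with ⟨h, -⟩ | ⟨-, h⟩
    · exact absurd rfl h
    · exact h
  have hba : b ≠ a := hab.ne'
  let par : Option V → Option V := fun x => x.elim none fun v =>
    if v = a ∨ v = b then none else some (p v)
  let ρ' : Option V → ℕ := fun x => x.elim 0 fun v => if ParentLE a p b v then ρ v else ρ v + 1
  have hnab : ¬ ParentLE a p b a := fun h => by
    have h1 := hp.rank_le h
    have h2 := hp.rank_par hba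
    rw [hp.rank_root] at h1
    omega
  have hb1 : ρ b = 1 := by
    rw [hp.rank_par hba, hb, hp.rank_root]
  refine ⟨ρ', par, ⟨rfl, ?_⟩, ?_⟩
  · rintro (_ | v) hv
    · exact absurd rfl hv
    · by_cases hva : v = a
      · simp [ρ', par, hva, hnab, hp.rank_root]
      · by_cases hvb : v = b
        · simp [ρ', par, hvb, ParentLE.refl, hb1]
        · have h1 : ParentLE a p b v ↔ ParentLE a p b (p v) := by
            rw [parentLE_iff]
            simp [hva, hvb]
          have h2 := hp.rank_par hva
          simp only [ρ', par, Option.elim, hva, hvb, or_self, if_false, h1]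
          split_ifs <;> omega
  · have hsome : ∀ u v, par (some u) = some v ↔ (u ≠ a ∧ u ≠ b) ∧ p u = v := by
      intro u v
      by_cases h : u = a ∨ u = b
      · simp only [par, Option.elim, h, if_true]
        simp
        tauto
      · simp only [par, Option.elim, h, if_false, Option.some.injEq]
        tauto
    have hnone : ∀ u, par (some u) = none ↔ u = a ∨ u = b := by
      intro u
      simp [par]
      tauto
    rintro (_ | u) (_ | v)
    · simp
    · simpa [subdivideEdge] using (hnone v).symm
    · simpa [subdivideEdge] using (hnone u).symm
    · simp only [subdivideEdge, ne_eq, reduceCtorEq, not_false_eq_true, true_and, hsome, hG u v,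
        Sym2.eq_iff]
      constructor
      · rintro ⟨⟨h1, rfl⟩ | ⟨h1, rfl⟩, h2⟩
        · refine Or.inl ⟨⟨h1, ?_⟩, rfl⟩
          rintro rfl
          exact h2 (Or.inr ⟨rfl, hb⟩)
        · refine Or.inr ⟨⟨h1, ?_⟩, rfl⟩
          rintro rfl
          exact h2 (Or.inl ⟨hb, rfl⟩)
      · rintro (⟨⟨h1, h2⟩, h3⟩ | ⟨⟨h1, h2⟩, h3⟩)
        · exact ⟨Or.inl ⟨h1, h3⟩, by tauto⟩
        · exact ⟨Or.inr ⟨h1, h3⟩, by tauto⟩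

/-- A rooted tree whose root has exactly the two children `a` and `b` arises from a tree by
subdivision of the edge `{a, b}`. -/
lemma exists_subdivideEdge {ρ : Option V → ℕ} {par : Option V → Option V}
    (hp : IsParentFun none ρ par) {a b : V} (hab : a ≠ b)
    (hroot : ∀ v, par (some v) = none ↔ v = a ∨ v = b) :
    ∃ G : SimpleGraph V, G.Adj a b ∧ G.Connected ∧ G.IsAcyclic ∧
      IsParentGraph (subdivideEdge G a b) none par := by
  classical
  have hne : ∀ u, par (some u) ≠ some u := fun u h => by
    have := hp.rank_par (x := some u) (by simp)
    rw [h] at this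
    omega
  have ha : par (some a) = none := (hroot a).2 (Or.inl rfl)
  have hb : par (some b) = none := (hroot b).2 (Or.inr rfl)
  let G : SimpleGraph V :=
    { Adj := fun u v => par (some u) = some v ∨ par (some v) = some u ∨ s(u, v) = s(a, b)
      symm := ⟨fun u v h => by rw [Sym2.eq_swap]; tauto⟩
      loopless := ⟨fun u h => by
        rcases h with h | h | h
        · exact hne u h
        · exact hne u h
        · rw [Sym2.eq_iff] at h
          rcases h with ⟨h1, h2⟩ | ⟨h1, h2⟩
          · exact hab (h1.symm.trans h2)
          · exact hab (h2.symm.trans h1)⟩ }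
  have hT : IsParentGraph (subdivideEdge G a b) none par := by
    rintro (_ | u) (_ | v)
    · simp [subdivideEdge]
    · simpa [subdivideEdge] using (hroot v).symm
    · simpa [subdivideEdge] using (hroot u).symm
    · simp only [subdivideEdge, ne_eq, reduceCtorEq, not_false_eq_true, true_and, G]
      constructor
      · tauto
      · have key : ∀ u v, par (some u) = some v → s(u, v) ≠ s(a, b) := by
          intro u v h h1
          rcases Sym2.eq_iff.1 h1 with ⟨rfl, -⟩ | ⟨rfl, -⟩
          · rw [ha] at h
            cases h
          · rw [hb] at h
            cases h
        rintro (h | h)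
        · exact ⟨Or.inl h, key u v h⟩
        · refine ⟨Or.inr (Or.inl h), ?_⟩
          rw [Sym2.eq_swap]
          exact key v u h
  -- the parent function and the height of the tree rooted at `a`
  let p : V → V := fun v => if v = b then a else (par (some v)).getD a
  let ρ' : V → ℕ := fun v =>
    if ParentLE none par (some b) (some v) then ρ (some v) else ρ (some v) - 1
  have h1 : ∀ v, (v = a ∨ v = b) → ρ (some v) = 1 := by
    intro v hv
    rw [hp.rank_par (by simp), (hroot v).2 hv, hp.rank_root]
  have hsome : ∀ v, v ≠ a → v ≠ b → par (some v) = some (p v) := by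
    intro v hva hvb
    obtain ⟨u, hu⟩ : ∃ u, par (some v) = some u := by
      rw [← Option.ne_none_iff_exists']
      exact fun h => ((hroot v).1 h).elim hva hvb
    simp [p, hvb, hu]
  have hpb : p b = a := by simp [p]
  have hρa : ρ' a = 0 := by
    have h2 : ¬ ParentLE none par (some b) (some a) := fun h => by
      have := hp.eq_of_rank_eq h (by rw [h1 b (Or.inr rfl), h1 a (Or.inl rfl)])
      exact hab (Option.some.inj this).symm
    simp [ρ', h2, h1 a (Or.inl rfl)]
  have hp' : IsParentFun a ρ' p := by
    refine ⟨hρa, fun {v} hva => ?_⟩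
    by_cases hvb : v = b
    · subst hvb
      rw [hpb, hρa]
      simp [ρ', ParentLE.refl, h1 v (Or.inr rfl)]
    · have h2 := hsome v hva hvb
      have h3 := hp.rank_par (x := some v) (by simp)
      have h4 : ParentLE none par (some b) (some v) ↔ ParentLE none par (some b) (some (p v)) := by
        rw [parentLE_iff, h2]
        simp [hvb]
      have h5 := hp.rank_par (x := some (p v)) (by simp)
      rw [h2] at h3
      simp only [ρ', h4]
      split_ifs <;> omega
  have hG : IsParentGraph G a p := by
    have key : ∀ u v, (par (some u) = some v ∨ (u = b ∧ v = a)) ↔ (u ≠ a ∧ p u = v) := by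
      intro u v
      by_cases hua : u = a
      · subst hua
        simp [ha, hab]
      · by_cases hub : u = b
        · subst hub
          simp [hb, hpb, hab.symm, eq_comm]
        · simp [hsome u hua hub, hua, hub]
    intro u v
    rw [← key u v, ← key v u]
    simp only [G, Sym2.eq_iff]
    tauto
  exact ⟨G, Or.inr (Or.inr rfl), hp'.connected hG, hp'.isAcyclic hG, hT⟩

end Subdivision

/-! ### The metric of an ordered boron tree structure -/

section BranchOrder

variable {W : Type} {r : W} {ρ : W → ℕ} {par : W → W}

/-- The lexicographical order of the vertices of a rooted tree, in terms of the parent function. -/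
def BranchLT (r : W) (par : W → W) (o : LinearOrder W) (x y : W) : Prop :=
  ∃ c c', c ≠ r ∧ c' ≠ r ∧ par c = par c' ∧ ParentLE r par c x ∧ ParentLE r par c' y ∧ o.lt c c'

lemma IsParentFun.treeLexLT_iff (hp : IsParentFun r ρ par) {T : SimpleGraph W}
    (hT : IsParentGraph T r par) {o : LinearOrder W} {x y : W} :
    treeLexLT T r o x y ↔ BranchLT r par o x y := by
  simp only [treeLexLT, hp.isChild_iff hT, hp.isAncestor_iff hT]
  constructor
  · rintro ⟨m, c, c', ⟨h1, h2⟩, ⟨h3, h4⟩, h5, h6, h7⟩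
    exact ⟨c, c', h1, h3, h2.trans h4.symm, h5, h6, h7⟩
  · rintro ⟨c, c', h1, h3, h2, h5, h6, h7⟩
    exact ⟨par c, c, c', ⟨h1, rfl⟩, ⟨h3, h2.symm⟩, h5, h6, h7⟩

namespace IsParentFun

variable (hp : IsParentFun r ρ par)

/-- The height of the meet of two vertices. -/
noncomputable def meetRank (x y : W) : ℕ :=
  ρ (hp.exists_meet x y).choose

include hp

lemma meetRank_eq {x y m : W} (hx : ParentLE r par m x) (hy : ParentLE r par m y)
    (h : ∀ z, ParentLE r par z x → ParentLE r par z y → ParentLE r par z m) :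
    hp.meetRank x y = ρ m := by
  obtain ⟨h1, h2, h3⟩ := (hp.exists_meet x y).choose_spec
  exact le_antisymm (hp.rank_le (h _ h1 h2)) (hp.rank_le (h3 _ hx hy))

lemma meetRank_comm (x y : W) : hp.meetRank x y = hp.meetRank y x := by
  obtain ⟨h1, h2, h3⟩ := (hp.exists_meet y x).choose_spec
  exact hp.meetRank_eq h2 h1 fun z h4 h5 => h3 z h5 h4

lemma meetRank_le (x y : W) : hp.meetRank x y ≤ ρ x :=
  hp.rank_le (hp.exists_meet x y).choose_spec.1

/-- The ultrametric inequality: the meets of `x`, `y` and of `y`, `z` are comparable, and the lower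
one lies below `x` and `z`. -/
lemma min_meetRank_le (x y z : W) :
    min (hp.meetRank x y) (hp.meetRank y z) ≤ hp.meetRank x z := by
  obtain ⟨h1, h2, -⟩ := (hp.exists_meet x y).choose_spec
  obtain ⟨h3, h4, -⟩ := (hp.exists_meet y z).choose_spec
  obtain ⟨-, -, h5⟩ := (hp.exists_meet x z).choose_spec
  rcases le_total (hp.meetRank x y) (hp.meetRank y z) with h | h
  · rw [min_eq_left h]
    exact hp.rank_le (h5 _ h1 ((hp.le_of_rank_le h2 h3 h).trans h4))
  · rw [min_eq_right h]
    exact hp.rank_le (h5 _ ((hp.le_of_rank_le h3 h2 h).trans h1) h4)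

lemma meetRank_eq_of_children {c c' x y : W} (hc : c ≠ r) (hc' : c' ≠ r) (h : par c = par c')
    (hne : c ≠ c') (hx : ParentLE r par c x) (hy : ParentLE r par c' y) :
    hp.meetRank x y = ρ (par c) :=
  hp.meetRank_eq ((ParentLE.par_le hc).trans hx) (h ▸ (ParentLE.par_le hc').trans hy)
    fun _ => hp.le_of_children hc hc' h hne hx hy

lemma exists_children {x y : W} (hxy : ¬ ParentLE r par x y) (hyx : ¬ ParentLE r par y x) :
    ∃ c c', c ≠ r ∧ c' ≠ r ∧ par c = par c' ∧ ParentLE r par c x ∧ ParentLE r par c' y ∧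
      c ≠ c' := by
  obtain ⟨m, h1, h2, h3⟩ := hp.exists_meet x y
  obtain ⟨c, hc, hcm, hcx⟩ := h1.exists_child (fun h => hxy (h ▸ h2))
  obtain ⟨c', hc', hcm', hcy⟩ := h2.exists_child (fun h => hyx (h ▸ h1))
  refine ⟨c, c', hc, hc', hcm.trans hcm'.symm, hcx, hcy, ?_⟩
  rintro rfl
  exact hp.not_le_par hc (hcm ▸ h3 c hcx hcy)

lemma not_branchLT_self {o : LinearOrder W} (x : W) : ¬ BranchLT r par o x x := by
  rintro ⟨c, c', h1, h2, h3, h4, h5, h6⟩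
  rw [hp.child_eq h1 h2 h3 h4 h5] at h6
  exact @lt_irrefl _ o.toPreorder _ h6

lemma branchLT_total {o : LinearOrder W} {x y : W} (hxy : ¬ ParentLE r par x y)
    (hyx : ¬ ParentLE r par y x) : BranchLT r par o x y ∨ BranchLT r par o y x := by
  obtain ⟨c, c', h1, h2, h3, h4, h5, h6⟩ := hp.exists_children hxy hyx
  rcases @lt_or_gt_of_ne _ o _ _ h6 with h | h
  · exact Or.inl ⟨c, c', h1, h2, h3, h4, h5, h⟩
  · exact Or.inr ⟨c', c, h2, h1, h3.symm, h5, h4, h⟩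

/-- In a binary tree, of three lexicographically increasing vertices two neighbouring ones have a
higher meet than the other pairs. -/
lemma branchLT_trans (hbin : ∀ c c' c'', c ≠ r → c' ≠ r → c'' ≠ r → par c = par c' →
      par c' = par c'' → c = c' ∨ c' = c'' ∨ c = c'') {o : LinearOrder W} {x y z : W}
    (hxy : BranchLT r par o x y) (hyz : BranchLT r par o y z) : BranchLT r par o x z ∧
      ((hp.meetRank x y < hp.meetRank y z ∧ hp.meetRank x z = hp.meetRank x y) ∨
        (hp.meetRank y z < hp.meetRank x y ∧ hp.meetRank x z = hp.meetRank y z)) := by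
  obtain ⟨c₁, d₁, h1, h2, h3, h4, h5, h6⟩ := hxy
  obtain ⟨c₂, d₂, k1, k2, k3, k4, k5, k6⟩ := hyz
  have hne₁ : c₁ ≠ d₁ := by
    rintro rfl
    exact @lt_irrefl _ o.toPreorder _ h6
  have hne₂ : c₂ ≠ d₂ := by
    rintro rfl
    exact @lt_irrefl _ o.toPreorder _ k6
  rw [hp.meetRank_eq_of_children h1 h2 h3 hne₁ h4 h5,
    hp.meetRank_eq_of_children k1 k2 k3 hne₂ k4 k5]
  have hm₁ : ParentLE r par (par c₁) y := h3 ▸ (ParentLE.par_le h2).trans h5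
  have hm₂ : ParentLE r par (par c₂) y := (ParentLE.par_le k1).trans k4
  have hr₁ := hp.rank_par h2
  have hr₂ := hp.rank_par k1
  rw [← h3] at hr₁
  rcases lt_trichotomy (ρ (par c₁)) (ρ (par c₂)) with h | h | h
  · have hle : ParentLE r par d₁ z :=
      ((hp.le_of_rank_le h5 hm₂ (by omega)).trans (k3 ▸ ParentLE.par_le k2)).trans k5
    exact ⟨⟨c₁, d₁, h1, h2, h3, h4, hle, h6⟩,
      Or.inl ⟨h, hp.meetRank_eq_of_children h1 h2 h3 hne₁ h4 hle⟩⟩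
  · have hpar : par c₁ = par c₂ := hp.eq_of_rank_eq (hp.le_of_rank_le hm₁ hm₂ h.le) h
    obtain rfl := hp.child_eq h2 k1 (h3.symm.trans hpar) h5 k4
    rcases hbin c₁ d₁ d₂ h1 h2 k2 h3 k3 with h7 | h7 | h7
    · exact absurd h7 hne₁
    · exact absurd h7 hne₂
    · rw [h7] at h6
      exact absurd (@lt_trans _ o.toPreorder _ _ _ h6 k6) (@lt_irrefl _ o.toPreorder _)
  · have hle : ParentLE r par c₂ x :=
      ((hp.le_of_rank_le k4 hm₁ (by omega)).trans (ParentLE.par_le h1)).trans h4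
    exact ⟨⟨c₂, d₂, k1, k2, k3, hle, k5, k6⟩,
      Or.inr ⟨h, hp.meetRank_eq_of_children k1 k2 k3 hne₂ hle k5⟩⟩

end IsParentFun

end BranchOrder

/-- The leaves of a finite binary tree form an ordered ultrametric space; the distance of two
leaves is a constant minus the height of their meet. -/
lemma IsParentFun.exists_metric {W C : Type} [Finite W] {r : W} {ρ : W → ℕ} {par : W → W}
    (hp : IsParentFun r ρ par)
    (hbin : ∀ c c' c'', c ≠ r → c' ≠ r → c'' ≠ r → par c = par c' →
      par c' = par c'' → c = c' ∨ c' = c'' ∨ c = c'')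
    (o : LinearOrder W) {e : C → W} (he : Function.Injective e)
    (hleaf : ∀ x w, w ≠ r → par w ≠ e x) :
    ∃ (_ : MetricSpace C) (_ : LinearOrder C), OrdUlt C ∧
      (∀ x y : C, x < y ↔ BranchLT r par o (e x) (e y)) ∧
      (∀ x y z : C, x < y → y < z → (dist x y < dist y z ↔
        hp.meetRank (e y) (e z) < hp.meetRank (e x) (e y))) ∧
      ∀ x y : C, ∃ q : ℚ, dist x y = q := by
  classical
  have hnle : ∀ x y : C, x ≠ y → ¬ ParentLE r par (e x) (e y) := by
    intro x y hxy h
    obtain ⟨c, h1, h2, -⟩ := h.exists_child (fun h' => hxy (he h'))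
    exact hleaf x c h1 h2
  obtain ⟨N, hN⟩ : ∃ N, ∀ w, ρ w < N := by
    obtain ⟨w, hw⟩ := @Finite.exists_max W ℕ _ ⟨r⟩ _ ρ
    exact ⟨ρ w + 1, fun v => Nat.lt_succ_of_le (hw v)⟩
  have hmN : ∀ x y, hp.meetRank x y < N := fun x y => (hp.meetRank_le x y).trans_lt (hN x)
  let d : C → C → ℕ := fun x y => if x = y then 0 else N - hp.meetRank (e x) (e y)
  have hd : ∀ {x y}, x ≠ y → d x y = N - hp.meetRank (e x) (e y) := fun h => if_neg h
  have hd0 : ∀ x, d x x = 0 := fun x => if_pos rfl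
  have hdpos : ∀ {x y}, x ≠ y → 0 < d x y := by
    intro x y hxy
    rw [hd hxy]
    have := hmN (e x) (e y)
    omega
  have hcomm : ∀ x y, d x y = d y x := by
    intro x y
    simp only [d, hp.meetRank_comm (e x), eq_comm]
  have hult : ∀ x y z, d x z ≤ max (d x y) (d y z) := by
    intro x y z
    by_cases hxz : x = z
    · rw [hxz, hd0]
      exact Nat.zero_le _
    by_cases hxy : x = y
    · rw [hxy]
      exact le_max_right _ _
    by_cases hyz : y = z
    · rw [hyz]
      exact le_max_left _ _
    rw [hd hxz, hd hxy, hd hyz]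
    have := hp.min_meetRank_le (e x) (e y) (e z)
    omega
  let m : MetricSpace C :=
    { dist := fun x y => d x y
      dist_self := fun x => by exact_mod_cast hd0 x
      dist_comm := fun x y => by exact_mod_cast hcomm x y
      dist_triangle := fun x y z => by
        have := (hult x y z).trans (max_le_add_of_nonneg (Nat.zero_le _) (Nat.zero_le _))
        exact_mod_cast this
      eq_of_dist_eq_zero := fun {x y} h => by
        by_contra hxy
        exact (hdpos hxy).ne' (by exact_mod_cast h) }
  have hdist : ∀ x y : C, dist x y = d x y := fun _ _ => rfl
  let lt : C → C → Prop := fun x y => BranchLT r par o (e x) (e y)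
  have hirr : ∀ x, ¬ lt x x := fun x => hp.not_branchLT_self (e x)
  have htot : ∀ x y, x ≠ y → lt x y ∨ lt y x := fun x y hxy =>
    hp.branchLT_total (hnle x y hxy) (hnle y x hxy.symm)
  have hsto : IsStrictTotalOrder C lt :=
    { irrefl := hirr
      trans := fun x y z hxy hyz => (hp.branchLT_trans hbin hxy hyz).1
      trichotomous := fun x y h1 h2 => by
        by_contra h
        exact (htot x y h).elim h1 h2 }
  let ord : LinearOrder C := linearOrderOfSTO lt
  have hlt : ∀ x y : C, x < y ↔ lt x y := fun _ _ => Iff.rfl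
  refine ⟨m, ord, ?_, hlt, ?_, fun x y => ⟨d x y, by rw [hdist]; norm_cast⟩⟩
  · refine { toIsUltrametricDist := ⟨fun x y z => ?_⟩, dist_eq_max := ?_, dist_ne := ?_ }
    · rw [hdist, hdist, hdist]
      exact_mod_cast hult x y z
    · intro x y z hxy hyz
      have h := (hp.branchLT_trans hbin ((hlt x y).1 hxy) ((hlt y z).1 hyz)).2
      have hm := hmN (e x) (e y)
      have hm' := hmN (e y) (e z)
      rw [hdist, hdist, hdist]
      norm_cast
      rw [hd hxy.ne, hd hyz.ne, hd (hxy.trans hyz).ne]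
      omega
    · intro x y z hxy hyz
      have h := (hp.branchLT_trans hbin ((hlt x y).1 hxy) ((hlt y z).1 hyz)).2
      have hm := hmN (e x) (e y)
      have hm' := hmN (e y) (e z)
      rw [hdist, hdist]
      norm_cast
      rw [hd hxy.ne, hd hyz.ne]
      omega
  · intro x y z hxy hyz
    have hm := hmN (e x) (e y)
    have hm' := hmN (e y) (e z)
    rw [hdist, hdist]
    norm_cast
    rw [hd hxy.ne, hd hyz.ne]
    omega

/-- The metric and the order of an ordered boron tree structure. -/
lemma IsOrderedBoron.exists_metric {C : Type} [boronLang.Structure C] (h : IsOrderedBoron C) :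
    Finite C ∧ ∃ (_ : MetricSpace C) (_ : LinearOrder C), OrdUlt C ∧ BoronCompat C ∧
      ∀ x y : C, ∃ q : ℚ, dist x y = q := by
  classical
  rcases h with ⟨V, _, G, ⟨hc, hacyc, hdeg⟩, a, b, o, e, hab, hprec, hsep⟩ | ⟨hs, hprec, hsep⟩
  · refine ⟨Finite.of_equiv _ e.symm, ?_⟩
    obtain ⟨ρ, par, hp, hT⟩ := exists_isParentFun_subdivideEdge hc hacyc hab
    have hroot : ∀ v, par (some v) = none ↔ v = a ∨ v = b := by
      intro v
      have h := hT (some v) none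
      simpa [subdivideEdge] using h.symm
    have hcard : ∀ v, {w | par (some w) = some v}.ncard ≤ 2 := by
      intro v
      have h1 := ncard_neighborSet_of_subdivideEdge hab hp hT v
      have h2 := hdeg v
      omega
    have hbin : ∀ c c' c'', c ≠ none → c' ≠ none → c'' ≠ none → par c = par c' →
        par c' = par c'' → c = c' ∨ c' = c'' ∨ c = c'' := by
      rintro (_ | c) (_ | c') (_ | c'') hc hc' hc'' h1 h2
      any_goals contradiction
      simp only [Option.some.injEq]
      rcases hm : par (some c) with _ | m
      · have h3 := (hroot c).1 hm
        have h4 := (hroot c').1 (h1 ▸ hm)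
        have h5 := (hroot c'').1 (h2 ▸ h1 ▸ hm)
        grind
      · by_contra hne
        push Not at hne
        have h3 : ({c, c', c''} : Set V) ⊆ {w | par (some w) = some m} := by
          rintro w (rfl | rfl | rfl)
          · exact hm
          · exact h1.symm.trans hm
          · exact h2.symm.trans (h1.symm.trans hm)
        have h4 := Set.ncard_le_ncard h3
        rw [Set.ncard_eq_three.2 ⟨c, c', c'', hne.1, hne.2.2, hne.2.1, rfl⟩] at h4
        have := hcard m
        omega
    have hleaf : ∀ (x : C) (w : Option V), w ≠ none → par w ≠ some (e x).1 := by
      rintro x (_ | w) hw h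
      · exact hw rfl
      · have h1 := ncard_neighborSet_of_subdivideEdge hab hp hT (e x).1
        have h2 : (G.neighborSet (e x).1).ncard = 1 := (e x).2
        have h3 : {w | par (some w) = some (e x).1}.ncard = 0 := by omega
        rw [Set.ncard_eq_zero] at h3
        exact (h3 ▸ h : w ∈ (∅ : Set V))
    obtain ⟨m, ord, h1, h2, h3, h4⟩ := hp.exists_metric hbin o (e := fun x => some (e x).1)
      ((Option.some_injective _).comp (Subtype.val_injective.comp e.injective)) hleaf
    refine ⟨m, ord, h1, ⟨fun x y => ?_, fun x y z => ?_⟩, h4⟩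
    · rw [hprec, h2, hp.treeLexLT_iff hT]
    · have hlt : ∀ x y, boronPrec x y ↔ x < y := fun x y => by
        rw [hprec, h2, hp.treeLexLT_iff hT]
      rw [hsep, hlt, hlt]
      refine and_congr_right fun hxy => and_congr_right fun hyz => ?_
      rw [h3 x y z hxy hyz]
      simp only [hp.isTreeMeet_iff hT, hp.dist_root hT]
      constructor
      · rintro ⟨m, m', ⟨k1, k2, k3⟩, ⟨k4, k5, k6⟩, k7⟩
        rwa [hp.meetRank_eq k1 k2 k3, hp.meetRank_eq k4 k5 k6]
      · intro h
        exact ⟨_, _, (hp.exists_meet _ _).choose_spec, (hp.exists_meet _ _).choose_spec, h⟩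
  · refine ⟨inferInstance, ?_⟩
    have h0 : ∀ x y : C, x = y := fun x y => Subsingleton.elim x y
    let m : MetricSpace C :=
      { dist := fun _ _ => 0
        dist_self := fun _ => rfl
        dist_comm := fun _ _ => rfl
        dist_triangle := fun _ _ _ => by simp
        eq_of_dist_eq_zero := fun _ => h0 _ _ }
    let ord : LinearOrder C := LinearOrder.lift' (fun _ => ()) fun x y _ => h0 x y
    have hlt : ∀ x y : C, ¬ x < y := fun x y h => h.ne (h0 x y)
    refine ⟨m, ord, ?_, ⟨fun x y => ?_, fun x y z => ?_⟩, fun x y => ⟨0, by simp [h0 x y]⟩⟩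
    · exact
        { toIsUltrametricDist := ⟨fun _ _ _ => le_max_left _ _⟩
          dist_eq_max := fun h => absurd h (hlt _ _)
          dist_ne := fun h => absurd h (hlt _ _) }
    · simp [hprec, hlt]
    · simp [hsep, hlt]

/-! ### The tree of balls of a finite ordered ultrametric space -/

section Hulls

variable {X : Type} [MetricSpace X]

/-- The smallest ball that contains `x` and `y`. -/
def hull (x y : X) : Set X := {z | dist x z ≤ dist x y}

lemma left_mem_hull (x y : X) : x ∈ hull x y := by
  simp [hull]

lemma right_mem_hull (x y : X) : y ∈ hull x y := le_refl (dist x y)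

lemma hull_self (x : X) : hull x x = {x} := by
  ext z
  simp [hull, eq_comm]

lemma exists_hull_eq_univ [Finite X] [Nonempty X] : ∃ x y : X, hull x y = Set.univ := by
  obtain ⟨x⟩ := ‹Nonempty X›
  obtain ⟨y, hy⟩ := @Finite.exists_max X ℝ _ ⟨x⟩ _ (dist x)
  exact ⟨x, y, Set.eq_univ_of_forall hy⟩

variable [IsUltrametricDist X]

lemma mem_hull_iff {x y z w : X} (hz : z ∈ hull x y) : w ∈ hull x y ↔ dist z w ≤ dist x y := by
  have hz' : dist x z ≤ dist x y := hz
  constructor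
  · intro hw
    have hw' : dist x w ≤ dist x y := hw
    exact (IsUltrametricDist.dist_triangle_max z x w).trans (max_le (dist_comm x z ▸ hz') hw')
  · intro hw
    exact (IsUltrametricDist.dist_triangle_max x z w).trans (max_le hz' hw)

lemma hull_subset {x y u v : X} (hu : u ∈ hull x y) (hv : v ∈ hull x y) :
    hull u v ⊆ hull x y := fun _ hw =>
  (mem_hull_iff hu).2 (le_trans hw ((mem_hull_iff hu).1 hv))

lemma hull_subset_or_subset {x y u v z : X} (h : z ∈ hull x y) (h' : z ∈ hull u v) :
    hull x y ⊆ hull u v ∨ hull u v ⊆ hull x y := by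
  rcases le_total (dist x y) (dist u v) with hd | hd
  · exact Or.inl fun w hw => (mem_hull_iff h').2 (((mem_hull_iff h).1 hw).trans hd)
  · exact Or.inr fun w hw => (mem_hull_iff h).2 (((mem_hull_iff h').1 hw).trans hd)

/-- The vertices `o` of the rooted tree with parent function `par` correspond to the balls `S o`
of `X`, the tree order being reverse inclusion. -/
structure IsBallTree {V : Type} (S : Option V → Set X) (ρ : Option V → ℕ)
    (par : Option V → Option V) : Prop extends IsParentFun none ρ par where
  root : S none = Set.univ
  injective : Function.Injective S
  exists_hull : ∀ o, ∃ x y, S o = hull x y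
  exists_eq : ∀ x y, ∃ o, S o = hull x y
  le_iff : ∀ o o', ParentLE none par o' o ↔ S o ⊆ S o'

/-- The parent of a ball is the least ball that properly contains it. -/
lemma exists_isBallTree [Finite X] [Nonempty X] : ∃ (V : Type) (_ : Finite V)
    (S : Option V → Set X) (ρ : Option V → ℕ) (par : Option V → Option V),
      IsBallTree S ρ par := by
  classical
  let V := {B : Set X // (∃ x y, B = hull x y) ∧ B ≠ Set.univ}
  let S : Option V → Set X := fun o => o.elim Set.univ Subtype.val
  have hroot : S none = Set.univ := rfl
  have hinj : Function.Injective S := by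
    rintro (_ | u) (_ | v) h
    · rfl
    · exact absurd h.symm v.2.2
    · exact absurd h u.2.2
    · exact congrArg some (Subtype.ext h)
  have hhull : ∀ o, ∃ x y, S o = hull x y := by
    rintro (_ | v)
    · obtain ⟨x, y, h⟩ := exists_hull_eq_univ (X := X)
      exact ⟨x, y, h.symm⟩
    · exact v.2.1
  have hex : ∀ x y, ∃ o, S o = hull x y := by
    intro x y
    by_cases h : hull x y = Set.univ
    · exact ⟨none, h.symm⟩
    · exact ⟨some ⟨hull x y, ⟨x, y, rfl⟩, h⟩, rfl⟩
  have hpar : ∀ o, ∃ o', o ≠ none → S o ⊂ S o' ∧ ∀ o'', S o ⊂ S o'' → S o' ⊆ S o'' := by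
    intro o
    by_cases ho : o = none
    · exact ⟨none, fun h => absurd ho h⟩
    obtain ⟨o', h1, h2⟩ := Set.exists_min_image {o' | S o ⊂ S o'} (fun o' => (S o').ncard)
      (Set.toFinite _) ⟨none, by
        rw [Set.mem_ofPred_eq, hroot, Set.ssubset_univ_iff, ← hroot]
        exact fun h => ho (hinj h)⟩
    refine ⟨o', fun _ => ⟨h1, fun o'' h3 => ?_⟩⟩
    obtain ⟨x, y, hx⟩ := hhull o
    have hxo : x ∈ S o := hx ▸ left_mem_hull x y
    obtain ⟨x', y', hx'⟩ := hhull o'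
    obtain ⟨x'', y'', hx''⟩ := hhull o''
    have h4 : S o' ⊆ S o'' ∨ S o'' ⊆ S o' := by
      rw [hx', hx'']
      have h5 : S o ⊆ S o' := (show S o ⊂ S o' from h1).1
      exact hull_subset_or_subset (hx' ▸ h5 hxo) (hx'' ▸ h3.1 hxo)
    rcases h4 with h4 | h4
    · exact h4
    · exact (Set.eq_of_subset_of_ncard_le h4 (h2 o'' h3)).ge
  choose par hpar using hpar
  let ρ : Option V → ℕ := fun o => {o' | S o ⊂ S o'}.ncard
  have hp : IsParentFun none ρ par := by
    refine ⟨?_, fun {o} ho => ?_⟩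
    · rw [Set.ncard_eq_zero, Set.eq_empty_iff_forall_notMem]
      exact fun o h => h.2 (Set.subset_univ _)
    · obtain ⟨h1, h2⟩ := hpar o ho
      have h3 : {o' | S o ⊂ S o'} = insert (par o) {o' | S (par o) ⊂ S o'} := by
        ext o'
        simp only [Set.mem_ofPred_eq, Set.mem_insert_iff]
        constructor
        · intro h
          rcases (h2 o' h).eq_or_ssubset with h4 | h4
          · exact Or.inl (hinj h4.symm)
          · exact Or.inr h4
        · rintro (rfl | h)
          · exact h1
          · exact h1.trans h
      have h4 : par o ∉ {o' | S (par o) ⊂ S o'} := ssubset_irrefl (S (par o))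
      change Set.ncard _ = Set.ncard _ + 1
      rw [h3, Set.ncard_insert_of_notMem h4]
  refine ⟨V, inferInstance, S, ρ, par, hp, hroot, hinj, hhull, hex, fun o o' => ⟨fun h => ?_, ?_⟩⟩
  · induction h with
    | refl => exact le_rfl
    | tail _ h ih =>
      rw [← h.2] at ih
      exact (hpar _ h.1).1.subset.trans ih
  · induction h : ρ o using Nat.strong_induction_on generalizing o with
    | _ n ih =>
      intro hsub
      rw [parentLE_iff]
      rcases hsub.eq_or_ssubset with h1 | h1
      · exact Or.inl (hinj h1)
      · have ho : o ≠ none := by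
          rintro rfl
          exact h1.2 (Set.subset_univ _)
        refine Or.inr ⟨ho, ih _ ?_ _ rfl ((hpar o ho).2 o' h1)⟩
        have := hp.rank_par ho
        omega

end Hulls

namespace IsBallTree

variable {X : Type} [MetricSpace X] {V : Type} {S : Option V → Set X}
  {ρ : Option V → ℕ} {par : Option V → Option V} (hS : IsBallTree S ρ par)
include hS

lemma nonempty (o : Option V) : (S o).Nonempty := by
  obtain ⟨x, y, h⟩ := hS.exists_hull o
  exact ⟨x, h ▸ left_mem_hull x y⟩

lemma le_singleton_iff {o l : Option V} {x : X} (hl : S l = {x}) :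
    ParentLE none par o l ↔ x ∈ S o := by
  rw [hS.le_iff, hl, Set.singleton_subset_iff]

lemma disjoint_of_children {c c' : Option V} (hc : c ≠ none) (hc' : c' ≠ none)
    (h : par c = par c') (hne : c ≠ c') : Disjoint (S c) (S c') := by
  rw [Set.disjoint_left]
  intro x hx hx'
  obtain ⟨l, hl⟩ := hS.exists_eq x x
  rw [hull_self] at hl
  exact hne (hS.child_eq hc hc' h ((hS.le_singleton_iff hl).2 hx) ((hS.le_singleton_iff hl).2 hx'))

lemma ncard_children_singleton {x : X} {m : Option V} (hm : S m = {x}) :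
    {d | par (some d) = m}.ncard = 0 := by
  have : {d | par (some d) = m} = ∅ := by
    rw [Set.eq_empty_iff_forall_notMem]
    rintro d rfl
    have h1 : ParentLE none par (par (some d)) (some d) := ParentLE.par_le (by simp)
    obtain ⟨z, hz⟩ := hS.nonempty (some d)
    have h2 := (hS.le_iff _ _).1 h1
    have h3 : S (some d) = S (par (some d)) := by
      refine h2.antisymm ?_
      have h4 : z = x := by simpa [hm] using h2 hz
      rw [hm, Set.singleton_subset_iff, ← h4]
      exact hz
    have h4 := hS.rank_par (x := some d) (by simp)
    rw [← hS.injective h3] at h4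
    omega
  rw [this, Set.ncard_empty]

variable [LinearOrder X] [OrdUlt X]

lemma hull_subset {o : Option V} {x y : X} (hx : x ∈ S o) (hy : y ∈ S o) : hull x y ⊆ S o := by
  obtain ⟨u, v, h⟩ := hS.exists_hull o
  rw [h] at hx hy ⊢
  exact _root_.hull_subset hx hy

/-- Disjoint balls are comparable in the order of `X`. -/
lemma lt_iff_of_disjoint {o o' : Option V} (h : Disjoint (S o) (S o')) {x u y v : X}
    (hx : x ∈ S o) (hu : u ∈ S o) (hy : y ∈ S o') (hv : v ∈ S o') : x < y ↔ u < v := by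
  have h1 : dist x u < dist x y := by
    by_contra hc
    exact Set.disjoint_left.1 h (hS.hull_subset hx hu (not_lt.1 hc)) hy
  have h2 : dist y v < dist y u := by
    by_contra hc
    exact Set.disjoint_left.1 h hu (hS.hull_subset hy hv (not_lt.1 hc))
  rw [OrdUlt.lt_iff_of_dist_lt h1, OrdUlt.gt_iff_of_dist_lt h2]

/-- The meet of two singletons is their hull. -/
lemma meetRank_eq {x y : X} {l l' m : Option V} (hl : S l = {x}) (hl' : S l' = {y})
    (hm : S m = hull x y) : hS.toIsParentFun.meetRank l l' = ρ m := by
  refine hS.toIsParentFun.meetRank_eq ?_ ?_ fun z h1 h2 => ?_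
  · rw [hS.le_singleton_iff hl, hm]
    exact left_mem_hull x y
  · rw [hS.le_singleton_iff hl', hm]
    exact right_mem_hull x y
  · rw [hS.le_singleton_iff hl] at h1
    rw [hS.le_singleton_iff hl'] at h2
    rw [hS.le_iff, hm]
    exact hS.hull_subset h1 h2

lemma exists_children {x y : X} (hxy : x ≠ y) {m : Option V} (hm : S m = hull x y) :
    ∃ c c' : V, c ≠ c' ∧ par (some c) = m ∧ par (some c') = m ∧ x ∈ S (some c) ∧
      y ∈ S (some c') := by
  have key : ∀ z, z ∈ S m → ({z} : Set X) ≠ S m → ∃ c : V, par (some c) = m ∧ z ∈ S (some c) := by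
    intro z hz hne
    obtain ⟨l, hl⟩ := hS.exists_eq z z
    rw [hull_self] at hl
    obtain ⟨c, h1, h2, h3⟩ := ((hS.le_singleton_iff hl).2 hz).exists_child
      (by rintro rfl; exact hne hl.symm)
    obtain ⟨c, rfl⟩ := Option.ne_none_iff_exists'.1 h1
    exact ⟨c, h2, (hS.le_singleton_iff hl).1 h3⟩
  have hx : x ∈ S m := hm ▸ left_mem_hull x y
  have hy : y ∈ S m := hm ▸ right_mem_hull x y
  obtain ⟨c, h1, h2⟩ := key x hx (fun h => hxy (h ▸ hy : y ∈ ({x} : Set X)).symm)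
  obtain ⟨c', h3, h4⟩ := key y hy (fun h => hxy (h ▸ hx : x ∈ ({y} : Set X)))
  refine ⟨c, c', ?_, h1, h3, h2, h4⟩
  rintro rfl
  have h5 : S m ⊆ S (some c) := hm ▸ hS.hull_subset h2 h4
  rw [← hS.le_iff, ← h1] at h5
  exact hS.not_le_par (by simp) h5

/-- A ball with at least two points has exactly two children, because the points of the ball
`hull x y` are closer to `x` than `y` is or closer to `y` than `x` is. -/
lemma exists_children_eq {x y : X} (hxy : x ≠ y) {m : Option V} (hm : S m = hull x y) :
    ∃ c c' : V, c ≠ c' ∧ ∀ d, par (some d) = m ↔ d = c ∨ d = c' := by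
  obtain ⟨c, c', hne, h1, h2, h3, h4⟩ := hS.exists_children hxy hm
  refine ⟨c, c', hne, fun d => ⟨fun hd => ?_, ?_⟩⟩
  · have key : ∀ {u v : X} {b : V} {z : X}, u ∈ S m → v ∈ S m → u ∈ S (some b) →
        par (some b) = m → z ∈ S (some d) → dist u z < dist u v → d = b := by
      intro u v b z hu hv hub hb hzd hlt
      obtain ⟨n, hn⟩ := hS.exists_eq u z
      have hzm : z ∈ S m := by
        refine (hS.le_iff _ _).1 ?_ hzd
        exact hd ▸ ParentLE.par_le (by simp)
      have hmn : ParentLE none par m n := by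
        rw [hS.le_iff, hn]
        exact hS.hull_subset hu hzm
      obtain ⟨a, ha1, ha2, ha3⟩ := hmn.exists_child (by
        rintro rfl
        rw [hn] at hv
        exact absurd hlt (not_lt.2 hv))
      rw [hS.le_iff, hn] at ha3
      have h5 : a = some b := by
        by_contra hab
        exact Set.disjoint_left.1 (hS.disjoint_of_children ha1 (by simp) (ha2.trans hb.symm) hab)
          (ha3 (left_mem_hull u z)) hub
      have h6 : a = some d := by
        by_contra had
        exact Set.disjoint_left.1 (hS.disjoint_of_children ha1 (by simp) (ha2.trans hd.symm) had)
          (ha3 (right_mem_hull u z)) hzd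
      exact Option.some.inj (h6.symm.trans h5)
    have hx : x ∈ S m := hm ▸ left_mem_hull x y
    have hy : y ∈ S m := hm ▸ right_mem_hull x y
    obtain ⟨z, hz⟩ := hS.nonempty (some d)
    have hzm : z ∈ hull x y := by
      rw [← hm]
      refine (hS.le_iff _ _).1 ?_ hz
      exact hd ▸ ParentLE.par_le (by simp)
    rcases lt_or_eq_of_le (show dist x z ≤ dist x y from hzm) with h | h
    · exact Or.inl (key hx hy h3 h1 hz h)
    · have h5 := OrdUlt.dist_lt_of_eq h.symm hxy.symm
      rw [dist_comm x y] at h5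
      exact Or.inr (key hy hx h4 h2 hz h5)
  · rintro (rfl | rfl)
    · exact h1
    · exact h2

end IsBallTree

/-- A finite ordered ultrametric space comes from a boron tree: the tree obtained from the balls,
ordered by inclusion, by removal of the whole space. -/
lemma isOrderedBoron_of_ordUlt {X : Type} [MetricSpace X] [LinearOrder X] [OrdUlt X]
    [boronLang.Structure X] [BoronCompat X] [Finite X] : IsOrderedBoron X := by
  classical
  rcases subsingleton_or_nontrivial X with hX | hX
  · right
    have h : ∀ x y : X, ¬ x < y := fun x y h => h.ne (Subsingleton.elim x y)
    exact ⟨hX, fun x y => by simp [BoronCompat.prec_iff, h],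
      fun x y z => by simp [BoronCompat.sep_iff, h]⟩
  obtain ⟨V, _, S, ρ, par, hS⟩ := exists_isBallTree (X := X)
  have hp := hS.toIsParentFun
  have hleaf : ∀ x : X, ∃ v : V, S (some v) = {x} := by
    intro x
    obtain ⟨o, ho⟩ := hS.exists_eq x x
    rw [hull_self] at ho
    rcases o with _ | v
    · rw [hS.root] at ho
      exact absurd ho.symm (Set.singleton_ne_univ x)
    · exact ⟨v, ho⟩
  choose l hl using hleaf
  obtain ⟨a, b, hab, hroot⟩ : ∃ a b : V, a ≠ b ∧ ∀ d, par (some d) = none ↔ d = a ∨ d = b := by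
    obtain ⟨x, y, hxy⟩ := hS.exists_hull none
    refine hS.exists_children_eq (x := x) (y := y) ?_ hxy
    rintro rfl
    rw [hull_self, hS.root] at hxy
    exact Set.singleton_ne_univ x hxy.symm
  obtain ⟨G, hadj, hconn, hacyc, hT⟩ := exists_subdivideEdge hp hab hroot
  have hcases : ∀ v : V, ((G.neighborSet v).ncard = 1 ∧ ∃ x, S (some v) = {x}) ∨
      ((G.neighborSet v).ncard = 3 ∧ ¬ ∃ x, S (some v) = {x}) := by
    intro v
    rw [ncard_neighborSet_of_subdivideEdge hadj hp hT v]
    obtain ⟨x, y, hv⟩ := hS.exists_hull (some v)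
    by_cases hxy : x = y
    · subst hxy
      rw [hull_self] at hv
      exact Or.inl ⟨by rw [hS.ncard_children_singleton hv], x, hv⟩
    · right
      constructor
      · obtain ⟨c, c', h1, h2⟩ := hS.exists_children_eq hxy hv
        have : {d | par (some d) = some v} = {c, c'} := by
          ext d
          simp [h2]
        rw [this, Set.ncard_pair h1]
      · rintro ⟨z, hz⟩
        rw [hz] at hv
        have hx : x ∈ ({z} : Set X) := hv ▸ left_mem_hull x y
        have hy : y ∈ ({z} : Set X) := hv ▸ right_mem_hull x y
        exact hxy (hx.trans hy.symm)
  have hmem : ∀ x, l x ∈ leafSet G := by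
    intro x
    rcases hcases (l x) with h | h
    · exact h.1
    · exact absurd ⟨x, hl x⟩ h.2
  let e : X ≃ leafSet G := Equiv.ofBijective (fun x => ⟨l x, hmem x⟩) (by
    constructor
    · intro x y h
      have h1 : l x = l y := congrArg Subtype.val h
      have h2 := hl x
      rw [h1, hl y] at h2
      exact (Set.singleton_injective h2).symm
    · rintro ⟨v, hv⟩
      rcases hcases v with ⟨-, x, h⟩ | h
      · refine ⟨x, Subtype.ext ?_⟩
        exact Option.some.inj (hS.injective ((hl x).trans h.symm))
      · have h1 : (G.neighborSet v).ncard = 1 := hv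
        omega)
  have he : ∀ x, (e x).1 = l x := fun _ => rfl
  -- distinct children of a vertex are ordered like their points
  choose pt hpt using hS.nonempty
  obtain ⟨n, ⟨idx⟩⟩ := Finite.exists_equiv_fin (Option V)
  let o : LinearOrder (Option V) := LinearOrder.lift' (fun v => toLex (pt v, idx v)) (by
    intro u v h
    have h1 := congrArg (fun p => (ofLex p).2) h
    exact idx.injective h1)
  have ho : ∀ u v, o.lt u v ↔ pt u < pt v ∨ (pt u = pt v ∧ idx u < idx v) := fun u v =>
    Prod.Lex.lt_iff (x := toLex (pt u, idx u)) (y := toLex (pt v, idx v))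
  have hlt : ∀ x y, BranchLT none par o (some (l x)) (some (l y)) ↔ x < y := by
    have key : ∀ {x y c c'}, c ≠ none → c' ≠ none → par c = par c' → c ≠ c' → x ∈ S c → y ∈ S c' →
        (o.lt c c' ↔ x < y) := by
      intro x y c c' h1 h2 h3 h4 h5 h6
      have hd := hS.disjoint_of_children h1 h2 h3 h4
      have hne : pt c ≠ pt c' := fun h => Set.disjoint_left.1 hd (hpt c) (h ▸ hpt c')
      rw [ho, hS.lt_iff_of_disjoint hd h5 (hpt c) h6 (hpt c')]
      simp [hne]
    intro x y
    constructor
    · rintro ⟨c, c', h1, h2, h3, h4, h5, h6⟩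
      rw [hS.le_singleton_iff (hl _)] at h4 h5
      refine (key h1 h2 h3 ?_ h4 h5).1 h6
      rintro rfl
      exact @lt_irrefl _ o.toPreorder _ h6
    · intro h
      obtain ⟨m, hm⟩ := hS.exists_eq x y
      obtain ⟨c, c', h1, h2, h3, h4, h5⟩ := hS.exists_children h.ne hm
      refine ⟨some c, some c', by simp, by simp, h2.trans h3.symm,
        (hS.le_singleton_iff (hl x)).2 h4, (hS.le_singleton_iff (hl y)).2 h5, ?_⟩
      exact (key (by simp) (by simp) (h2.trans h3.symm) (by simpa using h1) h4 h5).2 h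
  have hprec : ∀ x y : X, boronPrec x y ↔
      treeLexLT (subdivideEdge G a b) none o (some (e x).1) (some (e y).1) := by
    intro x y
    rw [hp.treeLexLT_iff hT, he, he, hlt, BoronCompat.prec_iff]
  refine Or.inl ⟨V, inferInstance, G, ⟨hconn, hacyc, fun v => (hcases v).imp And.left And.left⟩,
    a, b, o, e, hadj, hprec, fun x y z => ?_⟩
  rw [BoronCompat.sep_iff, BoronCompat.prec_iff, BoronCompat.prec_iff]
  refine and_congr_right fun hxy => and_congr_right fun hyz => ?_
  obtain ⟨m, hm⟩ := hS.exists_eq x y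
  obtain ⟨m', hm'⟩ := hS.exists_eq y z
  have hmy : ParentLE none par m (some (l y)) := by
    rw [hS.le_singleton_iff (hl y), hm]
    exact right_mem_hull x y
  have hmy' : ParentLE none par m' (some (l y)) := by
    rw [hS.le_singleton_iff (hl y), hm']
    exact left_mem_hull y z
  have hrank : dist x y < dist y z ↔ ρ m' < ρ m := by
    constructor
    · intro h
      refine hp.rank_lt ?_ ?_
      · rw [hS.le_iff, hm]
        refine hS.hull_subset ?_ ?_
        · rw [hm', hull, Set.mem_ofPred_eq, dist_comm y x]
          exact h.le
        · rw [hm']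
          exact left_mem_hull y z
      · rintro rfl
        have h1 : z ∈ hull x y := by
          rw [← hm, hm']
          exact right_mem_hull y z
        have h2 : dist x z ≤ dist x y := h1
        rw [OrdUlt.dist_eq_max hxy hyz] at h2
        exact absurd h (not_lt.2 ((le_max_right _ _).trans h2))
    · intro h
      have h1 := hp.le_of_rank_le hmy' hmy h.le
      rw [hS.le_iff, hm, hm'] at h1
      have h2 : dist y x ≤ dist y z := h1 (left_mem_hull x y)
      rw [dist_comm] at h2
      exact lt_of_le_of_ne h2 (OrdUlt.dist_ne hxy hyz)
  simp only [hp.isTreeMeet_iff hT, hp.dist_root hT, he]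
  rw [hrank]
  constructor
  · intro h
    refine ⟨_, _, (hp.exists_meet _ _).choose_spec, (hp.exists_meet _ _).choose_spec, ?_⟩
    rw [← hS.meetRank_eq (hl x) (hl y) hm, ← hS.meetRank_eq (hl y) (hl z) hm'] at h
    exact h
  · rintro ⟨n, n', ⟨k1, k2, k3⟩, ⟨k4, k5, k6⟩, k7⟩
    rwa [← hp.meetRank_eq k1 k2 k3, ← hp.meetRank_eq k4 k5 k6, hS.meetRank_eq (hl y) (hl z) hm',
      hS.meetRank_eq (hl x) (hl y) hm] at k7

/-! ### The equivalence of categories -/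

section Equivalence

lemma OrdUlt.isConvexOrder {X : Type} [MetricSpace X] [LinearOrder X] [OrdUlt X] :
    IsConvexOrder X := fun _ _ _ hxy hyz => by
  rw [OrdUlt.dist_eq_max hxy hyz]
  exact le_max_left _ _

lemma OrdUlt.polygonsBoundedBy {X : Type} [MetricSpace X] [LinearOrder X] [OrdUlt X] :
    PolygonsBoundedBy 2 X := by
  intro r P _ hP
  by_contra hcard
  obtain ⟨Q, hQ, hQ3⟩ := Set.exists_subset_encard_eq
    (show (3 : ℕ∞) ≤ P.encard from Order.add_one_le_of_lt (not_le.1 hcard))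
  obtain ⟨x, y, z, hxy, hxz, hyz, rfl⟩ := Set.encard_eq_three.1 hQ3
  have hx := hQ (show x ∈ ({x, y, z} : Set X) by simp)
  have hy := hQ (show y ∈ ({x, y, z} : Set X) by simp)
  have hz := hQ (show z ∈ ({x, y, z} : Set X) by simp)
  have key : ∀ x ∈ P, ∀ y ∈ P, ∀ z ∈ P, x < y → y < z → False := fun x hx y hy z hz hxy hyz =>
    OrdUlt.dist_ne hxy hyz ((hP x hx y hy hxy.ne).trans (hP y hy z hz hyz.ne).symm)
  rcases lt_or_gt_of_ne hxy with h1 | h1 <;> rcases lt_or_gt_of_ne hyz with h2 | h2 <;>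
    rcases lt_or_gt_of_ne hxz with h3 | h3
  · exact key x hx y hy z hz h1 h2
  · exact key x hx y hy z hz h1 h2
  · exact key x hx z hz y hy h3 h2
  · exact key z hz x hx y hy h3 h1
  · exact key y hy x hx z hz h1 h3
  · exact key y hy z hz x hx h2 h3
  · exact key z hz y hy x hx h2 h1
  · exact key z hz y hy x hx h2 h1

lemma ordUlt_of_isConvexOrder {X : Type} [MetricSpace X] [LinearOrder X] [IsUltrametricDist X]
    (hc : IsConvexOrder X) (hP : PolygonsBoundedBy 2 X) : OrdUlt X := by
  have hmax : ∀ {x y z : X}, x < y → y < z → dist x z = max (dist x y) (dist y z) := by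
    intro x y z hxy hyz
    have h1 := hc x y z hxy hyz
    refine le_antisymm (IsUltrametricDist.dist_triangle_max x y z) (max_le h1 ?_)
    have h2 := IsUltrametricDist.dist_triangle_max y x z
    rw [dist_comm y x] at h2
    exact h2.trans (max_le h1 le_rfl)
  refine ⟨hmax, fun {x y z} hxy hyz h => ?_⟩
  have hxz : dist x z = dist x y := by rw [hmax hxy hyz, ← h, max_self]
  have h2 := dist_comm x y
  have h3 := dist_comm y z
  have h4 := dist_comm x z
  have h1 := hP (dist x y) {x, y, z} (dist_pos.2 hxy.ne) (by
    rintro u (rfl | rfl | rfl) v (rfl | rfl | rfl) huv <;>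
      first
      | exact absurd rfl huv
      | linarith)
  rw [Set.encard_eq_three.2 ⟨x, y, z, hxy.ne, (hxy.trans hyz).ne, hyz.ne, rfl⟩] at h1
  exact absurd h1 (by norm_num)

/-- The boron structure defined by the order and the metric. -/
@[reducible]
def boronStructure (X : Type) [MetricSpace X] [LinearOrder X] : boronLang.Structure X where
  funMap φ := isEmptyElim φ
  RelMap := fun
    | BoronRel.prec => fun v => v 0 < v 1
    | BoronRel.sep => fun v => v 0 < v 1 ∧ v 1 < v 2 ∧ dist (v 0) (v 1) < dist (v 1) (v 2)

lemma boronCompat_boronStructure (X : Type) [MetricSpace X] [LinearOrder X] :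
    letI := boronStructure X
    BoronCompat X :=
  letI := boronStructure X
  { prec_iff := fun _ _ => Iff.rfl
    sep_iff := fun _ _ _ => Iff.rfl }

/-- The morphisms of the two categories are the same maps. -/
lemma strictMono_and_isBPEmbedding_iff {X Y : Type} [boronLang.Structure X] [MetricSpace X]
    [LinearOrder X] [OrdUlt X] [BoronCompat X] [Finite X] [boronLang.Structure Y] [MetricSpace Y]
    [LinearOrder Y] [OrdUlt Y] [BoronCompat Y] {f : X → Y} :
    StrictMono f ∧ IsBPEmbedding f ↔ (∀ x y, boronPrec (f x) (f y) ↔ boronPrec x y) ∧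
      ∀ x y z, boronSep (f x) (f y) (f z) ↔ boronSep x y z := by
  rw [boron_maps_iff, isBPEmbedding_iff]
  constructor
  · rintro ⟨h1, -, h2⟩
    refine ⟨fun x y => h1.lt_iff_lt.symm, fun x y z => ?_⟩
    rw [dist_comm x y, h2, dist_comm (f x) (f y)]
  · rintro ⟨h1, h2⟩
    have hf : StrictMono f := fun x y h => (h1 x y).1 h
    refine ⟨hf, hf.injective, fun x y z => ?_⟩
    rw [dist_comm x y, h2, dist_comm (f x) (f y)]

namespace OrderedBoron

/-- A metric for which the structure is that of an ordered ultrametric space; it is not unique. -/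
@[reducible]
noncomputable def metric (C : OrderedBoron) : MetricSpace C.carrier :=
  C.isOrderedBoron.exists_metric.2.choose

/-- The order of an ordered boron tree structure. -/
@[reducible]
noncomputable def order (C : OrderedBoron) : LinearOrder C.carrier :=
  C.isOrderedBoron.exists_metric.2.choose_spec.choose

attribute [local instance] metric order

lemma metric_spec (C : OrderedBoron) : OrdUlt C.carrier ∧ BoronCompat C.carrier ∧
    ∀ x y : C.carrier, ∃ q : ℚ, dist x y = q :=
  C.isOrderedBoron.exists_metric.2.choose_spec.choose_spec

lemma finite_carrier (C : OrderedBoron) : Finite C.carrier :=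
  C.isOrderedBoron.exists_metric.1

variable {D : Set ℝ} (hD : ∀ q : ℚ, (q : ℝ) ∈ D)

/-- The ordered ultrametric space of an ordered boron tree structure, with rational distances. -/
noncomputable def toSpace (C : OrderedBoron) : FinOrdUltrametric 2 D :=
  have := C.metric_spec.1
  have := C.finite_carrier
  { carrier := C.carrier
    convex := OrdUlt.isConvexOrder
    polygons := OrdUlt.polygonsBoundedBy
    dist_mem := fun x y => by
      obtain ⟨q, h⟩ := C.metric_spec.2.2 x y
      exact h ▸ hD q }

lemma hom_iff {C C' : OrderedBoron} {f : C.carrier → C'.carrier} :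
    StrictMono f ∧ IsBPEmbedding f ↔ (∀ x y, boronPrec (f x) (f y) ↔ boronPrec x y) ∧
      ∀ x y z, boronSep (f x) (f y) (f z) ↔ boronSep x y z := by
  have := C.metric_spec.1
  have := C'.metric_spec.1
  have := C.metric_spec.2.1
  have := C'.metric_spec.2.1
  have := C.finite_carrier
  exact strictMono_and_isBPEmbedding_iff

/-- The functor from ordered boron tree structures to ordered ultrametric spaces, the identity on
points and maps. -/
noncomputable def spaceFunctor : OrderedBoron ⥤ FinOrdUltrametric 2 D where
  obj C := C.toSpace hD
  map {C C'} f := ⟨mapOf f, (hom_iff (C := C) (C' := C')).2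
    ⟨boronPrec_map (show boronLang.Embedding C.carrier C'.carrier from f),
      boronSep_map (show boronLang.Embedding C.carrier C'.carrier from f)⟩⟩
  map_id _ := rfl
  map_comp _ _ := rfl

instance : (spaceFunctor hD).Faithful where
  map_injective {C C'} _ _ h :=
    DFunLike.coe_injective (F := boronLang.Embedding C.carrier C'.carrier)
      (congrArg Subtype.val h)

instance : (spaceFunctor hD).Full where
  map_surjective {C C'} g := by
    have h := (hom_iff (C := C) (C' := C')).1 g.2
    exact ⟨boronEmbedding g.1 g.2.1.injective h.1 h.2, rfl⟩

instance : (spaceFunctor hD).EssSurj where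
  mem_essImage X := by
    let := boronStructure X.carrier
    have := boronCompat_boronStructure X.carrier
    have := ordUlt_of_isConvexOrder X.convex X.polygons
    let C : OrderedBoron := ⟨X.carrier, isOrderedBoron_of_ordUlt⟩
    have h1 := C.metric_spec.1
    have h2 := C.metric_spec.2.1
    have h3 : Finite C.carrier := X.finite
    have h4 := (@strictMono_and_isBPEmbedding_iff C.carrier X.carrier C.str C.metric C.order h1 h2
      h3 _ _ _ _ _ id).2 ⟨fun _ _ => Iff.rfl, fun _ _ _ => Iff.rfl⟩
    have h5 := (@strictMono_and_isBPEmbedding_iff X.carrier C.carrier _ _ _ _ _ _ C.str C.metric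
      C.order h1 h2 id).2 ⟨fun _ _ => Iff.rfl, fun _ _ _ => Iff.rfl⟩
    exact ⟨C, ⟨⟨⟨id, h4⟩, ⟨id, h5⟩, rfl, rfl⟩⟩⟩

instance : (spaceFunctor hD).IsEquivalence where

end OrderedBoron

/-- The equivalence of categories, for any set `D` of distances that contains the rationals. -/
lemma exists_equivalence {D : Set ℝ} (hD : ∀ q : ℚ, (q : ℝ) ∈ D) :
    ∃ (F : OrderedBoron ≌ FinOrdUltrametric 2 D)
      (u : ∀ C : OrderedBoron, C.carrier ≃ (F.functor.obj C).carrier),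
      (∀ (C : OrderedBoron) (x y : C.carrier), boronPrec x y ↔ u C x < u C y) ∧
      (∀ (C C' : OrderedBoron) (f : C ⟶ C') (x : C.carrier),
        u C' (OrderedBoron.mapOf f x) = FinOrdUltrametric.mapOf (F.functor.map f) (u C x)) := by
  refine ⟨(OrderedBoron.spaceFunctor hD).asEquivalence, fun C => Equiv.refl C.carrier,
    fun C x y => ?_, fun _ _ _ _ => rfl⟩
  let := C.metric
  let := C.order
  have := C.metric_spec.2.1
  exact BoronCompat.prec_iff x y

end Equivalence

/-! ### The Fraïssé limit -/

section FraisseLimit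

open FirstOrder Language

/-- Metric and order pull back along embeddings of structures. -/
lemma exists_metric_of_embedding {C M : Type} [boronLang.Structure C] [boronLang.Structure M]
    [MetricSpace M] [LinearOrder M] [OrdUlt M] [BoronCompat M] (g : boronLang.Embedding C M) :
    ∃ (_ : MetricSpace C) (_ : LinearOrder C), OrdUlt C ∧ BoronCompat C ∧
      (∀ x y : C, x < y ↔ g x < g y) ∧ ∀ x y : C, dist x y = dist (g x) (g y) := by
  let m : MetricSpace C := MetricSpace.induced g g.injective inferInstance
  let o : LinearOrder C := LinearOrder.lift' g g.injective
  have hlt : ∀ x y : C, x < y ↔ g x < g y := fun _ _ => Iff.rfl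
  have hdist : ∀ x y : C, dist x y = dist (g x) (g y) := fun _ _ => rfl
  refine ⟨m, o, ?_, ⟨fun x y => ?_, fun x y z => ?_⟩, hlt, hdist⟩
  · exact
      { toIsUltrametricDist := ⟨fun x y z => IsUltrametricDist.dist_triangle_max (g x) (g y) (g z)⟩
        dist_eq_max := fun {x y z} hxy hyz =>
          OrdUlt.dist_eq_max (x := g x) (y := g y) (z := g z) hxy hyz
        dist_ne := fun {x y z} hxy hyz =>
          OrdUlt.dist_ne (x := g x) (y := g y) (z := g z) hxy hyz }
  · rw [← boronPrec_map g, BoronCompat.prec_iff, hlt]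
  · rw [← boronSep_map g, BoronCompat.sep_iff, hlt, hlt, hdist, hdist]

lemma isUniversalOrderedBoronTree_of_rich {M : Type} [boronLang.Structure M] [MetricSpace M]
    [LinearOrder M] [RichOrdUlt M] [BoronCompat M] : IsUniversalOrderedBoronTree M := by
  have : Countable M := RichOrdUlt.countable
  refine ⟨this, fun S hS f => ?_, ?_⟩
  · have := hS.finite
    obtain ⟨_, _, _, _, hlt, hdist⟩ := exists_metric_of_embedding S.subtype
    obtain ⟨h1, h2⟩ := boron_maps_iff.1 ⟨boronPrec_map f, boronSep_map f⟩
    let H : Set (M × M) := Set.range fun s : S => ((s : M), f s)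
    have hH : IsPartialIso H := by
      constructor
      · rintro _ _ ⟨s, rfl⟩ ⟨t, rfl⟩
        exact (hlt s t).symm.trans (h1 s t)
      · rintro _ _ _ ⟨s, rfl⟩ ⟨t, rfl⟩ ⟨u, rfl⟩
        have h3 := h2 s t u
        rw [hdist, hdist] at h3
        exact h3
    obtain ⟨e, h3, h4⟩ := hH.exists_isoGroup (Set.finite_range _)
    rw [← autGroup_eq_isoGroup] at h3
    obtain ⟨φ, rfl⟩ := h3
    refine ⟨φ, DFunLike.ext _ _ fun s => ?_⟩
    exact (h4 _ ⟨s, rfl⟩).symm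
  · ext N
    constructor
    · rintro ⟨hN, ⟨g⟩⟩
      have : Finite N := hN.finite
      obtain ⟨_, _, _, _, -⟩ := exists_metric_of_embedding g
      exact isOrderedBoron_of_ordUlt
    · intro hN
      obtain ⟨_, _, _, _, _, -⟩ := IsOrderedBoron.exists_metric hN
      obtain ⟨e, he⟩ := exists_embedding_of_finite (X := N) (Y := M)
      have h := boron_maps_iff.2 ⟨fun x y => he.lt_iff (p := (x, e x)) (q := (y, e y)) rfl rfl,
        fun x y z => he.dist_iff (p := (x, e x)) (q := (y, e y)) (r := (z, e z)) rfl rfl rfl⟩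
      refine ⟨Structure.fg_iff_finite.2 inferInstance, ⟨boronEmbedding e ?_ h.1 h.2⟩⟩
      exact fun x y hxy => (he.eq_iff (p := (x, e x)) (q := (y, e y)) rfl rfl).2 hxy

noncomputable instance : boronLang.Structure TreePoint := boronStructure TreePoint

instance : BoronCompat TreePoint := boronCompat_boronStructure TreePoint

/-- By uniqueness of Fraïssé limits, every universal ordered boron tree is a rich ordered
ultrametric space. -/
lemma IsUniversalOrderedBoronTree.exists_metric {M : Type} [boronLang.Structure M]
    (hM : IsUniversalOrderedBoronTree M) :
    ∃ (_ : MetricSpace M) (_ : LinearOrder M), RichOrdUlt M ∧ BoronCompat M := by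
  obtain ⟨_, hM⟩ := hM
  obtain ⟨_, hT⟩ := isUniversalOrderedBoronTree_of_rich (M := TreePoint)
  obtain ⟨φ⟩ := hM.nonempty_equiv hT
  obtain ⟨_, _, _, hcompat, hlt, hdist⟩ := exists_metric_of_embedding φ.toEmbedding
  refine ⟨_, _, ⟨inferInstance, ?_, fun f Z W hZ hW hf hZW left => ?_⟩, hcompat⟩
  · obtain ⟨t⟩ := RichOrdUlt.nonempty (X := TreePoint)
    exact ⟨φ.symm t⟩
  · have hdist' : ∀ x y, dist x y = dist (φ x) (φ y) := hdist
    have hlt' : ∀ x y, x < y ↔ φ x < φ y := hlt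
    obtain ⟨t, h1, h2, h3, h4⟩ := RichOrdUlt.exists_insert (φ f) (φ '' Z) (φ '' W) (hZ.image _)
      (hW.image _) (by rwa [φ.injective.mem_set_image]) (by
        rintro _ ⟨z, hz, rfl⟩ _ ⟨w, hw, rfl⟩
        rw [← hdist', ← hdist']
        exact hZW z hz w hw) left
    obtain ⟨u, rfl⟩ := φ.surjective t
    refine ⟨u, fun h => h1 (congrArg φ h), by rw [hlt', h2], fun z hz => ?_, fun w hw => ?_⟩
    · rw [hdist', hdist']
      exact h3 _ ⟨z, hz, rfl⟩
    · rw [hdist', hdist']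
      exact h4 _ ⟨w, hw, rfl⟩

end FraisseLimit

theorem mainTheorem7 :
    (∀ D ∈ ({Set.univ, Set.range ((↑) : ℚ → ℝ)} : Set (Set ℝ)),
      ∃ (F : OrderedBoron ≌ FinOrdUltrametric 2 D)
        (u : ∀ C : OrderedBoron, C.carrier ≃ (F.functor.obj C).carrier),
        (∀ (C : OrderedBoron) (x y : C.carrier), boronPrec x y ↔ u C x < u C y) ∧
        (∀ (C C' : OrderedBoron) (f : C ⟶ C') (x : C.carrier),
          u C' (OrderedBoron.mapOf f x) = FinOrdUltrametric.mapOf (F.functor.map f) (u C x))) ∧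
    (∃ (M : Type) (_ : boronLang.Structure M), IsUniversalOrderedBoronTree M) ∧
    (∀ (M : Type) [boronLang.Structure M], IsUniversalOrderedBoronTree M →
      HasComeagerConjClass (autGroup boronLang M) ∧
      ¬ HasComeagerDiagonalClass (autGroup boronLang M) 2) := by
  refine ⟨fun D hD => exists_equivalence fun q => ?_,
    ⟨TreePoint, inferInstance, isUniversalOrderedBoronTree_of_rich⟩, fun M _ hM => ?_⟩
  · rcases hD with rfl | rfl
    · exact Set.mem_univ _
    · exact ⟨q, rfl⟩
  · obtain ⟨_, _, _, _⟩ := hM.exists_metric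
    exact ⟨hasComeagerConjClass, not_hasComeagerDiagonalClass⟩
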